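/- **Theorem (Learning shallow circuits with many-qubit gates).** Let $d \ge 0$ be a constant and let $p$ be a nonzero polynomial with coefficients in $\mathbb{N}$. A depth-$d$ $\mathsf{QAC}^0$ circuit on $n$ qubits without ancillas consists of $d$ layers of $CZ$ gates, with arbitrary single-qubit gates before, between and after these layers; the gates in one layer act on pairwise disjoint nonempty sets of qubits of arbitrary size, and the $CZ$ gate on a set $S$ of qubits multiplies a computational basis state by $-1$ if all qubits in $S$ are $1$ and fixes it otherwise. There are a randomized learning algorithm and a constant $K$ (depending only on $d$ and $p$) such that the following holds for every $n \ge 1$, every $\delta \in (0,1)$ and every unitary $C$ implemented by an $n$-qubit, depth-$d$ $\mathsf{QAC}^0$ circuit. The algorithm is given $n$ and $\lceil \log_2(1/\delta)\rceil$, and its only access to $C$ is by experiments, each of which prepares a product of single-qubit stabilizer states, applies $C$ or $C^\dagger$, and measures every qubit in a Pauli basis, all chosen by the algorithm. With probability at least $1-\delta$ it outputs an explicit description (a list of gates, each given by the qubits it acts on and a unitary matrix with entries in $\mathbb{Q}[i]$) of a $2n$-qubit unitary $C_{\mathrm{sew}}$ with $$\mathcal{D}_{\mathrm{avg}}(C_{\mathrm{sew}},\,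 C\otimes C^\dagger)\ \le\ \frac{1}{p(n)},$$ and it always uses at most $$K\, n^{K (\log n)^d}\,\bigl(1+\log(1/\delta)\bigr)$$ experiments and at most this many time steps. Here $$\mathcal{D}_{\mathrm{avg}}(U,V)=\mathbb{E}_{|\psi\rangle\sim\mathrm{Haar}}\bigl[1-\mathcal{F}(U|\psi\rangle\langle\psi|U^\dagger,\,V|\psi\rangle\langle\psi|V^\dagger)\bigr],\qquad \mathcal{F}(\rho,\sigma)=\Bigl(\mathrm{Tr}\sqrt{\sqrt{\rho}\,\sigma\sqrt{\rho}}\Bigr)^2,$$ and time is counted on a random-access machine with integer memory cells in which each addition, subtraction, memory access, fair coin flip, test, loop iteration and output of a number costs one step, and each experiment costs $4n+1$ steps. -/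

import Mathlib

open MeasureTheory Matrix

noncomputable section

namespace QACLearning

/-! ### Qubit registers and unitaries -/

/-- Labels of the computational basis of an `m`-qubit register. -/
abbrev Bits (m : ℕ) : Type := Fin m → Fin 2

/-- Operators on an `m`-qubit register, written in the computational basis. -/
abbrev Op (m : ℕ) : Type := Matrix (Bits m) (Bits m) ℂ

/-- Unitary operators on an `m`-qubit register. -/
abbrev UnitaryOp (m : ℕ) : Type := Matrix.unitaryGroup (Bits m) ℂ

theorem submatrix_equiv_mem_unitary {α β : Type} [Fintype α] [DecidableEq α] [Fintype β]
    [DecidableEq β] (e : α ≃ β) {A : Matrix β β ℂ} (hA : A ∈ Matrix.unitaryGroup β ℂ) :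
    A.submatrix e e ∈ Matrix.unitaryGroup α ℂ := by
  rw [Matrix.mem_unitaryGroup_iff, Matrix.star_eq_conjTranspose, Matrix.conjTranspose_submatrix,
    Matrix.submatrix_mul_equiv, ← Matrix.star_eq_conjTranspose,
    Matrix.mem_unitaryGroup_iff.mp hA, Matrix.submatrix_one_equiv]

/-- The tensor product `A 0 ⊗ A 1 ⊗ ⋯` of single-qubit operators. -/
def tensorAll {m : ℕ} (A : Fin m → Matrix (Fin 2) (Fin 2) ℂ) : Op m :=
  Matrix.of fun x y => ∏ i, A i (x i) (y i)

theorem tensorAll_mem {m : ℕ} (u : Fin m → Matrix.unitaryGroup (Fin 2) ℂ) :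
    tensorAll (fun i => (u i : Matrix (Fin 2) (Fin 2) ℂ)) ∈ Matrix.unitaryGroup (Bits m) ℂ := by
  rw [Matrix.mem_unitaryGroup_iff]
  ext x z
  have key : ∀ i, ∑ b, (u i : Matrix (Fin 2) (Fin 2) ℂ) (x i) b *
      star ((u i : Matrix (Fin 2) (Fin 2) ℂ) (z i) b) = if x i = z i then 1 else 0 := by
    intro i
    have h := congrFun (congrFun (Matrix.mem_unitaryGroup_iff.mp (u i).2) (x i)) (z i)
    simpa [Matrix.mul_apply, Matrix.one_apply] using h
  rw [Matrix.mul_apply]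
  simp only [tensorAll, Matrix.of_apply, Matrix.star_apply, star_prod, ← Finset.prod_mul_distrib]
  rw [← Fintype.prod_sum (fun i b => (u i : Matrix (Fin 2) (Fin 2) ℂ) (x i) b *
      star ((u i : Matrix (Fin 2) (Fin 2) ℂ) (z i) b))]
  simp only [key, Matrix.one_apply, Finset.prod_ite_zero, Finset.prod_const_one, funext_iff,
    Finset.mem_univ, true_imp_iff]

/-- The tensor product of single-qubit unitaries. -/
def tensorUnitary {m : ℕ} (u : Fin m → Matrix.unitaryGroup (Fin 2) ℂ) : UnitaryOp m :=
  ⟨tensorAll fun i => (u i : Matrix (Fin 2) (Fin 2) ℂ), tensorAll_mem u⟩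

/-- `A ⊗ B` on `n + n` qubits: `A` acts on the first `n` qubits and `B` on the last `n`. -/
def tensorPair {n : ℕ} (A B : Op n) : Op (n + n) :=
  Matrix.of fun x y =>
    A (fun i => x (Fin.castAdd n i)) (fun i => y (Fin.castAdd n i)) *
      B (fun i => x (Fin.natAdd n i)) (fun i => y (Fin.natAdd n i))

theorem tensorPair_mem {n : ℕ} (A B : UnitaryOp n) :
    tensorPair (A : Op n) (B : Op n) ∈ Matrix.unitaryGroup (Bits (n + n)) ℂ := by
  have h := submatrix_equiv_mem_unitary (Fin.appendEquiv (α := Fin 2) n n).symm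
    (Matrix.kronecker_mem_unitary A.2 B.2)
  exact h

/-- `A ⊗ B` for unitaries. -/
def tensorPairUnitary {n : ℕ} (A B : UnitaryOp n) : UnitaryOp (n + n) :=
  ⟨tensorPair (A : Op n) (B : Op n), tensorPair_mem A B⟩

/-! ### Constant-depth circuits with many-qubit `CZ` gates -/

/-- One layer of `CZ` gates: finitely many gates acting on nonempty, pairwise disjoint sets of
qubits, of arbitrary width. -/
structure CZLayer (n : ℕ) where
  gates : Finset (Finset (Fin n))
  nonempty : ∀ S ∈ gates, S.Nonempty
  disjoint : ∀ S ∈ gates, ∀ T ∈ gates, S ≠ T → Disjoint S T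

/-- The phase that the `CZ` gate on the qubits in `S` gives to the basis state `x`. -/
def czPhase {n : ℕ} (S : Finset (Fin n)) (x : Bits n) : ℂ :=
  if ∀ i ∈ S, x i = 1 then -1 else 1

/-- The operator of a layer: the product of its (commuting, diagonal) `CZ` gates. -/
def CZLayer.op {n : ℕ} (L : CZLayer n) : Op n :=
  Matrix.diagonal fun x => ∏ S ∈ L.gates, czPhase S x

theorem CZLayer.op_mem {n : ℕ} (L : CZLayer n) : L.op ∈ Matrix.unitaryGroup (Bits n) ℂ := by
  rw [Matrix.mem_unitaryGroup_iff, Matrix.star_eq_conjTranspose, CZLayer.op,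
    Matrix.diagonal_conjTranspose, Matrix.diagonal_mul_diagonal, ← Matrix.diagonal_one]
  congr 1
  funext x
  rw [Pi.star_apply, star_prod, ← Finset.prod_mul_distrib]
  refine Finset.prod_eq_one fun S _ => ?_
  unfold czPhase
  split <;> simp

/-- `n`-qubit circuits without ancillas that consist of `d` layers of `CZ` gates of unbounded width
(the depth), with arbitrary single-qubit gates before, between and after them. -/
inductive QACCircuit (n : ℕ) : ℕ → Type
  | single (u : Fin n → Matrix.unitaryGroup (Fin 2) ℂ) : QACCircuit n 0
  | layer {d : ℕ} (C : QACCircuit n d) (L : CZLayer n)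
      (u : Fin n → Matrix.unitaryGroup (Fin 2) ℂ) : QACCircuit n (d + 1)

/-- The unitary implemented by a circuit. In `layer C L u` the circuit `C` acts first, then the
`CZ` gates in `L`, then the single-qubit gates `u`. -/
def QACCircuit.unitary {n : ℕ} : {d : ℕ} → QACCircuit n d → UnitaryOp n
  | _, .single u => tensorUnitary u
  | _, .layer C L u => tensorUnitary u * ⟨L.op, L.op_mem⟩ * C.unitary

/-! ### Average-case distance -/

open scoped MatrixOrder in
/-- The fidelity `(Tr √(√ρ σ √ρ))²` of two states. -/
def fidelity {ι : Type} [Fintype ι] [DecidableEq ι] (ρ σ : Matrix ι ι ℂ) : ℝ :=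
  (Matrix.trace (CFC.sqrt (CFC.sqrt ρ * σ * CFC.sqrt ρ))).re ^ 2

/-- Pure states of an `m`-qubit register: unit vectors of `ℂ^(2^m)`. -/
abbrev PureState (m : ℕ) : Type := Metric.sphere (0 : EuclideanSpace ℂ (Bits m)) 1

/-- The density matrix `|ψ⟩⟨ψ|`. -/
def ketbra {m : ℕ} (ψ : PureState m) : Op m :=
  Matrix.of fun x y => ψ.1 x * star (ψ.1 y)

/-- The Haar measure on pure states: the uniform probability measure on the unit sphere. -/
def haarState (m : ℕ) : Measure (PureState m) :=
  ((volume : Measure (EuclideanSpace ℂ (Bits m))).toSphere Set.univ)⁻¹ •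
    (volume : Measure (EuclideanSpace ℂ (Bits m))).toSphere

instance haarState_isProbabilityMeasure (m : ℕ) : IsProbabilityMeasure (haarState m) := by
  constructor
  rw [haarState, Measure.smul_apply, smul_eq_mul]
  refine ENNReal.inv_mul_cancel ?_ (measure_ne_top _ _)
  rw [Ne, Measure.measure_univ_eq_zero]
  exact Measure.toSphere_ne_zero _

/-- The average-case distance of two maps on `m`-qubit states. -/
def channelDist {m : ℕ} (E₁ E₂ : Op m → Op m) : ℝ :=
  ∫ ψ, (1 - fidelity (E₁ (ketbra ψ)) (E₂ (ketbra ψ))) ∂(haarState m)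

/-- The unitary channel `ρ ↦ U ρ U†`. -/
def unitaryChannel {m : ℕ} (U : UnitaryOp m) (ρ : Op m) : Op m :=
  (U : Op m) * ρ * star (U : Op m)

/-- The average-case distance of two unitaries is that of their channels. -/
def avgDist {m : ℕ} (U V : UnitaryOp m) : ℝ :=
  channelDist (unitaryChannel U) (unitaryChannel V)

/-! ### Explicit descriptions of unitaries -/

/-- The matrix with entries `(re + i im) / den`. -/
def ratMatrix (N : ℕ) (den : ℕ) (re im : Fin N → Fin N → ℤ) : Matrix (Fin N) (Fin N) ℂ :=
  Matrix.of fun r c => ((re r c : ℂ) + (im r c : ℂ) * Complex.I) / (den : ℂ)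

/-- A gate on `arity` of the `m` qubits: the list of qubits it acts on and its unitary matrix,
given entry by entry. -/
structure MatrixGate (m : ℕ) where
  arity : ℕ
  wire : Fin arity ↪ Fin m
  den : ℕ
  re : Fin (2 ^ arity) → Fin (2 ^ arity) → ℤ
  im : Fin (2 ^ arity) → Fin (2 ^ arity) → ℤ
  isUnitary : ratMatrix (2 ^ arity) den re im ∈ Matrix.unitaryGroup (Fin (2 ^ arity)) ℂ

/-- The operator `M` on the qubits `w 0, w 1, …` tensored with the identity on the other qubits.
The rows and columns of `M` are numbered by the binary numbers that the bits on the qubits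
`w 0, w 1, …` form, least significant bit first. -/
def onWires {m k : ℕ} (w : Fin k ↪ Fin m) (M : Matrix (Fin (2 ^ k)) (Fin (2 ^ k)) ℂ) : Op m :=
  open Classical in
  Matrix.of fun x y =>
    if ∀ i, i ∉ Set.range w → x i = y i then
      M (finFunctionFinEquiv fun j => x (w j)) (finFunctionFinEquiv fun j => y (w j))
    else 0

theorem onWires_mem {m k : ℕ} (w : Fin k ↪ Fin m) {M : Matrix (Fin (2 ^ k)) (Fin (2 ^ k)) ℂ}
    (hM : M ∈ Matrix.unitaryGroup (Fin (2 ^ k)) ℂ) :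
    onWires w M ∈ Matrix.unitaryGroup (Bits m) ℂ := by
  classical
  let e := Equiv.piEquivPiSubtypeProd (fun i : Fin m => i ∈ Set.range w) (fun _ => Fin 2)
  let g : ({i : Fin m // i ∈ Set.range w} → Fin 2) ≃ Fin (2 ^ k) :=
    (Equiv.arrowCongr (Equiv.ofInjective w w.injective).symm (Equiv.refl _)).trans
      finFunctionFinEquiv
  have h1 := submatrix_equiv_mem_unitary g hM
  have h2 := submatrix_equiv_mem_unitary e (Matrix.kronecker_mem_unitary h1
    (one_mem (Matrix.unitaryGroup ({i : Fin m // i ∉ Set.range w} → Fin 2) ℂ)))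
  convert h2 using 1
  ext x y
  simp only [onWires, Matrix.of_apply, Matrix.submatrix_apply, Matrix.kroneckerMap_apply,
    Matrix.one_apply, mul_ite, mul_one, mul_zero]
  congr 1
  simp [e, funext_iff]

/-- The unitary on the whole register that a gate implements. -/
def MatrixGate.unitary {m : ℕ} (g : MatrixGate m) : UnitaryOp m :=
  ⟨onWires g.wire (ratMatrix (2 ^ g.arity) g.den g.re g.im), onWires_mem g.wire g.isUnitary⟩

/-- A gate written out as a list of integers: its arity, its qubits, the common denominator, and
the real and imaginary numerators of all entries, row by row. -/
def MatrixGate.encode {m : ℕ} (g : MatrixGate m) : List ℤ :=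
  (g.arity : ℤ) :: (List.ofFn fun j => ((g.wire j : ℕ) : ℤ)) ++ (g.den : ℤ) ::
    (List.ofFn fun r => (List.ofFn fun c => [g.re r c, g.im r c]).flatten).flatten

/-- The unitary that a list of gates implements; the head of the list acts first. -/
def circuitUnitary {m : ℕ} : List (MatrixGate m) → UnitaryOp m
  | [] => 1
  | g :: gs => circuitUnitary gs * g.unitary

/-- A list of gates written out as a list of integers. -/
def encodeCircuit {m : ℕ} (gs : List (MatrixGate m)) : List ℤ :=
  gs.flatMap MatrixGate.encode

/-! ### Experiments on the unknown unitary -/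

/-- The three nontrivial single-qubit Pauli operators, as labels of their eigenbases. -/
inductive Axis
  | X
  | Y
  | Z

/-- The matrix whose columns `0` and `1` are the eigenvectors of the Pauli operator for the
eigenvalues `+1` and `-1`. -/
def Axis.basis : Axis → Matrix (Fin 2) (Fin 2) ℂ
  | .X => !![1 / (Real.sqrt 2 : ℂ), 1 / (Real.sqrt 2 : ℂ);
      1 / (Real.sqrt 2 : ℂ), -1 / (Real.sqrt 2 : ℂ)]
  | .Y => !![1 / (Real.sqrt 2 : ℂ), 1 / (Real.sqrt 2 : ℂ);
      Complex.I / (Real.sqrt 2 : ℂ), -Complex.I / (Real.sqrt 2 : ℂ)]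
  | .Z => !![1, 0; 0, 1]

theorem Axis.basis_mem (a : Axis) : a.basis ∈ Matrix.unitaryGroup (Fin 2) ℂ := by
  have h : (Real.sqrt 2 : ℂ) * (Real.sqrt 2 : ℂ) = 2 := by
    rw [← Complex.ofReal_mul, Real.mul_self_sqrt (by norm_num)]
    norm_num
  have h0 : (Real.sqrt 2 : ℂ) ≠ 0 := by
    intro h0
    rw [h0] at h
    norm_num at h
  rw [Matrix.mem_unitaryGroup_iff]
  cases a <;> ext i j <;> fin_cases i <;> fin_cases j <;>
    simp [Axis.basis, Matrix.mul_apply, Fin.sum_univ_two, Matrix.star_apply, Complex.conj_ofReal] <;>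
    field_simp <;> simp [pow_two, h] <;> norm_num

/-- The change of basis from computational basis states to products of Pauli eigenstates. -/
def productBasis {n : ℕ} (a : Fin n → Axis) : UnitaryOp n :=
  tensorUnitary fun i => ⟨(a i).basis, (a i).basis_mem⟩

/-- The amplitude of the outcome `y` when the product stabilizer state with axes `a` and bits `x`
is sent through `U` and every qubit `i` of the result is measured in the eigenbasis of `c i`. -/
def amplitude {n : ℕ} (U : UnitaryOp n) (a : Fin n → Axis) (x : Bits n) (c : Fin n → Axis)
    (y : Bits n) : ℂ :=
  (star (productBasis c) * U * productBasis a : UnitaryOp n).1 y x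

theorem sum_normSq_amplitude {n : ℕ} (U : UnitaryOp n) (a : Fin n → Axis) (x : Bits n)
    (c : Fin n → Axis) : ∑ y, ENNReal.ofReal (‖amplitude U a x c y‖ ^ 2) = 1 := by
  rw [← ENNReal.ofReal_sum_of_nonneg fun _ _ => by positivity]
  have h := congrFun (congrFun (Matrix.mem_unitaryGroup_iff'.mp
    (star (productBasis c) * U * productBasis a : UnitaryOp n).2) x) x
  rw [Matrix.mul_apply, Matrix.one_apply_eq] at h
  have h' : ((∑ y, ‖amplitude U a x c y‖ ^ 2 : ℝ) : ℂ) = 1 := by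
    rw [← h, Complex.ofReal_sum]
    refine Finset.sum_congr rfl fun y _ => ?_
    rw [Matrix.star_apply, RCLike.star_def, RCLike.conj_mul]
    simp [amplitude]
  have h'' : (∑ y, ‖amplitude U a x c y‖ ^ 2 : ℝ) = 1 := by exact_mod_cast h'
  rw [h'', ENNReal.ofReal_one]

/-- The distribution of the measurement outcomes, by Born's rule. Outcome bit `0` stands for the
eigenvalue `+1` and outcome bit `1` for the eigenvalue `-1`. -/
def experiment {n : ℕ} (U : UnitaryOp n) (a : Fin n → Axis) (x : Bits n) (c : Fin n → Axis) :
    PMF (Bits n) :=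
  PMF.ofFintype (fun y => ENNReal.ofReal (‖amplitude U a x c y‖ ^ 2)) (sum_normSq_amplitude U a x c)

/-! ### Learning algorithms with a step count -/

/-- Programs for a probabilistic random-access machine with integer memory cells, whose only
arithmetic instructions are addition and subtraction, and with access to the unknown unitary. -/
inductive Prog
  | set (a : ℕ) (v : ℤ)
  | add (a b c : ℕ)
  | sub (a b c : ℕ)
  | load (a b : ℕ)
  | store (a b : ℕ)
  | coin (a : ℕ)
  | query (inverse : Bool) (a b c r : ℕ)
  | print (a : ℕ)
  | seq (P Q : Prog)
  | ifPos (a : ℕ) (P Q : Prog)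
  | loop (a : ℕ) (P : Prog)

/-- A state of the machine: the memory, the output written so far, and the numbers of time steps
and of experiments used so far. -/
structure State where
  mem : ℕ → ℤ
  out : List ℤ
  time : ℕ
  queries : ℕ

namespace State

/-- Let `t` units of time pass. -/
def tick (s : State) (t : ℕ) : State := { s with time := s.time + t }

/-- Write `v` into the memory cell `a`. -/
def write (s : State) (a : ℕ) (v : ℤ) : State := { s with mem := Function.update s.mem a v }

/-- The address that is stored in the memory cell `a`. -/
def addr (s : State) (a : ℕ) : ℕ := (s.mem a).toNat

/-- Read `n` Pauli axes from consecutive cells, starting at address `p`; the code of `X` is `1`,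
that of `Y` is `2`, and every other number stands for `Z`. -/
def readAxes (s : State) (n p : ℕ) : Fin n → Axis := fun i =>
  if s.mem (p + i) = 1 then .X else if s.mem (p + i) = 2 then .Y else .Z

/-- Read `n` bits from consecutive cells, starting at address `p`; every number other than `1`
stands for the bit `0`. -/
def readBits (s : State) (n p : ℕ) : Bits n := fun i => if s.mem (p + i) = 1 then 1 else 0

/-- Write `n` bits into consecutive cells, starting at address `p`. -/
def writeBits (s : State) {n : ℕ} (p : ℕ) (y : Bits n) : State :=
  { s with mem := fun q =>
      if h : p ≤ q ∧ q - p < n then ((y ⟨q - p, h.2⟩ : ℕ) : ℤ) else s.mem q }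

end State

/-- The execution of a program with access to the `n`-qubit unitary `U` from a given state: the
distribution of the final state. Every instruction, every test of a conditional and of a loop costs
one unit of time, except that an experiment, which reads `3 n` cells and writes `n` cells, costs
`4 n + 1`.
* `load a b` copies the cell whose address is in cell `b` to cell `a`.
* `store a b` copies cell `b` to the cell whose address is in cell `a`.
* `coin a` writes a fair random bit to cell `a`.
* `query inverse a b c r` prepares the product stabilizer state whose axes and bits are stored from
  the addresses in cells `a` and `b` on, applies `U` (or `U†` if `inverse` is set), measures
  every qubit in the Pauli basis stored from the address in cell `c` on, and writes the outcomes from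
  the address in cell `r` on.
* `print a` appends the content of cell `a` to the output.
* `loop a P` executes `P` as many times as the content of cell `a` on entry says. -/
def Prog.run {n : ℕ} (U : UnitaryOp n) : Prog → State → PMF State
  | .set a v, s => PMF.pure ((s.write a v).tick 1)
  | .add a b c, s => PMF.pure ((s.write a (s.mem b + s.mem c)).tick 1)
  | .sub a b c, s => PMF.pure ((s.write a (s.mem b - s.mem c)).tick 1)
  | .load a b, s => PMF.pure ((s.write a (s.mem (s.addr b))).tick 1)
  | .store a b, s => PMF.pure ((s.write (s.addr a) (s.mem b)).tick 1)
  | .coin a, s =>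
      (PMF.uniformOfFintype (Fin 2)).map fun r => (s.write a ((r : ℕ) : ℤ)).tick 1
  | .query inverse a b c r, s =>
      (experiment (if inverse then star U else U) (s.readAxes n (s.addr a))
        (s.readBits n (s.addr b)) (s.readAxes n (s.addr c))).map fun y =>
          { (s.writeBits (s.addr r) y).tick (4 * n + 1) with queries := s.queries + 1 }
  | .print a, s => PMF.pure { s.tick 1 with out := s.out ++ [s.mem a] }
  | .seq P Q, s => (P.run U s).bind (Q.run U)
  | .ifPos a P Q, s => if 0 < s.mem a then P.run U (s.tick 1) else Q.run U (s.tick 1)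
  | .loop a P, s =>
      (fun μ : PMF State => μ.bind fun t => P.run U (t.tick 1))^[(s.mem a).toNat]
        (PMF.pure (s.tick 1))

/-- The initial state: the number `n` of qubits is in cell `0`, the number `⌈log₂ (1/δ)⌉` that
describes the failure probability `δ` is in cell `1`, and all other cells are `0`. -/
def State.init (n : ℕ) (δ : ℝ) : State where
  mem := fun q => if q = 0 then (n : ℤ) else if q = 1 then (⌈Real.logb 2 (1 / δ)⌉₊ : ℤ) else 0
  out := []
  time := 0
  queries := 0

/-- The machine has output an explicit description of a unitary on `n + n` qubits whose average-case
distance from `C ⊗ C†` is at most `ε`. -/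
def State.Learned (s : State) {n : ℕ} (C : UnitaryOp n) (ε : ℝ) : Prop :=
  ∃ gs : List (MatrixGate (n + n)), s.out = encodeCircuit gs ∧
    avgDist (circuitUnitary gs) (tensorPairUnitary C (star C)) ≤ ε

end QACLearning

end

noncomputable section

namespace QACLearning

open scoped ENNReal

section

/-! ### Reasoning about programs -/

/-! The algorithm rests on the identity `sewing`: if SWAP exchanges the two registers, then (C ⊗ 1)
SWAP (C† ⊗ 1) SWAP = C ⊗ C†. Since SWAP is the product of the swaps Sᵢ of the qubit pairs, C ⊗ C† is
SWAP followed by the product of the involutions Wᵢ = (C ⊗ 1) Sᵢ (C† ⊗ 1), called `sewOp C i`, and Sᵢ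
= ½ ∑ P ⊗ P gives Wᵢ = ½ ∑ (C Pᵢ C†) ⊗ Pᵢ (`sewOp_eq`, `sewProd_mul_swapOp`). Only the Heisenberg
operators C Pᵢ C† have to be learned, and only in normalized Hilbert–Schmidt norm: by
`Near.avgDist_le` the average-case distance is at most the square of that norm of the difference, up
to a phase.

These operators are almost of low degree. A CZ gate on more than k qubits moves a fraction below
2^(-k) of the basis states, so deleting all wide gates costs O(d √(n 2^(-k)))
(`hsNorm_narrow_sub_le`). In what remains, a qubit has a light cone of at most k^d qubits
(`exists_light_cone`). With k of order log n, the Pauli strings of weight at most k^d suffice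
(`tailBound`), and there are quasi-polynomially many. Each Pauli coefficient is the correlation
between the sign of a random input eigenstate and a product of outcome signs
(`correlation_eq_trace`), so it is estimated by sampling, with a Chernoff bound
(`whp_estimateProg`).

Estimated coefficients need not define a unitary. The printed circuit therefore follows the path s ↦
(1 + isW)/(1 - isW) from 1 to iW, in M steps given by the tangent addition formula
(`rotOp_stepAngle_mul`), and replaces each step by a product of small rotations about the strings Q
⊗ Pᵢ. With N strings the product formula costs O(N²/M²) per step, next to the sampling and
truncation errors (`TermsPrinted.near`); the constant term ½ of W is only a phase. This
parametrization keeps all entries in ℚ[i], and a rotation about a string is one single-qubit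
rotation between two rows of two-qubit gates (`termGates_unitary`).

All parameters are bounded by powers of B = `precision` = 2^((c · bitLen n)^(d+1)), so the running
time is polynomial in B, which is the claimed n^(K (log n)^d) (`totalTime_le`, `precision_pow_le`).
The behaviour of the program is established once, for an arbitrary accuracy and failure probability
of the estimates (`whp_learnProg`). The trivial accuracy 2 with failure probability 0 bounds the
resources of every run; accuracy 1/B gives the output.

Memory map: cell 0 holds n, 1 the digits of 1/δ, 2 and 3 the constants 1 and 0, 4 the number M of
steps, 5 the number T of samples, 6 the number of rows (Pauli strings), 7 to 9 the addresses of
input bits, outcomes and input axes, 10 and 12 the start and end of the rows, 11 the weight bound;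
13 to 15 serve the setup, 20 to 22 are the current qubit, step and row, 30 to 49 are scratch. The
three arrays start at 50 and the rows at 50 + 3n. -/

/-- The expectation of `f` in the final state of the program. -/
def Prog.expect {n : ℕ} (U : UnitaryOp n) (P : Prog) (f : State → ℝ≥0∞) (s : State) : ℝ≥0∞ :=
  ∑' t, P.run U s t * f t

/-- Every possible final state has the property `G`. -/
def Sure {n : ℕ} (U : UnitaryOp n) (P : Prog) (s : State) (G : State → Prop) : Prop :=
  ∀ t ∈ (P.run U s).support, G t

/-- The final state violates the property `G` with probability at most `ε`. -/
def Whp {n : ℕ} (U : UnitaryOp n) (P : Prog) (s : State) (G : State → Prop) (ε : ℝ≥0∞) : Prop :=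
  (P.run U s).toOuterMeasure {t | ¬ G t} ≤ ε

section PMFExpectation

variable {α β : Type}

/-- The expectation of a nonnegative function. -/
def pmfExpect (μ : PMF α) (f : α → ℝ≥0∞) : ℝ≥0∞ := ∑' a, μ a * f a

theorem pmfExpect_pure (a : α) (f : α → ℝ≥0∞) : pmfExpect (PMF.pure a) f = f a := by
  unfold pmfExpect
  rw [tsum_eq_single a]
  · simp
  · intro b hb
    simp [PMF.pure_apply, hb]

theorem pmfExpect_bind (μ : PMF α) (g : α → PMF β) (f : β → ℝ≥0∞) :
    pmfExpect (μ.bind g) f = pmfExpect μ fun a => pmfExpect (g a) f := by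
  unfold pmfExpect
  simp_rw [PMF.bind_apply, ← ENNReal.tsum_mul_right]
  rw [ENNReal.tsum_comm]
  refine tsum_congr fun a => ?_
  rw [← ENNReal.tsum_mul_left]
  exact tsum_congr fun b => mul_assoc _ _ _

theorem pmfExpect_map (μ : PMF α) (g : α → β) (f : β → ℝ≥0∞) :
    pmfExpect (μ.map g) f = pmfExpect μ fun a => f (g a) := by
  rw [PMF.map, pmfExpect_bind]
  simp [pmfExpect_pure]

theorem pmfExpect_mono {μ : PMF α} {f g : α → ℝ≥0∞} (h : ∀ a ∈ μ.support, f a ≤ g a) :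
    pmfExpect μ f ≤ pmfExpect μ g := by
  refine ENNReal.tsum_le_tsum fun a => ?_
  by_cases ha : a ∈ μ.support
  · exact mul_le_mul_right (h a ha) _
  · rw [PMF.mem_support_iff, not_not] at ha
    simp [ha]

theorem pmfExpect_const (μ : PMF α) (c : ℝ≥0∞) : pmfExpect μ (fun _ => c) = c := by
  rw [pmfExpect, ENNReal.tsum_mul_right, μ.tsum_coe, one_mul]

end PMFExpectation

variable {n : ℕ} {U : UnitaryOp n}

theorem expect_eq (P : Prog) (f : State → ℝ≥0∞) (s : State) :
    P.expect U f s = pmfExpect (P.run U s) f := rfl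

theorem expect_seq (P Q : Prog) (f : State → ℝ≥0∞) (s : State) :
    (Prog.seq P Q).expect U f s = P.expect U (fun t => Q.expect U f t) s := by
  simp only [expect_eq, Prog.run, pmfExpect_bind]

theorem expect_mono {P : Prog} {f g : State → ℝ≥0∞} {s : State}
    (h : ∀ t ∈ (P.run U s).support, f t ≤ g t) : P.expect U f s ≤ P.expect U g s :=
  pmfExpect_mono h

theorem expect_le_of_sure {P : Prog} {f : State → ℝ≥0∞} {s : State} {G : State → Prop} {c : ℝ≥0∞}
    (h : Sure U P s G) (hf : ∀ t, G t → f t ≤ c) : P.expect U f s ≤ c :=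
  (pmfExpect_mono fun t ht => hf t (h t ht)).trans (pmfExpect_const _ c).le

theorem expect_coin (a : ℕ) (f : State → ℝ≥0∞) (s : State) :
    (Prog.coin a).expect U f s =
      2⁻¹ * ∑ r : Fin 2, f ((s.write a ((r : ℕ) : ℤ)).tick 1) := by
  have h : Prog.run U (.coin a) s = (PMF.uniformOfFintype (Fin 2)).map
      fun r : Fin 2 => (s.write a ((r : ℕ) : ℤ)).tick 1 := by
    rw [Prog.run]
    exact PMF.map_comp _ (PMF.uniformOfFintype (Fin 2)) _
  rw [expect_eq, h, pmfExpect_map, pmfExpect, tsum_fintype, Finset.mul_sum]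
  simp

theorem expect_query (b : Bool) (a x c r : ℕ) (f : State → ℝ≥0∞) (s : State) :
    (Prog.query b a x c r).expect U f s =
      ∑ y, experiment (if b then star U else U) (s.readAxes n (s.addr a))
        (s.readBits n (s.addr x)) (s.readAxes n (s.addr c)) y *
        f { (s.writeBits (s.addr r) y).tick (4 * n + 1) with queries := s.queries + 1 } := by
  rw [expect_eq, Prog.run, pmfExpect_map, pmfExpect, tsum_fintype]

/-- A supermartingale argument: a potential that does not grow in expectation during any pass does
not grow over the loop. No invariant appears because a potential may be `⊤` wherever an invariant
fails. -/
theorem expect_loop_le {a : ℕ} {P : Prog} {s : State} (f : ℕ → State → ℝ≥0∞)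
    (h : ∀ k < (s.mem a).toNat, ∀ t, P.expect U (f (k + 1)) (t.tick 1) ≤ f k t) :
    (Prog.loop a P).expect U (f (s.mem a).toNat) s ≤ f 0 (s.tick 1) := by
  rw [expect_eq, Prog.run]
  generalize (s.mem a).toNat = N at h
  induction N with
  | zero => simp [pmfExpect_pure]
  | succ N ih =>
    rw [Function.iterate_succ_apply', pmfExpect_bind]
    refine le_trans (pmfExpect_mono fun t _ => ?_) (ih fun k hk => h k (by omega))
    exact h N (by omega) t

theorem whp_iff (P : Prog) (s : State) (G : State → Prop) (ε : ℝ≥0∞) [DecidablePred G] :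
    Whp U P s G ε ↔ P.expect U (fun t => if G t then 0 else 1) s ≤ ε := by
  rw [Whp, PMF.toOuterMeasure_apply, Prog.expect]
  have : ∀ t, ({t | ¬ G t} : Set State).indicator (⇑(P.run U s)) t =
      P.run U s t * (if G t then 0 else 1) := by
    intro t
    by_cases h : G t <;> simp [Set.indicator, h]
  simp_rw [this]

/-- A set is null for a discrete law exactly when it misses the support. Deterministic parts of the
program thus enter the union bound with error 0. -/
theorem sure_iff_whp (P : Prog) (s : State) (G : State → Prop) :
    Sure U P s G ↔ Whp U P s G 0 := by
  rw [Whp, nonpos_iff_eq_zero, PMF.toOuterMeasure_apply_eq_zero_iff, Set.disjoint_left]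
  simp [Sure]

theorem Whp.mono {P : Prog} {s : State} {G G' : State → Prop} {ε ε' : ℝ≥0∞}
    (h : Whp U P s G ε) (hG : ∀ t, G t → G' t) (hε : ε ≤ ε') : Whp U P s G' ε' := by
  refine le_trans ((P.run U s).toOuterMeasure.mono ?_) (h.trans hε)
  intro t ht h'
  exact ht (hG t h')

theorem Sure.mono {P : Prog} {s : State} {G G' : State → Prop}
    (h : Sure U P s G) (hG : ∀ t, G t → G' t) : Sure U P s G' :=
  fun t ht => hG t (h t ht)

/-- Markov's inequality with threshold 1. -/
theorem whp_of_expect_le {P : Prog} {s : State} {G : State → Prop} {f : State → ℝ≥0∞} {ε : ℝ≥0∞}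
    (hf : ∀ t, ¬ G t → 1 ≤ f t) (h : P.expect U f s ≤ ε) : Whp U P s G ε := by
  classical
  rw [whp_iff]
  refine le_trans (expect_mono fun t _ => ?_) h
  split
  · exact zero_le
  · exact hf t ‹_›

/-- Union bound: where `F` fails, the failure probability of `Q` is bounded by 1, and this happens
with probability at most `ε₁`. -/
theorem Whp.seq {P Q : Prog} {s : State} {F G : State → Prop} {ε₁ ε₂ : ℝ≥0∞}
    (hP : Whp U P s F ε₁) (hQ : ∀ t, F t → Whp U Q t G ε₂) :
    Whp U (.seq P Q) s G (ε₁ + ε₂) := by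
  classical
  rw [whp_iff, expect_seq]
  rw [whp_iff] at hP
  have h1 : ∀ t, Q.expect U (fun t => if G t then 0 else 1) t ≤
      (if F t then 0 else 1) + ε₂ := by
    intro t
    by_cases h : F t
    · simpa [h] using (whp_iff _ _ _ _).1 (hQ t h)
    · rw [if_neg h]
      refine le_trans (pmfExpect_mono (g := fun _ => 1) fun t _ => ?_)
        ((pmfExpect_const _ _).le.trans le_self_add)
      split <;> simp
  refine le_trans (expect_mono fun t _ => h1 t) ?_
  unfold Prog.expect at hP ⊢
  simp_rw [mul_add]
  rw [ENNReal.tsum_add, ENNReal.tsum_mul_right, (P.run U s).tsum_coe, one_mul]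
  gcongr

/-- Union bound over the passes. The invariant describes the state before the test of the next pass,
whose unit of time is charged to that pass. -/
theorem Whp.loop {a : ℕ} {P : Prog} {s : State} {N : ℕ} (I : ℕ → State → Prop) {ε : ℝ≥0∞}
    (hN : (s.mem a).toNat = N) (h0 : I 0 (s.tick 1))
    (h : ∀ k < N, ∀ t, I k t → Whp U P (t.tick 1) (I (k + 1)) ε) :
    Whp U (.loop a P) s (I N) (N * ε) := by
  unfold Whp
  rw [Prog.run, hN]
  have key : ∀ k ≤ N, ((fun μ : PMF State => μ.bind fun t => P.run U (t.tick 1))^[k]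
      (PMF.pure (s.tick 1))).toOuterMeasure {t | ¬ I k t} ≤ k * ε := by
    intro k
    induction k with
    | zero =>
      intro _
      rw [Function.iterate_zero, id_eq, PMF.toOuterMeasure_pure_apply]
      simp [h0]
    | succ k ih =>
      intro hk
      classical
      rw [Function.iterate_succ_apply']
      set μ := (fun μ : PMF State => μ.bind fun t => P.run U (t.tick 1))^[k]
        (PMF.pure (s.tick 1))
      rw [PMF.toOuterMeasure_bind_apply]
      have h1 : ∀ t, (P.run U (t.tick 1)).toOuterMeasure {t | ¬ I (k + 1) t} ≤
          ({t | ¬ I k t} : Set State).indicator 1 t + ε := by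
        intro t
        by_cases hI : I k t
        · simpa [hI, Whp] using h k (by omega) t hI
        · have : (P.run U (t.tick 1)).toOuterMeasure {t | ¬ I (k + 1) t} ≤ 1 := by
            rw [PMF.toOuterMeasure_apply]
            refine le_trans (ENNReal.tsum_le_tsum fun a => Set.indicator_le_self _ _ _) ?_
            rw [PMF.tsum_coe]
          refine this.trans ?_
          simp [hI]
      refine le_trans (ENNReal.tsum_le_tsum fun t => mul_le_mul_right (h1 t) _) ?_
      simp_rw [mul_add]
      rw [ENNReal.tsum_add, ENNReal.tsum_mul_right, PMF.tsum_coe, one_mul]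
      push_cast
      rw [add_mul, one_mul]
      gcongr
      refine le_trans (le_of_eq ?_) (ih (by omega))
      rw [PMF.toOuterMeasure_apply]
      refine tsum_congr fun t => ?_
      by_cases hI : I k t <;> simp [Set.indicator, hI]
  exact key N le_rfl

theorem sure_seq {P Q : Prog} {s : State} {G : State → Prop} :
    Sure U (.seq P Q) s G ↔ Sure U P s fun t => Sure U Q t G := by
  simp only [Sure, Prog.run, PMF.mem_support_bind_iff]
  exact ⟨fun h t ht t' ht' => h t' ⟨t, ht, ht'⟩, fun h t' ⟨t, ht, ht'⟩ => h t ht t' ht'⟩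

theorem sure_set {a : ℕ} {v : ℤ} {s : State} {G : State → Prop} :
    Sure U (.set a v) s G ↔ G ((s.write a v).tick 1) := by
  simp [Sure, Prog.run]

theorem sure_add {a b c : ℕ} {s : State} {G : State → Prop} :
    Sure U (.add a b c) s G ↔ G ((s.write a (s.mem b + s.mem c)).tick 1) := by
  simp [Sure, Prog.run]

theorem sure_sub {a b c : ℕ} {s : State} {G : State → Prop} :
    Sure U (.sub a b c) s G ↔ G ((s.write a (s.mem b - s.mem c)).tick 1) := by
  simp [Sure, Prog.run]

theorem sure_load {a b : ℕ} {s : State} {G : State → Prop} :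
    Sure U (.load a b) s G ↔ G ((s.write a (s.mem (s.addr b))).tick 1) := by
  simp [Sure, Prog.run]

theorem sure_store {a b : ℕ} {s : State} {G : State → Prop} :
    Sure U (.store a b) s G ↔ G ((s.write (s.addr a) (s.mem b)).tick 1) := by
  simp [Sure, Prog.run]

theorem sure_print {a : ℕ} {s : State} {G : State → Prop} :
    Sure U (.print a) s G ↔ G { s.tick 1 with out := s.out ++ [s.mem a] } := by
  simp [Sure, Prog.run]

theorem sure_ifPos {a : ℕ} {P Q : Prog} {s : State} {G : State → Prop} :
    Sure U (.ifPos a P Q) s G ↔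
      (0 < s.mem a → Sure U P (s.tick 1) G) ∧ (s.mem a ≤ 0 → Sure U Q (s.tick 1) G) := by
  unfold Sure
  rw [Prog.run]
  by_cases h : 0 < s.mem a
  · simp [h, not_le.2 h]
  · simp [h, not_lt.1 h]

theorem sure_loop {a : ℕ} {P : Prog} {s : State} {N : ℕ} (I : ℕ → State → Prop)
    (hN : (s.mem a).toNat = N) (h0 : I 0 (s.tick 1))
    (h : ∀ k < N, ∀ t, I k t → Sure U P (t.tick 1) (I (k + 1))) :
    Sure U (.loop a P) s (I N) := by
  rw [sure_iff_whp]
  have := Whp.loop (U := U) (ε := 0) I hN h0 fun k hk t ht => (sure_iff_whp _ _ _).1 (h k hk t ht)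
  rwa [mul_zero] at this

section StateLemmas

variable (s : State)

@[simp] theorem mem_write (a q : ℕ) (v : ℤ) :
    (s.write a v).mem q = if q = a then v else s.mem q := by
  simp [State.write, Function.update_apply]

@[simp] theorem mem_tick (t : ℕ) : (s.tick t).mem = s.mem := rfl
@[simp] theorem out_write (a : ℕ) (v : ℤ) : (s.write a v).out = s.out := rfl
@[simp] theorem out_tick (t : ℕ) : (s.tick t).out = s.out := rfl
@[simp] theorem time_write (a : ℕ) (v : ℤ) : (s.write a v).time = s.time := rfl
@[simp] theorem time_tick (t : ℕ) : (s.tick t).time = s.time + t := rfl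
@[simp] theorem queries_write (a : ℕ) (v : ℤ) : (s.write a v).queries = s.queries := rfl
@[simp] theorem queries_tick (t : ℕ) : (s.tick t).queries = s.queries := rfl

end StateLemmas

end

section

/-! ### Estimating a correlation by sampling -/

infixr:60 " ;; " => Prog.seq

/-- The code of a Pauli axis in the memory of the machine. -/
def Axis.code : Axis → ℕ
  | .X => 1
  | .Y => 2
  | .Z => 3

/-- The axis in which a tensor factor of a Pauli string is measured; `0`, `1`, `2`, `3` stand for
the identity and the Pauli operators `X`, `Y`, `Z`. -/
def pauliAxis (c : Fin 4) : Axis := if c = 1 then .X else if c = 2 then .Y else .Z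

/-- The input axes: `P` on qubit `i` and `Z` elsewhere. -/
def inputAxes {n : ℕ} (i : Fin n) (P : Axis) : Fin n → Axis := fun q => if q = i then P else .Z

/-- The sign that belongs to a measurement outcome. -/
def bitSign (b : Fin 2) : ℤ := if b = 1 then -1 else 1

/-- The product of the signs of the outcomes on the support of a Pauli string. -/
def stringSign {n : ℕ} (Q : Fin n → Fin 4) (y : Bits n) : ℤ :=
  ∏ q, if Q q = 0 then 1 else bitSign (y q)

/-- The correlation between the sign of input qubit `i`, prepared in a random eigenstate of `P`,
and the outcome of the measurement of the Pauli string `Q`, all other input bits being random. -/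
def correlation {n : ℕ} (U : UnitaryOp n) (i : Fin n) (P : Axis) (Q : Fin n → Fin 4) : ℝ :=
  (2 ^ n : ℝ)⁻¹ * ∑ x : Bits n, ∑ y : Bits n,
    ‖amplitude U (inputAxes i P) x (fun q => pauliAxis (Q q)) y‖ ^ 2 *
      ((bitSign (x i) * stringSign Q y : ℤ) : ℝ)

/-- Does nothing but use a scratch cell. -/
def skip : Prog := .add 49 3 3

/-- Fill the input bits with coin flips and clear the input axes. -/
def coinsProg : Prog :=
  .add 30 7 3 ;; .add 31 9 3 ;;
  .loop 0 (.coin 32 ;; .store 30 32 ;; .store 31 3 ;; .add 30 30 2 ;; .add 31 31 2)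

/-- Multiply cell `33` by the sign of the bit in cell `a`. -/
def flipProg (a : ℕ) : Prog := .ifPos a (.sub 33 3 33) skip

/-- Compute the sign of a sample in cell `33`. -/
def signProg : Prog :=
  .set 33 1 ;; .add 30 7 20 ;; .load 32 30 ;; flipProg 32 ;; .add 30 22 3 ;; .add 31 8 3 ;;
  .loop 0 (.load 32 30 ;; .ifPos 32 (.load 34 31 ;; flipProg 34) skip ;;
    .add 30 30 2 ;; .add 31 31 2)

/-- Take one sample for the correlation with input axis `P` on the qubit in cell `20` and the Pauli
string whose address is in cell `22`, and add its sign to cell `40`. -/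
def sampleProg (P : Axis) : Prog :=
  coinsProg ;; .add 31 9 20 ;; .set 32 P.code ;; .store 31 32 ;; .query false 9 7 22 8 ;;
  signProg ;; .add 40 40 33

/-- Sum the signs of as many samples as cell `5` says in cell `40`. -/
def estimateProg (P : Axis) : Prog := .set 40 0 ;; .loop 5 (sampleProg P)

/-- Only scratch cells have changed. -/
structure Frame (n : ℕ) (s t : State) : Prop where
  mem : ∀ q, q < 30 ∨ 50 + 3 * n ≤ q → t.mem q = s.mem q

theorem Frame.trans {n : ℕ} {s t u : State} (h : Frame n s t) (h' : Frame n t u) : Frame n s u :=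
  ⟨fun q hq => (h'.mem q hq).trans (h.mem q hq)⟩

/-- What a sample relies on: the constants, the number `i` of a qubit, and the address of a row of
memory cells that hold the Pauli string `Q`. -/
structure SampleEnv (n : ℕ) (i : Fin n) (Q : Fin n → Fin 4) (s : State) : Prop where
  num : s.mem 0 = n
  one : s.mem 2 = 1
  zero : s.mem 3 = 0
  inBits : s.mem 7 = 50
  outBits : s.mem 8 = 50 + n
  inAxes : s.mem 9 = 50 + 2 * n
  qubit : s.mem 20 = (i : ℕ)
  row : ∃ r : ℕ, 50 + 3 * n ≤ r ∧ s.mem 22 = r ∧ ∀ q : Fin n, s.mem (r + q) = ((Q q : ℕ) : ℤ)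

theorem SampleEnv.congr {n : ℕ} {i : Fin n} {Q : Fin n → Fin 4} {s t : State}
    (h : SampleEnv n i Q s) (hf : Frame n s t) : SampleEnv n i Q t := by
  obtain ⟨r, hr, hr', hQ⟩ := h.row
  refine ⟨?_, ?_, ?_, ?_, ?_, ?_, ?_, r, hr, ?_, fun q => ?_⟩
  · rw [hf.mem _ (by omega), h.num]
  · rw [hf.mem _ (by omega), h.one]
  · rw [hf.mem _ (by omega), h.zero]
  · rw [hf.mem _ (by omega), h.inBits]
  · rw [hf.mem _ (by omega), h.outBits]
  · rw [hf.mem _ (by omega), h.inAxes]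
  · rw [hf.mem _ (by omega), h.qubit]
  · rw [hf.mem _ (by omega), hr']
  · rw [hf.mem _ (by omega), hQ]

variable {n : ℕ} {U : UnitaryOp n}

theorem expect_set (a : ℕ) (v : ℤ) (f : State → ℝ≥0∞) (s : State) :
    (Prog.set a v).expect U f s = f ((s.write a v).tick 1) := by
  rw [expect_eq, Prog.run, pmfExpect_pure]

theorem expect_add (a b c : ℕ) (f : State → ℝ≥0∞) (s : State) :
    (Prog.add a b c).expect U f s = f ((s.write a (s.mem b + s.mem c)).tick 1) := by
  rw [expect_eq, Prog.run, pmfExpect_pure]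

theorem expect_store (a b : ℕ) (f : State → ℝ≥0∞) (s : State) :
    (Prog.store a b).expect U f s = f ((s.write (s.addr a) (s.mem b)).tick 1) := by
  rw [expect_eq, Prog.run, pmfExpect_pure]

/-- The state after the coin flips, with input bits `x`. -/
structure CoinPost (s : State) (x : Bits n) (t : State) : Prop where
  frame : Frame n s t
  bits : ∀ q : Fin n, t.mem (50 + q) = ((x q : ℕ) : ℤ)
  axes : ∀ q : Fin n, t.mem (50 + 2 * n + q) = 0
  acc : t.mem 40 = s.mem 40
  out : t.out = s.out
  time : t.time = s.time + 3 + 6 * n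
  queries : t.queries = s.queries

/-- The bits written so far are only known to be bits; their distribution is left to
`coinPotential`. The time is exact: two additions and the loop entry at first, then a test and five
instructions per pass. -/
structure CoinInv (n : ℕ) (s : State) (k : ℕ) (t : State) : Prop where
  frame : Frame n s t
  ptr : t.mem 30 = 50 + k
  ptr' : t.mem 31 = 50 + 2 * n + k
  bits : ∀ q < k, t.mem (50 + q) = 0 ∨ t.mem (50 + q) = 1
  axes : ∀ q < k, t.mem (50 + 2 * n + q) = 0
  acc : t.mem 40 = s.mem 40
  out : t.out = s.out
  time : t.time = s.time + 3 + 6 * k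
  queries : t.queries = s.queries

open Classical in
/-- The average of `F` over the bit strings that extend the first `k` bits in memory. -/
def coinPotential (s : State) (F : Bits n → ℝ≥0∞) (k : ℕ) (t : State) : ℝ≥0∞ :=
  if CoinInv n s k t then
    (2 ^ (n - k))⁻¹ * ∑ x, if ∀ q : Fin n, (q : ℕ) < k → t.mem (50 + q) = ((x q : ℕ) : ℤ)
      then F x else 0
  else ⊤

/-- A martingale step: the average over the extensions of `k` bits is the mean of the two averages
obtained by fixing bit `k`, and a fair coin fixes it. -/
theorem coinPotential_step {i : Fin n} {Q : Fin n → Fin 4} {s : State} (hs : SampleEnv n i Q s)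
    (F : Bits n → ℝ≥0∞) {k : ℕ} (hk : k < n) (t : State) :
    (Prog.coin 32 ;; .store 30 32 ;; .store 31 3 ;; .add 30 30 2 ;; .add 31 31 2).expect U
      (coinPotential s F (k + 1)) (t.tick 1) ≤ coinPotential s F k t := by
  classical
  by_cases h : CoinInv n s k t
  swap
  · simp [coinPotential, h]
  have h2 : t.mem 2 = 1 := by rw [h.frame.mem _ (by omega), hs.one]
  have h3 : t.mem 3 = 0 := by rw [h.frame.mem _ (by omega), hs.zero]
  simp only [expect_seq, expect_coin, expect_store, expect_add]
  -- The five writes are condensed into one formula for the memory, so that the bookkeeping is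
  -- shared by both outcomes of the coin.
  have key : ∀ r : Fin 2, ∀ t' : State,
      (∀ q, t'.mem q = if q = 31 then ((50 + 2 * n + (k + 1) : ℕ) : ℤ) else
        if q = 30 then ((50 + (k + 1) : ℕ) : ℤ) else if q = 50 + 2 * n + k then 0 else
        if q = 50 + k then ((r : ℕ) : ℤ) else if q = 32 then ((r : ℕ) : ℤ) else t.mem q) →
      t'.out = t.out → t'.time = t.time + 6 → t'.queries = t.queries →
      coinPotential s F (k + 1) t' = (2 ^ (n - (k + 1)))⁻¹ * ∑ x : Bits n,
        if (∀ q : Fin n, (q : ℕ) < k → t.mem (50 + q) = ((x q : ℕ) : ℤ)) ∧ x ⟨k, hk⟩ = r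
        then F x else 0 := by
    intro r t' hm ho ht hq
    have hI : CoinInv n s (k + 1) t' := by
      refine ⟨⟨fun q hq => ?_⟩, ?_, ?_, fun q hq => ?_, fun q hq => ?_, ?_, ?_, ?_, ?_⟩
      · rw [hm, if_neg (by omega), if_neg (by omega), if_neg (by omega), if_neg (by omega),
          if_neg (by omega), h.frame.mem q hq]
      · rw [hm]; simp
      · rw [hm]; simp
      · rw [hm, if_neg (by omega), if_neg (by omega), if_neg (by omega)]
        split
        · fin_cases r <;> simp
        · rw [if_neg (by omega)]
          exact h.bits q (by omega)
      · rw [hm, if_neg (by omega), if_neg (by omega)]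
        split
        · rfl
        · rw [if_neg (by omega), if_neg (by omega)]
          exact h.axes q (by omega)
      · rw [hm, if_neg (by omega), if_neg (by omega), if_neg (by omega), if_neg (by omega),
          if_neg (by omega), h.acc]
      · rw [ho, h.out]
      · rw [ht, h.time]; ring
      · rw [hq, h.queries]
    rw [coinPotential, if_pos hI]
    congr 1
    refine Finset.sum_congr rfl fun x _ => ?_
    congr 1
    refine propext ⟨fun hx => ⟨fun q hq => ?_, ?_⟩, fun hx q hq => ?_⟩
    · rw [← hx q (by omega), hm, if_neg (by omega), if_neg (by omega), if_neg (by omega),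
        if_neg (by omega), if_neg (by omega)]
    · have := hx ⟨k, hk⟩ (by simp)
      rw [hm, if_neg (by simp; omega), if_neg (by simp; omega), if_neg (by simp; omega),
        if_pos rfl] at this
      exact Fin.ext (by exact_mod_cast this.symm)
    · rw [hm, if_neg (by omega), if_neg (by omega), if_neg (by omega)]
      split
      · have : q = ⟨k, hk⟩ := Fin.ext (by simp; omega)
        rw [this, hx.2]
      · rw [if_neg (by omega), hx.1 q (by omega)]
  simp only [Fin.sum_univ_two]
  rw [key 0, key 1, coinPotential, if_pos h, ← mul_add, ← Finset.sum_add_distrib, ← mul_assoc]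
  · refine le_of_eq ?_
    congr 1
    · rw [show n - k = n - (k + 1) + 1 by omega, pow_succ, mul_comm,
        ENNReal.mul_inv (by simp) (by simp)]
    · refine Finset.sum_congr rfl fun x _ => ?_
      rcases (by omega : x ⟨k, hk⟩ = 0 ∨ x ⟨k, hk⟩ = 1) with hx | hx <;> simp [hx]
  all_goals first
    | (intro q
       simp [State.addr, h.ptr, h.ptr', h2, h3]
       have e1 : (50 + 2 * (n : ℤ) + (k : ℤ)).toNat = 50 + 2 * n + k := by omega
       have e2 : (50 + (k : ℤ)).toNat = 50 + k := by omega
       have e3 : ¬ (31 = 50 + k) := by omega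
       simp [e1, e2, e3]
       split_ifs <;> first | rfl | omega)
    | rfl

/-- The potential starts as the average of `F` over all bit strings and ends as `F` at the string in
memory, so the loop of coin flips acts as a uniform choice of `x`. -/
theorem expect_coinsProg_le {i : Fin n} {Q : Fin n → Fin 4} {s : State} (hs : SampleEnv n i Q s)
    {f : State → ℝ≥0∞} (F : Bits n → ℝ≥0∞) (hf : ∀ x t, CoinPost s x t → f t ≤ F x) :
    coinsProg.expect U f s ≤ (2 ^ n)⁻¹ * ∑ x, F x := by
  classical
  rw [coinsProg]
  simp only [expect_seq, expect_add]
  set s' := ((((s.write 30 (s.mem 7 + s.mem 3)).tick 1)).write 31 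
    ((((s.write 30 (s.mem 7 + s.mem 3)).tick 1)).mem 9 +
      (((s.write 30 (s.mem 7 + s.mem 3)).tick 1)).mem 3)).tick 1 with hs'
  have hN : (s'.mem 0).toNat = n := by simp [hs', hs.num]
  refine le_trans (expect_mono (g := coinPotential s F n) fun t _ => ?_) ?_
  · by_cases h : CoinInv n s n t
    swap
    · simp [coinPotential, h]
    -- Read the string back from memory; for `k = n` it is the only surviving summand of the
    -- potential.
    let x : Bits n := fun q => if t.mem (50 + q) = 1 then 1 else 0
    have hx : ∀ q : Fin n, t.mem (50 + q) = ((x q : ℕ) : ℤ) := by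
      intro q
      rcases h.bits q q.2 with h | h <;> simp [x, h]
    rw [coinPotential, if_pos h, Finset.sum_eq_single x]
    · rw [if_pos fun q _ => hx q]
      simpa using hf x t ⟨h.frame, hx, fun q => h.axes q q.2, h.acc, h.out, h.time, h.queries⟩
    · intro z _ hz
      rw [if_neg]
      intro hz'
      refine hz (funext fun q => Fin.ext ?_)
      have := (hz' q q.2).symm.trans (hx q)
      exact_mod_cast this
    · simp
  · have := expect_loop_le (U := U) (a := 0) (s := s') (coinPotential s F)
      fun k hk t => coinPotential_step (U := U) hs F (by omega) t
    rw [hN] at this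
    refine this.trans ?_
    rw [coinPotential, if_pos]
    · simp
    · refine ⟨⟨fun q hq => ?_⟩, ?_, ?_, by simp, by simp, ?_, rfl, rfl, rfl⟩
      · simp [hs']
        rw [if_neg (by omega), if_neg (by omega)]
      all_goals simp [hs', hs.inBits, hs.zero, hs.inAxes]

end

/-! ### The sign of an outcome and the law of a single sample -/

section

variable {n : ℕ} {U : UnitaryOp n}

theorem sure_skip {s : State} {G : State → Prop} :
    Sure U skip s G ↔ G ((s.write 49 (s.mem 3 + s.mem 3)).tick 1) := sure_add

/-- Both branches take the same time, because `skip` spends one step on the dead cell 49. -/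
theorem sure_flipProg {a : ℕ} {b : Fin 2} {s : State} (h3 : s.mem 3 = 0)
    (hb : s.mem a = ((b : ℕ) : ℤ)) {G : State → Prop}
    (hG : ∀ t : State, (∀ q, q ≠ 33 → q ≠ 49 → t.mem q = s.mem q) →
      t.mem 33 = s.mem 33 * bitSign b → t.out = s.out → t.time = s.time + 2 →
      t.queries = s.queries → G t) :
    Sure U (flipProg a) s G := by
  rw [flipProg, sure_ifPos, sure_sub, sure_skip]
  rcases (by omega : b = 0 ∨ b = 1) with rfl | rfl
  · refine ⟨fun h => absurd h (by simp [hb]), fun _ => hG _ ?_ ?_ rfl rfl rfl⟩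
    · intro q _ h; simp [h]
    · simp [bitSign]
  · refine ⟨fun _ => hG _ ?_ ?_ rfl rfl rfl, fun h => absurd h (by simp [hb])⟩
    · intro q h _; simp [h]
    · simp [bitSign, h3]

theorem sure_signProg {i : Fin n} {Q : Fin n → Fin 4} {s : State} (hs : SampleEnv n i Q s)
    {x y : Bits n} (hx : s.mem (50 + i) = ((x i : ℕ) : ℤ))
    (hy : ∀ q : Fin n, s.mem (50 + n + q) = ((y q : ℕ) : ℤ)) :
    Sure U signProg s fun t => Frame n s t ∧ t.mem 33 = bitSign (x i) * stringSign Q y ∧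
      t.mem 40 = s.mem 40 ∧ t.out = s.out ∧ t.time ≤ s.time + 20 + 10 * n ∧
      t.queries = s.queries := by
  obtain ⟨r, hr, h22, hQ⟩ := hs.row
  have hi := i.2
  -- Extended by 1 beyond `n`, so that the loop invariant can be a product over an initial segment
  -- of ℕ.
  let g : ℕ → ℤ := fun j => if h : j < n then (if Q ⟨j, h⟩ = 0 then 1 else bitSign (y ⟨j, h⟩)) else 1
  have hg : stringSign Q y = ∏ j ∈ Finset.range n, g j := by
    rw [Finset.prod_range]
    refine Finset.prod_congr rfl fun q _ => ?_
    simp [g]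
  rw [hg]
  simp only [signProg, sure_seq, sure_set, sure_add, sure_load]
  apply sure_flipProg (b := x i)
  · simp [hs.zero]
  · simp only [State.addr, mem_write, mem_tick, hs.inBits, hs.qubit]
    norm_num
    rw [show (50 + ((i : ℕ) : ℤ)).toNat = 50 + i by omega, if_neg (by omega), if_neg (by omega), hx]
  intro t ht ht33 hto htt htq
  refine Sure.mono (sure_loop (N := n) (fun k u => Frame n s u ∧
    (∀ q, 50 ≤ q → u.mem q = s.mem q) ∧ u.mem 30 = r + k ∧ u.mem 31 = 50 + n + k ∧
    u.mem 33 = bitSign (x i) * ∏ j ∈ Finset.range k, g j ∧ u.mem 40 = s.mem 40 ∧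
    u.out = s.out ∧ u.time ≤ s.time + 20 + 10 * k ∧ u.queries = s.queries) ?_ ?_ ?_) ?_
  · have := ht 0 (by omega) (by omega)
    simp [this, hs.num]
  · have h3 := ht 3 (by omega) (by omega)
    have h8 := ht 8 (by omega) (by omega)
    have h22' := ht 22 (by omega) (by omega)
    have h40' := ht 40 (by omega) (by omega)
    simp at h3 h8 h22' h40' ht33
    refine ⟨⟨fun q hq => ?_⟩, fun q hq => ?_, ?_, ?_, ?_, ?_, ?_, ?_, ?_⟩
    · simp
      rw [if_neg (by omega), if_neg (by omega), ht q (by omega) (by omega)]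
      simp
      rw [if_neg (by omega), if_neg (by omega), if_neg (by omega)]
    · simp
      rw [if_neg (by omega), if_neg (by omega), ht q (by omega) (by omega)]
      simp
      rw [if_neg (by omega), if_neg (by omega), if_neg (by omega)]
    · simp [h22', h3, h22, hs.zero]
    · simp [h8, h3, hs.outBits, hs.zero]
    · simp [ht33]
    · simp [h40']
    · simp [hto]
    · simp [htt]
    · simp [htq]
  · rintro k hk u ⟨hf, hu, h30, h31, h33, h40, ho, htime, hq⟩
    have u0 : u.mem 3 = 0 := by rw [hf.mem _ (by omega), hs.zero]
    have u1 : u.mem 2 = 1 := by rw [hf.mem _ (by omega), hs.one]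
    have uQ : u.mem (r + k) = ((Q ⟨k, hk⟩ : ℕ) : ℤ) := by rw [hf.mem _ (by omega), hQ ⟨k, hk⟩]
    have uy : u.mem (50 + n + k) = ((y ⟨k, hk⟩ : ℕ) : ℤ) := by rw [hu _ (by omega), hy ⟨k, hk⟩]
    have a30 : (u.mem 30).toNat = r + k := by omega
    have a31 : (u.mem 31).toNat = 50 + n + k := by omega
    have ne1 : ¬ (50 + n + k = 32) := by omega
    simp only [sure_seq, sure_add, sure_load, sure_ifPos, sure_skip]
    have gk : g k = if Q ⟨k, hk⟩ = 0 then 1 else bitSign (y ⟨k, hk⟩) := by simp [g, hk]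
    constructor
    · intro hpos
      simp [State.addr, a30, uQ] at hpos
      have hne : Q ⟨k, hk⟩ ≠ 0 := fun h => by simp [h] at hpos
      apply sure_flipProg (b := y ⟨k, hk⟩)
      · simp [u0]
      · simp [State.addr, a31, ne1, uy]
      intro v hv hv33 hvo hvt hvq
      have v2 := hv 2 (by omega) (by omega)
      have v30 := hv 30 (by omega) (by omega)
      have v31 := hv 31 (by omega) (by omega)
      have v40 := hv 40 (by omega) (by omega)
      simp at v2 v30 v31 v40 hv33 hvt
      refine ⟨⟨fun q hq => ?_⟩, fun q hq => ?_, ?_, ?_, ?_, ?_, ?_, ?_, ?_⟩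
      · simp
        rw [if_neg (by omega), if_neg (by omega), hv q (by omega) (by omega)]
        simp
        rw [if_neg (by omega), if_neg (by omega), hf.mem q (by omega)]
      · simp
        rw [if_neg (by omega), if_neg (by omega), hv q (by omega) (by omega)]
        simp
        rw [if_neg (by omega), if_neg (by omega), hu q (by omega)]
      · simp [v30, v2, h30, u1]; ring
      · simp [v31, v2, h31, u1]; ring
      · simp [hv33, h33, Finset.prod_range_succ, gk, hne]; ring
      · simp [v40, h40]
      · simp [hvo, ho]
      · simp [hvt]; omega
      · simp [hvq, hq]
    · intro hpos
      simp [State.addr, a30, uQ] at hpos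
      refine ⟨⟨fun q hq => ?_⟩, fun q hq => ?_, ?_, ?_, ?_, ?_, ?_, ?_, ?_⟩
      · simp
        rw [if_neg (by omega), if_neg (by omega), if_neg (by omega), if_neg (by omega),
          hf.mem q (by omega)]
      · simp
        rw [if_neg (by omega), if_neg (by omega), if_neg (by omega), if_neg (by omega),
          hu q (by omega)]
      · simp [h30, u1]; ring
      · simp [h31, u1]; ring
      · simp [h33, Finset.prod_range_succ, gk, hpos]
      · simp [h40]
      · simp [ho]
      · simp; omega
      · simp [hq]
  · rintro u ⟨hf, -, -, -, h33, h40, ho, htime, hq⟩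
    exact ⟨hf, h33, h40, ho, htime, hq⟩

theorem bitSign_cases (b : Fin 2) : bitSign b = 1 ∨ bitSign b = -1 := by
  unfold bitSign
  split <;> simp

theorem isUnit_bitSign (b : Fin 2) : IsUnit (bitSign b) := by
  rw [Int.isUnit_iff]
  exact bitSign_cases b

theorem isUnit_stringSign (Q : Fin n → Fin 4) (y : Bits n) : IsUnit (stringSign Q y) := by
  unfold stringSign
  refine Finset.prod_induction _ IsUnit (fun _ _ => IsUnit.mul) isUnit_one fun q _ => ?_
  split
  · exact isUnit_one
  · exact isUnit_bitSign _

theorem sampleSign_cases (b : Fin 2) (Q : Fin n → Fin 4) (y : Bits n) :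
    bitSign b * stringSign Q y = 1 ∨ bitSign b * stringSign Q y = -1 := by
  rw [← Int.isUnit_iff]
  exact (isUnit_bitSign b).mul (isUnit_stringSign Q y)

/-- The state after one sample of sign `v`. -/
structure SamplePost (n : ℕ) (s : State) (v : ℤ) (t : State) : Prop where
  frame : Frame n s t
  acc : t.mem 40 = s.mem 40 + v
  out : t.out = s.out
  time : t.time ≤ s.time + 40 + 20 * n
  queries : t.queries = s.queries + 1

theorem readAxes_eq {s : State} {p : ℕ} {a : Fin n → Axis}
    (h : ∀ q : Fin n, ∃ c : ℕ, s.mem (p + q) = c ∧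
      (if (c : ℤ) = 1 then Axis.X else if (c : ℤ) = 2 then .Y else .Z) = a q) :
    s.readAxes n p = a := by
  funext q
  obtain ⟨c, hc, hc'⟩ := h q
  rw [State.readAxes, hc, hc']

/-- The input bits are uniform, the outcomes follow Born's rule given the input, and the sign is a
function of both. Hence a sample has the law whose mean defines `correlation`. The test function `g`
is kept general because the concentration bound needs `cosh`. -/
theorem expect_sampleProg_le {i : Fin n} {Q : Fin n → Fin 4} {P : Axis} {s : State}
    (hs : SampleEnv n i Q s) {f : State → ℝ≥0∞} {g : ℤ → ℝ} (hg : ∀ v, 0 ≤ g v)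
    (hf : ∀ v t, (v = 1 ∨ v = -1) → SamplePost n s v t → f t ≤ ENNReal.ofReal (g v)) :
    (sampleProg P).expect U f s ≤ ENNReal.ofReal ((2 ^ n : ℝ)⁻¹ * ∑ x : Bits n, ∑ y : Bits n,
      ‖amplitude U (inputAxes i P) x (fun q => pauliAxis (Q q)) y‖ ^ 2 *
        g (bitSign (x i) * stringSign Q y)) := by
  rw [sampleProg, expect_seq]
  refine (expect_coinsProg_le hs (fun x => ∑ y, ENNReal.ofReal
    (‖amplitude U (inputAxes i P) x (fun q => pauliAxis (Q q)) y‖ ^ 2 *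
      g (bitSign (x i) * stringSign Q y))) ?_).trans (le_of_eq ?_)
  · intro x t ht
    have env := hs.congr ht.frame
    obtain ⟨r, hr, h22, hQ⟩ := env.row
    have hi := i.2
    simp only [expect_seq, expect_add, expect_set, expect_store, expect_query]
    refine Finset.sum_le_sum fun y _ => ?_
    rw [ENNReal.ofReal_mul (by positivity)]
    set s1 := ((((t.write 31 (t.mem 9 + t.mem 20)).tick 1).write 32 (P.code : ℤ)).tick 1) with hs1
    have a31 : s1.addr 31 = 50 + 2 * n + i := by
      simp [hs1, State.addr, env.inAxes, env.qubit]; omega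
    rw [a31]
    set s2 := (s1.write (50 + 2 * n + i) (s1.mem 32)).tick 1 with hs2
    have m2 : ∀ q, s2.mem q = if q = 50 + 2 * n + i then (P.code : ℤ) else if q = 32 then
        (P.code : ℤ) else if q = 31 then 50 + 2 * (n : ℤ) + i else t.mem q := by
      intro q
      simp [hs2, hs1, env.inAxes, env.qubit]
    have e1 : s2.addr 9 = 50 + 2 * n := by
      rw [State.addr, m2, if_neg (by omega), if_neg (by omega), if_neg (by omega), env.inAxes]
      omega
    have e2 : s2.addr 7 = 50 := by
      rw [State.addr, m2, if_neg (by omega), if_neg (by omega), if_neg (by omega), env.inBits]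
      omega
    have e3 : s2.addr 22 = r := by
      rw [State.addr, m2, if_neg (by omega), if_neg (by omega), if_neg (by omega), h22]
      omega
    have e4 : s2.addr 8 = 50 + n := by
      rw [State.addr, m2, if_neg (by omega), if_neg (by omega), if_neg (by omega), env.outBits]
      omega
    have r1 : s2.readAxes n (50 + 2 * n) = inputAxes i P := by
      refine readAxes_eq fun q => ?_
      by_cases hq : q = i
      · subst hq
        refine ⟨P.code, by rw [m2, if_pos rfl], ?_⟩
        cases P <;> simp [Axis.code, inputAxes]
      -- The loop of coin flips cleared these cells, and the code 0 is read as the axis Z.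
      · refine ⟨0, ?_, by simp [inputAxes, hq]⟩
        have : (q : ℕ) ≠ i := fun h => hq (Fin.ext h)
        rw [m2, if_neg (by omega), if_neg (by omega), if_neg (by omega), ht.axes]
        rfl
    have r2 : s2.readBits n 50 = x := by
      funext q
      have hm : s2.mem (50 + q) = ((x q : ℕ) : ℤ) := by
        rw [m2, if_neg (by omega), if_neg (by omega), if_neg (by omega), ht.bits]
      rw [State.readBits, hm]
      rcases (by omega : x q = 0 ∨ x q = 1) with h | h <;> simp [h]
    -- The row of the Pauli string itself serves as the list of measurement axes. Identity letters
    -- are measured in the Z basis, and `stringSign` ignores their outcomes.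
    have r3 : s2.readAxes n r = fun q => pauliAxis (Q q) := by
      refine readAxes_eq fun q => ⟨Q q, ?_, ?_⟩
      · rw [m2, if_neg (by omega), if_neg (by omega), if_neg (by omega), hQ]
      · unfold pauliAxis
        generalize Q q = c
        fin_cases c <;> simp
    rw [e1, e2, e3, e4, r1, r2, r3]
    simp only [Bool.false_eq_true, if_false]
    have hexp : experiment U (inputAxes i P) x (fun q => pauliAxis (Q q)) y = ENNReal.ofReal
        (‖amplitude U (inputAxes i P) x (fun q => pauliAxis (Q q)) y‖ ^ 2) := rfl
    rw [hexp]
    refine mul_le_mul_right ?_ _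
    set s3 : State := { (s2.writeBits (50 + n) y).tick (4 * n + 1) with queries := s2.queries + 1 }
      with hs3
    have m3 : ∀ q, s3.mem q = if h : 50 + n ≤ q ∧ q - (50 + n) < n then
        ((y ⟨q - (50 + n), h.2⟩ : ℕ) : ℤ) else s2.mem q := fun q => rfl
    have f3 : Frame n t s3 := by
      refine ⟨fun q hq => ?_⟩
      rw [m3, dif_neg (by omega), m2, if_neg (by omega), if_neg (by omega), if_neg (by omega)]
    have env3 := env.congr f3
    have hx3 : s3.mem (50 + i) = ((x i : ℕ) : ℤ) := by
      rw [m3, dif_neg (by omega), m2, if_neg (by omega), if_neg (by omega), if_neg (by omega),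
        ht.bits]
    have hy3 : ∀ q : Fin n, s3.mem (50 + n + q) = ((y q : ℕ) : ℤ) := by
      intro q
      rw [m3, dif_pos ⟨by omega, by omega⟩]
      congr 3
      exact Fin.ext (by simp)
    refine expect_le_of_sure (sure_signProg env3 hx3 hy3) ?_
    rintro u ⟨hfu, h33, h40, hou, htu, hqu⟩
    refine hf _ _ (sampleSign_cases _ _ _) ⟨?_, ?_, ?_, ?_, ?_⟩
    · refine (ht.frame.trans (f3.trans hfu)).trans ⟨fun q hq => ?_⟩
      simp
      omega
    · have : s3.mem 40 = s.mem 40 := by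
        rw [m3, dif_neg (by omega), m2, if_neg (by omega), if_neg (by omega), if_neg (by omega),
          ht.acc]
      simp [h33, h40, this]
    · have : s3.out = t.out := rfl
      simp [hou, this, ht.out]
    · have : s3.time = t.time + 3 + (4 * n + 1) := rfl
      have := ht.time
      simp
      omega
    · have : s3.queries = t.queries + 1 := rfl
      simp [hqu, this, ht.queries]
  · rw [ENNReal.ofReal_mul (by positivity), ENNReal.ofReal_inv_of_pos (by positivity),
      ENNReal.ofReal_pow (by norm_num), ENNReal.ofReal_sum_of_nonneg
        fun x _ => Finset.sum_nonneg fun y _ => mul_nonneg (by positivity) (hg _)]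
    congr 2
    · simp
    · refine funext fun x => ?_
      rw [ENNReal.ofReal_sum_of_nonneg fun y _ => mul_nonneg (by positivity) (hg _)]

end

/-! ### Concentration of the empirical correlation -/

section

variable {n : ℕ} {U : UnitaryOp n}

theorem sum_sq_amplitude (U : UnitaryOp n) (a c : Fin n → Axis) (x : Bits n) :
    ∑ y, ‖amplitude U a x c y‖ ^ 2 = 1 := by
  have h := sum_normSq_amplitude U a x c
  rw [← ENNReal.ofReal_sum_of_nonneg fun _ _ => by positivity, ENNReal.ofReal_eq_one] at h
  exact h

/-- Averages over the outcomes of samples are averages over a probability distribution. -/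
theorem sample_average_const (U : UnitaryOp n) (a c : Fin n → Axis) (r : ℝ) :
    (2 ^ n : ℝ)⁻¹ * ∑ x : Bits n, ∑ y : Bits n, ‖amplitude U a x c y‖ ^ 2 * r = r := by
  simp_rw [← Finset.sum_mul, sum_sq_amplitude]
  simp

theorem abs_correlation_le (U : UnitaryOp n) (i : Fin n) (P : Axis) (Q : Fin n → Fin 4) :
    |correlation U i P Q| ≤ 1 := by
  rw [← sample_average_const U (inputAxes i P) (fun q => pauliAxis (Q q)) 1, correlation, abs_mul,
    abs_of_pos (by positivity : (0 : ℝ) < (2 ^ n)⁻¹)]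
  refine mul_le_mul_of_nonneg_left ?_ (by positivity)
  refine (Finset.abs_sum_le_sum_abs _ _).trans (Finset.sum_le_sum fun x _ => ?_)
  refine (Finset.abs_sum_le_sum_abs _ _).trans (Finset.sum_le_sum fun y _ => ?_)
  rw [abs_mul, abs_of_nonneg (by positivity)]
  refine mul_le_mul_of_nonneg_left (le_of_eq ?_) (by positivity)
  rcases sampleSign_cases (x i) Q y with h | h <;> simp [h]

/-- The range `2 * l` is that of a centred sign multiplied by `l`; the restriction on `l` keeps `|x|
≤ 1`, where the quadratic remainder of the exponential is at most `x ^ 2`. -/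
theorem exp_le_quadratic {x l : ℝ} (hx : |x| ≤ 2 * l) (hl : l ≤ 1 / 2) :
    Real.exp x ≤ 1 + x + 4 * l ^ 2 := by
  have h := (abs_le.1 (Real.abs_exp_sub_one_sub_id_le (x := x) (by linarith))).2
  have h2 : x ^ 2 ≤ (2 * l) ^ 2 := sq_le_sq' (by linarith [(abs_le.1 hx).1]) (abs_le.1 hx).2
  nlinarith

/-- The increment is a sign minus its mean. In the second-order bound of the exponential the linear
term averages to zero, which leaves the factor `1 + 4 * l ^ 2`. Using `cosh` treats both tails at
once. -/
theorem sample_cosh_le (U : UnitaryOp n) (i : Fin n) (P : Axis) (Q : Fin n → Fin 4) {l : ℝ}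
    (hl0 : 0 ≤ l) (hl : l ≤ 1 / 2) (w : ℝ) :
    (2 ^ n : ℝ)⁻¹ * ∑ x : Bits n, ∑ y : Bits n,
      ‖amplitude U (inputAxes i P) x (fun q => pauliAxis (Q q)) y‖ ^ 2 *
        Real.cosh (l * (w + (((bitSign (x i) * stringSign Q y : ℤ) : ℝ) - correlation U i P Q))) ≤
      Real.cosh (l * w) * Real.exp (4 * l ^ 2) := by
  set a := correlation U i P Q with ha
  have ha1 := abs_le.1 (abs_correlation_le U i P Q)
  -- The pointwise bound is affine in the sign `v`, so averaging it only replaces `v` by the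
  -- correlation `a`.
  set α := (Real.exp (l * w) + Real.exp (-(l * w))) / 2 * (1 + 4 * l ^ 2) -
    (Real.exp (l * w) - Real.exp (-(l * w))) / 2 * (l * a) with hα
  set β := (Real.exp (l * w) - Real.exp (-(l * w))) / 2 * l with hβ
  have key : ∀ v : ℤ, (v = 1 ∨ v = -1) →
      Real.cosh (l * (w + ((v : ℝ) - a))) ≤ α + β * v := by
    intro v hv
    have hv' : |(v : ℝ) - a| ≤ 2 := by
      rcases hv with rfl | rfl <;> rw [abs_le] <;> push_cast <;> constructor <;> linarith
    have h1 : |l * ((v : ℝ) - a)| ≤ 2 * l := by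
      rw [abs_mul, abs_of_nonneg hl0]; nlinarith
    have h2 : |-(l * ((v : ℝ) - a))| ≤ 2 * l := by rwa [abs_neg]
    have e1 := mul_le_mul_of_nonneg_left (exp_le_quadratic h1 hl) (Real.exp_pos (l * w)).le
    have e2 := mul_le_mul_of_nonneg_left (exp_le_quadratic h2 hl) (Real.exp_pos (-(l * w))).le
    rw [← Real.exp_add] at e1 e2
    rw [Real.cosh_eq, mul_add, neg_add, hα, hβ]
    linarith
  calc _ ≤ (2 ^ n : ℝ)⁻¹ * ∑ x : Bits n, ∑ y : Bits n,
      ‖amplitude U (inputAxes i P) x (fun q => pauliAxis (Q q)) y‖ ^ 2 *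
        (α + β * ((bitSign (x i) * stringSign Q y : ℤ) : ℝ)) := by
        refine mul_le_mul_of_nonneg_left (Finset.sum_le_sum fun x _ => Finset.sum_le_sum
          fun y _ => mul_le_mul_of_nonneg_left (key _ (sampleSign_cases _ _ _)) ?_) ?_ <;>
          positivity
    _ = α + β * a := by
        rw [ha, correlation]
        nth_rewrite 2 [← sample_average_const U (inputAxes i P) (fun q => pauliAxis (Q q)) α]
        simp_rw [mul_add, Finset.sum_add_distrib, mul_add, Finset.mul_sum]
        congr 1
        refine Finset.sum_congr rfl fun x _ => Finset.sum_congr rfl fun y _ => ?_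
        ring
    _ = Real.cosh (l * w) * (1 + 4 * l ^ 2) := by rw [Real.cosh_eq, hα, hβ]; ring
    _ ≤ _ := by
        refine mul_le_mul_of_nonneg_left ?_ (Real.cosh_pos _).le
        have := Real.add_one_le_exp (4 * l ^ 2)
        linarith

/-- `bound` holds on every run, since the accumulator is a sum of `k` signs. It limits the time of
the later arithmetic even when the estimate is bad. -/
structure EstimateInv (n : ℕ) (s : State) (k : ℕ) (t : State) : Prop where
  frame : Frame n s t
  bound : |t.mem 40| ≤ k
  out : t.out = s.out
  time : t.time ≤ s.time + 2 + (41 + 20 * n) * k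
  queries : t.queries = s.queries + k

/-- The state after the estimation of a correlation `a`, up to an error `τ`. -/
structure EstimatePost (n T : ℕ) (a τ : ℝ) (s : State) (t : State) : Prop where
  inv : EstimateInv n s T t
  accurate : |(t.mem 40 : ℝ) - T * a| ≤ τ * T

-- The normalized exponential moment of the centred sum. Because of the value `⊤` outside the
-- invariant, a finite expectation also certifies that the invariant never fails.
open Classical in
def estimatePotential (n : ℕ) (s : State) (l a : ℝ) (k : ℕ) (t : State) : ℝ≥0∞ :=
  if EstimateInv n s k t then
    ENNReal.ofReal (Real.cosh (l * ((t.mem 40 : ℝ) - k * a)) * Real.exp (-(4 * l ^ 2 * k)))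
  else ⊤

/-- The potential starts at `cosh 0 = 1`, and `sample_cosh_le` says that the normalization pays for
the growth in each pass. -/
theorem expect_estimateProg_le {i : Fin n} {Q : Fin n → Fin 4} {P : Axis} {s : State} {T : ℕ}
    (hs : SampleEnv n i Q s) (hT : s.mem 5 = T) {l : ℝ} (hl0 : 0 ≤ l) (hl : l ≤ 1 / 2) :
    (estimateProg P).expect U (estimatePotential n s l (correlation U i P Q) T) s ≤ 1 := by
  rw [estimateProg, expect_seq, expect_set]
  set s' := (s.write 40 0).tick 1 with hs'
  have hN : (s'.mem 5).toNat = T := by simp [hs', hT]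
  have := expect_loop_le (U := U) (a := 5) (s := s') (P := sampleProg P)
    (estimatePotential n s l (correlation U i P Q)) fun k hk t => ?_
  · rw [hN] at this
    refine this.trans ?_
    rw [estimatePotential, if_pos]
    · simp [hs']
    · refine ⟨⟨fun q hq => ?_⟩, ?_, rfl, ?_, rfl⟩
      · simp [hs']
        omega
      · simp [hs']
      · simp [hs']
  · by_cases h : EstimateInv n s k t
    swap
    · simp [estimatePotential, h]
    have env : SampleEnv n i Q (t.tick 1) := (hs.congr h.frame).congr ⟨fun _ _ => rfl⟩
    refine (expect_sampleProg_le (P := P) env (g := fun v =>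
      Real.cosh (l * ((t.mem 40 : ℝ) + v - (k + 1) * correlation U i P Q)) *
        Real.exp (-(4 * l ^ 2 * (k + 1)))) (fun v => by positivity) ?_).trans ?_
    · intro v u hv hu
      rw [estimatePotential, if_pos]
      · have := hu.acc
        rw [this]
        push_cast
        exact le_of_eq rfl
      · refine ⟨h.frame.trans (Frame.trans (t := t.tick 1) ⟨fun _ _ => rfl⟩ hu.frame), ?_, ?_, ?_, ?_⟩
        · have h1 := hu.acc
          have h2 := h.bound
          simp only [mem_tick] at h1
          rw [h1]
          push_cast
          refine (abs_add_le _ _).trans (add_le_add h2 ?_)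
          rcases hv with rfl | rfl <;> simp
        · rw [hu.out, out_tick, h.out]
        · have h1 := hu.time
          have h2 := h.time
          simp only [time_tick] at h1
          rw [mul_add]
          omega
        · have h1 := hu.queries
          have h2 := h.queries
          simp only [queries_tick] at h1
          omega
    · rw [estimatePotential, if_pos h]
      refine ENNReal.ofReal_le_ofReal ?_
      have := sample_cosh_le U i P Q hl0 hl ((t.mem 40 : ℝ) - k * correlation U i P Q)
      have h2 := mul_le_mul_of_nonneg_right this (Real.exp_pos (-(4 * l ^ 2 * (k + 1)))).le
      rw [mul_assoc (Real.cosh _), ← Real.exp_add,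
        show 4 * l ^ 2 + -(4 * l ^ 2 * (k + 1)) = -(4 * l ^ 2 * k) by ring] at h2
      refine le_trans (le_of_eq ?_) h2
      rw [mul_assoc (2 ^ n : ℝ)⁻¹, Finset.sum_mul]
      congr 1
      refine Finset.sum_congr rfl fun x _ => ?_
      rw [Finset.sum_mul]
      refine Finset.sum_congr rfl fun y _ => ?_
      rw [← mul_assoc]
      congr 4
      ring

/-- For `l = 0` the potential is 1 on the invariant and `⊤` elsewhere, so an expectation of at most
1 excludes all other states. The accuracy 2 is trivial: the sum and `T * a` both have modulus at
most `T`. -/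
theorem sure_estimateProg {i : Fin n} {Q : Fin n → Fin 4} {P : Axis} {s : State} {T : ℕ}
    (hs : SampleEnv n i Q s) (hT : s.mem 5 = T) :
    Sure U (estimateProg P) s (EstimatePost n T (correlation U i P Q) 2 s) := by
  have h := expect_estimateProg_le (U := U) (P := P) hs hT (l := 0) le_rfl (by norm_num)
  intro t ht
  have hI : EstimateInv n s T t := by
    by_contra hI
    have h2 : (P |> estimateProg).run U s t * ⊤ ≤ 1 := by
      refine le_trans ?_ ((ENNReal.le_tsum t).trans h)
      rw [estimatePotential, if_neg hI]
    rw [ENNReal.mul_top ((PMF.mem_support_iff _ _).1 ht)] at h2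
    exact absurd h2 (by simp)
  refine ⟨hI, ?_⟩
  have h1 : |(t.mem 40 : ℝ)| ≤ T := by exact_mod_cast hI.bound
  have h2 : |(T : ℝ) * correlation U i P Q| ≤ T := by
    rw [abs_mul, Nat.abs_cast]
    exact mul_le_of_le_one_right (by positivity) (abs_correlation_le U i P Q)
  linarith [abs_sub (t.mem 40 : ℝ) (T * correlation U i P Q)]

/-- The Chernoff bound with `l = τ / 8`: at deviation `τ * T` the `cosh` is at least `exp (τ² T / 8)
/ 2` and the normalization costs `exp (-τ² T / 16)`. -/
theorem whp_estimateProg {i : Fin n} {Q : Fin n → Fin 4} {P : Axis} {s : State} {T : ℕ}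
    (hs : SampleEnv n i Q s) (hT : s.mem 5 = T) {τ : ℝ} (hτ0 : 0 ≤ τ) (hτ : τ ≤ 1) :
    Whp U (estimateProg P) s (EstimatePost n T (correlation U i P Q) τ s)
      (ENNReal.ofReal (2 * Real.exp (-(τ ^ 2 * T / 16)))) := by
  have h := expect_estimateProg_le (U := U) (P := P) hs hT (l := τ / 8) (by positivity)
    (by linarith)
  set c := ENNReal.ofReal (2 * Real.exp (-(τ ^ 2 * T / 16))) with hc
  set a := correlation U i P Q with ha
  refine whp_of_expect_le (f := fun t => c * estimatePotential n s (τ / 8) a T t) ?_ ?_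
  · intro t ht
    have hc0 : c ≠ 0 := by
      rw [hc, Ne, ENNReal.ofReal_eq_zero, not_le]
      positivity
    by_cases hI : EstimateInv n s T t
    swap
    · simp [estimatePotential, if_neg hI, ENNReal.mul_top hc0]
    have hacc : τ * T < |(t.mem 40 : ℝ) - T * a| := by
      by_contra hcon
      exact ht ⟨hI, not_lt.1 hcon⟩
    rw [estimatePotential, if_pos hI, hc, ← ENNReal.ofReal_mul (by positivity), ENNReal.one_le_ofReal]
    have h1 : Real.exp (τ / 8 * (τ * T)) / 2 ≤
        Real.cosh (τ / 8 * ((t.mem 40 : ℝ) - T * a)) := by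
      rw [← Real.cosh_abs, abs_mul, abs_of_nonneg (by positivity : 0 ≤ τ / 8), Real.cosh_eq]
      have := Real.exp_le_exp.2 (mul_le_mul_of_nonneg_left hacc.le (by positivity : 0 ≤ τ / 8))
      have := Real.exp_pos (-(τ / 8 * |(t.mem 40 : ℝ) - T * a|))
      linarith
    have h2 : (1 : ℝ) = 2 * Real.exp (-(τ ^ 2 * T / 16)) * (Real.exp (τ / 8 * (τ * T)) / 2 *
        Real.exp (-(4 * (τ / 8) ^ 2 * T))) := by
      rw [show ∀ x y z : ℝ, 2 * x * (y / 2 * z) = x * y * z by intros; ring, ← Real.exp_add,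
        ← Real.exp_add, eq_comm, Real.exp_eq_one_iff]
      ring
    rw [h2]
    gcongr
  · unfold Prog.expect
    simp_rw [mul_left_comm _ c]
    rw [ENNReal.tsum_mul_left]
    exact mul_le_of_le_one_right zero_le h

end

section

/-! ### The gates that the algorithm prints -/

/-- The Pauli operators `I`, `X`, `Y`, `Z` with entries in the Gaussian integers. -/
def pauliG : Fin 4 → Fin 2 → Fin 2 → GaussianInt :=
  ![fun r c => if r = c then 1 else 0, fun r c => if r = c then 0 else 1,
    fun r c => if r = c then 0 else if r = 0 then ⟨0, -1⟩ else ⟨0, 1⟩,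
    fun r c => if r = c then (if r = 0 then 1 else -1) else 0]

/-- The Pauli operators. -/
def pauli (c : Fin 4) : Matrix (Fin 2) (Fin 2) ℂ :=
  Matrix.of fun r s => GaussianInt.toComplex (pauliG c r s)

/-- The number of a Pauli axis. -/
def Axis.index : Axis → Fin 4
  | .X => 1
  | .Y => 2
  | .Z => 3

/-- A Pauli axis different from the given one. -/
def Axis.mate : Axis → Fin 4
  | .X => 3
  | .Y => 3
  | .Z => 1

/-- The bit number `j` of a basis label. -/
def labelBit {k : ℕ} (r : Fin (2 ^ k)) (j : Fin k) : Fin 2 := finFunctionFinEquiv.symm r j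

/-- Twice the operator `(1 + σ ⊗ 1 + 1 ⊗ τ - σ ⊗ τ) / 2` that applies `τ` if `σ` is `-1`. -/
def ctrlEntry (σ τ : Fin 4) (r c : Fin (2 ^ 2)) : GaussianInt :=
  pauliG 0 (labelBit r 0) (labelBit c 0) * pauliG 0 (labelBit r 1) (labelBit c 1) +
  pauliG σ (labelBit r 0) (labelBit c 0) * pauliG 0 (labelBit r 1) (labelBit c 1) +
  pauliG 0 (labelBit r 0) (labelBit c 0) * pauliG τ (labelBit r 1) (labelBit c 1) -
  pauliG σ (labelBit r 0) (labelBit c 0) * pauliG τ (labelBit r 1) (labelBit c 1)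

/-- With Gaussian integer entries unitarity is a finite decidable check; 4 is the square of the
common denominator 2. -/
theorem ctrlEntry_unitary : ∀ σ τ r c, ∑ k, ctrlEntry σ τ r k * star (ctrlEntry σ τ c k) =
    if r = c then 4 else 0 := by
  decide +kernel

theorem ratMatrix_eq {N : ℕ} (den : ℕ) (g : Fin N → Fin N → GaussianInt) :
    ratMatrix N den (fun r c => (g r c).re) (fun r c => (g r c).im) =
      Matrix.of fun r c => GaussianInt.toComplex (g r c) / den := by
  ext r c
  simp [ratMatrix, GaussianInt.toComplex_def]

theorem ratMatrix_mem {N : ℕ} {den : ℕ} (hd : den ≠ 0) (g : Fin N → Fin N → GaussianInt)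
    (h : ∀ r c, ∑ k, g r k * star (g c k) = if r = c then (den : GaussianInt) ^ 2 else 0) :
    ratMatrix N den (fun r c => (g r c).re) (fun r c => (g r c).im) ∈
      Matrix.unitaryGroup (Fin N) ℂ := by
  rw [ratMatrix_eq, Matrix.mem_unitaryGroup_iff]
  ext r c
  have hd' : (den : ℂ) ≠ 0 := by exact_mod_cast hd
  have := congrArg GaussianInt.toComplex (h r c)
  simp only [map_sum, map_mul, GaussianInt.toComplex_star] at this
  simp only [Matrix.mul_apply, Matrix.star_apply, Matrix.of_apply, star_div₀, Complex.star_def,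
    Complex.conj_natCast, div_mul_div_comm]
  rw [← Finset.sum_div, this, Matrix.one_apply]
  split
  · simp
    field_simp
  · simp

variable {n : ℕ}

/-- The qubit `q` of the first register and the qubit `i` of the second register. -/
def pairWire (q i : Fin n) : Fin 2 ↪ Fin (n + n) where
  toFun := ![Fin.castAdd n q, Fin.natAdd n i]
  inj' := by
    have h : Fin.castAdd n q ≠ Fin.natAdd n i := by
      intro h
      have := congrArg Fin.val h
      simp at this
      omega
    intro a b hab
    fin_cases a <;> fin_cases b <;> simp_all

/-- The gate that applies `τ` on the qubit `i` of the second register if `σ` is `-1` on the qubit `q`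
of the first register. -/
def ctrlGate (q i : Fin n) (σ τ : Fin 4) : MatrixGate (n + n) where
  arity := 2
  wire := pairWire q i
  den := 2
  re := fun r c => (ctrlEntry σ τ r c).re
  im := fun r c => (ctrlEntry σ τ r c).im
  isUnitary := ratMatrix_mem (by norm_num) _ fun r c => by
    rw [ctrlEntry_unitary]
    norm_num

/-- The entries of the gate that exchanges two qubits. -/
def swapEntry (r c : Fin (2 ^ 2)) : GaussianInt :=
  if labelBit r 0 = labelBit c 1 ∧ labelBit r 1 = labelBit c 0 then 1 else 0

theorem swapEntry_unitary : ∀ r c, ∑ k, swapEntry r k * star (swapEntry c k) =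
    if r = c then 1 else 0 := by
  decide +kernel

/-- The gate that exchanges the qubits `q` of the two registers. -/
def swapGate (q : Fin n) : MatrixGate (n + n) where
  arity := 2
  wire := pairWire q q
  den := 1
  re := fun r c => (swapEntry r c).re
  im := fun r c => (swapEntry r c).im
  isUnitary := ratMatrix_mem (by norm_num) _ fun r c => by
    rw [swapEntry_unitary]
    norm_num

/-- Numerators of the rotation with half angle `num / den` about the axis `P`. -/
def rotEntry (P : Axis) (num den : ℤ) (r c : Fin (2 ^ 1)) : GaussianInt :=
  (if r = c then ((den * den - num * num : ℤ) : GaussianInt) else 0) +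
    ((2 * (num * den) : ℤ) : GaussianInt) *
      (⟨0, 1⟩ * pauliG P.index (labelBit r 0) (labelBit c 0))

/-- The Pythagorean identity (den² - num²)² + (2 num den)² = (den² + num²)². It is the reason why a
rational half-angle tangent gives a rational rotation. -/
theorem rotEntry_unitary (P : Axis) (num den : ℤ) (r c : Fin (2 ^ 1)) :
    ∑ k, rotEntry P num den r k * star (rotEntry P num den c k) =
      if r = c then ((den * den + num * num : ℤ) : GaussianInt) ^ 2 else 0 := by
  have hb : ∀ r : Fin 2, labelBit (k := 1) r 0 = r := by decide
  change ∑ k : Fin 2, _ = _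
  rw [Fin.sum_univ_two]
  change Fin 2 at r c
  simp only [rotEntry, hb]
  cases P <;> fin_cases r <;> fin_cases c <;>
  · apply Zsqrtd.ext <;> simp [Axis.index, pauliG, Zsqrtd.re_mul, pow_two] <;> ring

/-- The rotation of the qubit `i` of the second register with half angle `num / den` about the
axis `P`. -/
def rotGate (i : Fin n) (P : Axis) (num : ℤ) (den : ℕ) (h : den ≠ 0) : MatrixGate (n + n) where
  arity := 1
  wire := ⟨fun _ => Fin.natAdd n i, fun _ _ _ => Subsingleton.elim _ _⟩
  den := den * den + num.natAbs * num.natAbs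
  re := fun r c => (rotEntry P num den r c).re
  im := fun r c => (rotEntry P num den r c).im
  isUnitary := ratMatrix_mem (by positivity) _ fun r c => by
    rw [rotEntry_unitary]
    congr 2
    rw [show ((den : ℤ) * den + num * num : ℤ) =
      ((den * den + num.natAbs * num.natAbs : ℕ) : ℤ) by simp, Int.cast_natCast]

end

section

/-! ### Programs that print gates -/

/-- The entries of a gate as it is written out. -/
def entryList {N : ℕ} (g : Fin N → Fin N → GaussianInt) : List ℤ :=
  (List.ofFn fun r => (List.ofFn fun c => [(g r c).re, (g r c).im]).flatten).flatten

/-- Print a list of constants. -/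
def printConst : List ℤ → Prog
  | [] => skip
  | v :: l => .set 34 v ;; .print 34 ;; printConst l

/-- Print the contents of a list of memory cells. -/
def printCells : List ℕ → Prog
  | [] => skip
  | a :: l => .print a ;; printCells l

/-- Multiply the cell `a` by the nonnegative cell `b`. -/
def mulProg (d a b : ℕ) : Prog := .set d 0 ;; .loop b (.add d d a)

/-- Run one of four programs, depending on the number in cell `32`. -/
def caseProg (p : Fin 4 → Prog) : Prog :=
  .ifPos 32 (.sub 32 32 2 ;; .ifPos 32 (.sub 32 32 2 ;; .ifPos 32 (p 3) (p 2)) (p 1)) (p 0)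

/-- Print the controlled gates for all letters of the Pauli string whose address is in cell `22`,
with the qubit in cell `20` of the second register as the target. -/
def lettersProg (τ : Fin 4) : Prog :=
  .set 30 0 ;; .add 31 22 3 ;; .add 35 0 20 ;;
  .loop 0 (.load 32 31 ;; .set 33 2 ;; .print 33 ;; .print 30 ;; .print 35 ;;
    -- For the letter 0 the four terms collapse to twice the identity, so identity letters print a
    -- trivial gate and the loop needs no exception.
    caseProg (fun σ => printConst (2 :: entryList (ctrlEntry σ τ))) ;;
    .add 30 30 2 ;; .add 31 31 2)

/-- Compute the entries of the rotation for the estimate in cell `40` and the step number in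
cell `21`. -/
def angleProg : Prog :=
  .add 30 21 2 ;; mulProg 31 21 30 ;; mulProg 32 4 4 ;; .add 31 31 32 ;; .add 33 5 5 ;;
  mulProg 41 33 31 ;; mulProg 42 40 4 ;; mulProg 43 41 41 ;;
  .ifPos 42 (.add 32 42 3) (.sub 32 3 42) ;; mulProg 44 32 32 ;; mulProg 45 42 41 ;;
  .add 45 45 45 ;; .sub 46 43 44 ;; .add 47 43 44 ;; .sub 48 3 45

/-- The cells that hold the entries of the rotation about an axis. -/
def rotCells : Axis → List ℕ
  | .X => [46, 3, 3, 45, 3, 45, 46, 3]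
  | .Y => [46, 3, 45, 3, 48, 3, 46, 3]
  | .Z => [46, 45, 3, 3, 3, 3, 46, 48]

/-- Print the rotation. -/
def rotProg (P : Axis) : Prog := .set 30 1 ;; .print 30 ;; .print 35 ;; .print 47 ;;
  printCells (rotCells P)

/-- Estimate a correlation and print the gates of the corresponding Pauli rotation. -/
def termProg (P : Axis) : Prog :=
  estimateProg P ;; angleProg ;; lettersProg P.mate ;; rotProg P ;; lettersProg P.mate

variable {n : ℕ} {U : UnitaryOp n}

/-- Repeated addition, whose time is linear in the multiplier. This is affordable because every
multiplier in the program is quasi-polynomial. The operands must differ from `d`, which is cleared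
first. -/
theorem sure_mulProg {d a b : ℕ} {s : State} {N : ℕ} (hda : a ≠ d) (hdb : b ≠ d)
    (hb : s.mem b = N) {G : State → Prop}
    (hG : ∀ t : State, (∀ q, q ≠ d → t.mem q = s.mem q) → t.mem d = s.mem a * N →
      t.out = s.out → t.time = s.time + 2 + 2 * N → t.queries = s.queries → G t) :
    Sure U (mulProg d a b) s G := by
  simp only [mulProg, sure_seq, sure_set]
  refine Sure.mono (sure_loop (N := N) (fun k t => (∀ q, q ≠ d → t.mem q = s.mem q) ∧
    t.mem d = s.mem a * k ∧ t.out = s.out ∧ t.time = s.time + 2 + 2 * k ∧ t.queries = s.queries)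
    (by simp [hdb, hb]) ?_ ?_) ?_
  · refine ⟨fun q hq => by simp [hq], by simp, rfl, rfl, rfl⟩
  · rintro k hk t ⟨h1, h2, h3, h4, h5⟩
    rw [sure_add]
    refine ⟨fun q hq => by simp [hq, h1 q hq], ?_, h3, ?_, h5⟩
    · simp [h2, h1 a hda]; ring
    · simp [h4]; ring
  · rintro t ⟨h1, h2, h3, h4, h5⟩
    exact hG t h1 h2 h3 h4 h5

theorem sure_printConst (l : List ℤ) (s : State) :
    Sure U (printConst l) s fun t => (∀ q, q ≠ 34 → q ≠ 49 → t.mem q = s.mem q) ∧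
      t.out = s.out ++ l ∧ t.time = s.time + 1 + 2 * l.length ∧ t.queries = s.queries := by
  induction l generalizing s with
  | nil =>
    rw [printConst, sure_skip]
    refine ⟨fun q _ h => by simp [h], by simp, rfl, rfl⟩
  | cons v l ih =>
    rw [printConst, sure_seq, sure_set, sure_seq, sure_print]
    refine (ih _).mono ?_
    rintro t ⟨h1, h2, h3, h4⟩
    refine ⟨fun q hq hq' => by simp [h1 q hq hq', hq], by simp [h2], ?_, by simp [h4]⟩
    simp at h3
    simp
    omega

theorem sure_printCells (l : List ℕ) (hl : 49 ∉ l) (s : State) :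
    Sure U (printCells l) s fun t => (∀ q, q ≠ 49 → t.mem q = s.mem q) ∧
      t.out = s.out ++ l.map s.mem ∧ t.time = s.time + 1 + l.length ∧ t.queries = s.queries := by
  induction l generalizing s with
  | nil =>
    rw [printCells, sure_skip]
    refine ⟨fun q h => by simp [h], by simp, rfl, rfl⟩
  | cons v l ih =>
    rw [printCells, sure_seq, sure_print]
    refine (ih (by simp_all) _).mono ?_
    rintro t ⟨h1, h2, h3, h4⟩
    refine ⟨fun q hq => h1 q hq, by simp [h2], ?_, h4⟩
    simp at h3
    simp
    omega

theorem length_entryList {N : ℕ} (g : Fin N → Fin N → GaussianInt) :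
    (entryList g).length = 2 * N * N := by
  simp [entryList, List.length_flatten, List.map_ofFn, Function.comp_def]
  ring

theorem sure_caseProg {p : Fin 4 → Prog} {σ : Fin 4} {s : State} (h2 : s.mem 2 = 1)
    (hσ : s.mem 32 = ((σ : ℕ) : ℤ)) {G : State → Prop}
    (h : ∀ t : State, (∀ q, q ≠ 32 → t.mem q = s.mem q) → t.out = s.out → t.time ≤ s.time + 5 →
      t.queries = s.queries → Sure U (p σ) t G) :
    Sure U (caseProg p) s G := by
  simp only [caseProg, sure_ifPos, sure_seq, sure_sub]
  fin_cases σ <;> simp at hσ <;> simp [hσ, h2]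
  all_goals refine h _ (fun q hq => ?_) rfl ?_ rfl
  all_goals simp_all

@[simp] theorem pairWire_zero (q i : Fin n) : pairWire q i 0 = Fin.castAdd n q := rfl

@[simp] theorem pairWire_one (q i : Fin n) : pairWire q i 1 = Fin.natAdd n i := rfl

theorem encode_ctrlGate (q i : Fin n) (σ τ : Fin 4) :
    (ctrlGate q i σ τ).encode = 2 :: ((q : ℕ) : ℤ) :: ((n : ℤ) + (i : ℕ)) :: 2 ::
      entryList (ctrlEntry σ τ) := by
  change (((2 : ℕ) : ℤ) :: List.ofFn fun j : Fin 2 => ((pairWire q i j : ℕ) : ℤ)) ++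
    ((2 : ℕ) : ℤ) :: entryList (ctrlEntry σ τ) = _
  simp [List.ofFn_succ, add_comm]

theorem sure_lettersProg {i : Fin n} {Q : Fin n → Fin 4} {s : State} (hs : SampleEnv n i Q s)
    (τ : Fin 4) :
    Sure U (lettersProg τ) s fun t => (∀ q, q < 30 ∨ (36 ≤ q ∧ q ≠ 49) → t.mem q = s.mem q) ∧
      t.mem 35 = (n : ℤ) + (i : ℕ) ∧
      t.out = s.out ++ encodeCircuit (List.ofFn fun q => ctrlGate q i (Q q) τ) ∧
      t.time ≤ s.time + 4 + 90 * n ∧ t.queries = s.queries := by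
  obtain ⟨r, hr, h22, hQ⟩ := hs.row
  simp only [lettersProg, sure_seq, sure_set, sure_add]
  set g : Fin n → MatrixGate (n + n) := fun q => ctrlGate q i (Q q) τ with hg
  refine Sure.mono (sure_loop (N := n) (fun k t =>
    (∀ q, q < 30 ∨ (36 ≤ q ∧ q ≠ 49) → t.mem q = s.mem q) ∧
    t.mem 30 = k ∧ t.mem 31 = r + k ∧ t.mem 35 = (n : ℤ) + (i : ℕ) ∧
      t.out = s.out ++ encodeCircuit ((List.ofFn g).take k) ∧
      t.time ≤ s.time + 4 + 90 * k ∧ t.queries = s.queries) ?_ ?_ ?_) ?_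
  · simp [hs.num]
  · refine ⟨fun q hq => ?_, ?_, ?_, ?_, ?_, ?_, rfl⟩
    · simp
      rw [if_neg (by omega), if_neg (by omega), if_neg (by omega)]
    · simp
    · simp [h22, hs.zero]
    · simp [hs.num, hs.qubit]
    · simp [encodeCircuit]
    · simp
  · rintro k hk t ⟨h1, h30, h31, h35, ho, ht, hq⟩
    have t2 : t.mem 2 = 1 := by rw [h1 _ (by omega), hs.one]
    have a31 : t.addr 31 = r + k := by rw [State.addr, h31]; omega
    have ha31 : (t.tick 1).addr 31 = r + k := a31
    have tQ : t.mem (r + k) = ((Q ⟨k, hk⟩ : ℕ) : ℤ) := by rw [h1 _ (by omega), hQ ⟨k, hk⟩]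
    simp only [sure_seq, sure_set, sure_add, sure_load, sure_print, ha31]
    apply sure_caseProg (σ := Q ⟨k, hk⟩)
    · simp [t2]
    · simp [tQ]
    intro u hu huo hut huq
    refine (sure_printConst _ _).mono ?_
    rintro v ⟨hv, hvo, hvt, hvq⟩
    have v2 := hv 2 (by omega) (by omega)
    have v30 := hv 30 (by omega) (by omega)
    have v31 := hv 31 (by omega) (by omega)
    have v35 := hv 35 (by omega) (by omega)
    have u2 := hu 2 (by omega)
    have u30 := hu 30 (by omega)
    have u31 := hu 31 (by omega)
    have u35 := hu 35 (by omega)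
    simp at u2 u30 u31 u35 huo hut huq
    refine ⟨fun q hq => ?_, ?_, ?_, ?_, ?_, ?_, ?_⟩
    · simp
      rw [if_neg (by omega), if_neg (by omega), hv q (by omega) (by omega), hu q (by omega)]
      simp
      rw [if_neg (by omega), if_neg (by omega), h1 q hq]
    · simp [v30, v2, u30, u2, h30, t2]
    · simp [v31, v2, u31, u2, h31, t2]; ring
    · simp [v35, u35, h35]
    · have hlen : k < (List.ofFn g).length := by simpa using hk
      rw [List.take_add_one, List.getElem?_eq_getElem hlen]
      simp only [List.getElem_ofFn, Option.toList_some, encodeCircuit, List.flatMap_append]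
      simp [hvo, huo, ho, encodeCircuit, hg, encode_ctrlGate, h30, h35]
    · simp [length_entryList] at hvt
      simp
      omega
    · simp [hvq, huq, hq]
  · rintro t ⟨h1, -, -, h35, ho, ht, hq⟩
    refine ⟨h1, h35, ?_, ht, hq⟩
    rw [ho, List.take_of_length_le (by simp)]

/-- The numerator and the denominator of the half angle of a rotation. -/
def angleDen (M T j : ℕ) : ℕ := (T + T) * (j * (j + 1) + M * M)

/-- The tangent of the half angle is (v / T) times half of M / (M² + j(j+1)), that is, `v * M` over
`angleDen M T j`. A multiplier must be nonnegative, so the square of `v * M` is computed from its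
absolute value. The hypothesis on cell 40 bounds the time of that square. -/
theorem sure_angleProg {s : State} {M T j : ℕ} (h2 : s.mem 2 = 1) (h3 : s.mem 3 = 0)
    (hM : s.mem 4 = M) (hT : s.mem 5 = T) (hj : s.mem 21 = j) (hv : |s.mem 40| ≤ T) :
    Sure U angleProg s fun t => (∀ q, q < 30 ∨ 49 ≤ q → t.mem q = s.mem q) ∧
      t.mem 46 = angleDen M T j * angleDen M T j - (s.mem 40 * M) * (s.mem 40 * M) ∧
      t.mem 47 = angleDen M T j * angleDen M T j + (s.mem 40 * M) * (s.mem 40 * M) ∧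
      t.mem 45 = 2 * (s.mem 40 * M * angleDen M T j) ∧
      t.mem 48 = - (2 * (s.mem 40 * M * angleDen M T j)) ∧ t.out = s.out ∧
      t.time ≤ s.time + 50 + 2 * j + 4 * M + 2 * (j * (j + 1) + M * M) +
        4 * angleDen M T j + 2 * (T * M) ∧ t.queries = s.queries := by
  set v := s.mem 40 with hv'
  simp only [angleProg, sure_seq, sure_add]
  refine sure_mulProg (N := j + 1) (by omega) (by omega) (by simp [hj, h2]) ?_
  intro t1 k1 d1 o1 e1 q1
  refine sure_mulProg (N := M) (by omega) (by omega) (by simp [k1, hM]) ?_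
  intro t2 k2 d2 o2 e2 q2
  refine sure_mulProg (N := j * (j + 1) + M * M) (by omega) (by omega)
    (by simp [k2, d1, d2, k1, hj, hM]) ?_
  intro t3 k3 d3 o3 e3 q3
  refine sure_mulProg (N := M) (by omega) (by omega) (by simp [k3, k2, k1, hM]) ?_
  intro t4 k4 d4 o4 e4 q4
  have f41 : t4.mem 41 = (angleDen M T j : ℕ) := by
    simp [k4, d3, k2, k1, hT, angleDen]
  refine sure_mulProg (N := angleDen M T j) (by omega) (by omega) f41 ?_
  intro t5 k5 d5 o5 e5 q5
  have f42 : t5.mem 42 = v * M := by simp [k5, d4, k3, k2, k1, hv']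
  have f43 : t5.mem 43 = angleDen M T j * angleDen M T j := by simp [d5, f41]
  have f3 : t5.mem 3 = 0 := by simp [k5, k4, k3, k2, k1, h3]
  have f41' : t5.mem 41 = angleDen M T j := by simp [k5, f41]
  have fr : ∀ q, q < 30 ∨ 49 ≤ q → t5.mem q = s.mem q := by
    intro q hq
    rw [k5 _ (by omega), k4 _ (by omega), k3 _ (by omega)]
    simp only [mem_tick, mem_write]
    rw [if_neg (by omega), if_neg (by omega), k2 _ (by omega), k1 _ (by omega)]
    simp only [mem_tick, mem_write]
    rw [if_neg (by omega)]
  have fo : t5.out = s.out := by simp [o5, o4, o3, o2, o1]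
  have fq : t5.queries = s.queries := by simp [q5, q4, q3, q2, q1]
  have ft : t5.time ≤ s.time + 20 + 2 * j + 4 * M + 2 * (j * (j + 1) + M * M) +
      2 * angleDen M T j := by
    simp at e5 e4 e3 e2 e1
    omega
  clear_value v
  clear k1 d1 o1 e1 q1 k2 d2 o2 e2 q2 k3 d3 o3 e3 q3 k4 d4 o4 e4 q4 k5 d5 o5 e5 q5 f41
  -- The remaining instructions are treated once for both branches of the absolute value.
  have rest : ∀ u : State, (∀ q, q ≠ 32 → u.mem q = t5.mem q) →
      u.mem 32 = ((v * M).natAbs : ℕ) → u.out = t5.out → u.time = t5.time + 2 →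
      u.queries = t5.queries →
      Sure U (mulProg 44 32 32 ;; mulProg 45 42 41 ;; .add 45 45 45 ;; .sub 46 43 44 ;;
        .add 47 43 44 ;; .sub 48 3 45) u fun t => (∀ q, q < 30 ∨ 49 ≤ q → t.mem q = s.mem q) ∧
      t.mem 46 = angleDen M T j * angleDen M T j - (v * M) * (v * M) ∧
      t.mem 47 = angleDen M T j * angleDen M T j + (v * M) * (v * M) ∧
      t.mem 45 = 2 * (v * M * angleDen M T j) ∧
      t.mem 48 = - (2 * (v * M * angleDen M T j)) ∧ t.out = s.out ∧
      t.time ≤ s.time + 50 + 2 * j + 4 * M + 2 * (j * (j + 1) + M * M) +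
        4 * angleDen M T j + 2 * (T * M) ∧ t.queries = s.queries := by
    intro u ku d32 uo ut uq
    have hnat : (v * M).natAbs ≤ T * M := by
      rw [Int.natAbs_mul, Int.natAbs_natCast]
      refine Nat.mul_le_mul_right _ ?_
      rw [Int.abs_eq_natAbs] at hv
      exact_mod_cast hv
    simp only [sure_seq, sure_add, sure_sub]
    refine sure_mulProg (N := (v * M).natAbs) (by omega) (by omega) d32 ?_
    intro w1 k1 d1 o1 e1 q1
    refine sure_mulProg (N := angleDen M T j) (by omega) (by omega) (by simp [k1, ku, f41']) ?_
    intro w2 k2 d2 o2 e2 q2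
    have g44 : w2.mem 44 = (v * M) * (v * M) := by
      rw [k2 _ (by omega), d1, d32, Int.natAbs_mul_self']
    have g43 : w2.mem 43 = angleDen M T j * angleDen M T j := by
      rw [k2 _ (by omega), k1 _ (by omega), ku _ (by omega), f43]
    have g45 : w2.mem 45 = v * M * angleDen M T j := by
      rw [d2, k1 _ (by omega), ku _ (by omega), f42]
    have g3 : w2.mem 3 = 0 := by
      rw [k2 _ (by omega), k1 _ (by omega), ku _ (by omega), f3]
    refine ⟨fun q hq => ?_, ?_, ?_, ?_, ?_, ?_, ?_, ?_⟩
    · simp only [mem_tick, mem_write]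
      rw [if_neg (by omega), if_neg (by omega), if_neg (by omega), if_neg (by omega),
        k2 _ (by omega), k1 _ (by omega), ku _ (by omega), fr q hq]
    · simp [g43, g44]
    · simp [g43, g44]
    · simp [g45]; ring
    · simp [g45, g3]; ring
    · simp [o2, o1, uo, fo]
    · simp
      omega
    · simp [q2, q1, uq, fq]
  simp only [sure_seq, sure_add, sure_sub] at rest
  simp only [sure_ifPos, sure_add, sure_sub]
  constructor
  · intro hp
    refine rest _ (fun q hq => by simp [hq]) ?_ rfl rfl rfl
    simp only [f42] at hp
    simp [f42, f3, -abs_mul, abs_of_pos hp, -mul_eq_mul_right_iff]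
  · intro hp
    refine rest _ (fun q hq => by simp [hq]) ?_ rfl rfl rfl
    simp only [f42] at hp
    simp [f42, f3, -abs_mul, abs_of_nonpos hp, -mul_eq_mul_right_iff]

end

/-! ### Records of the printed gates and the loops over strings, steps and qubits -/

section

variable {n : ℕ} {U : UnitaryOp n}

theorem angleDen_ne_zero {M T : ℕ} (hM : M ≠ 0) (hT : T ≠ 0) (j : ℕ) : angleDen M T j ≠ 0 := by
  unfold angleDen
  positivity

/-- The gates that implement the rotation about the Pauli string `Q` on the first register and the
axis `P` on the qubit `i` of the second register. -/
def termGates (i : Fin n) (P : Axis) (Q : Fin n → Fin 4) (num : ℤ) (den : ℕ) (h : den ≠ 0) :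
    List (MatrixGate (n + n)) :=
  (List.ofFn fun q => ctrlGate q i (Q q) P.mate) ++ rotGate i P num den h ::
    List.ofFn fun q => ctrlGate q i (Q q) P.mate

theorem encode_rotGate (i : Fin n) (P : Axis) (num : ℤ) (den : ℕ) (h : den ≠ 0) :
    (rotGate i P num den h).encode = 1 :: ((n : ℤ) + (i : ℕ)) ::
      ((den : ℤ) * den + num * num) :: entryList (rotEntry P num den) := by
  change (((1 : ℕ) : ℤ) :: List.ofFn fun _ : Fin 1 => ((Fin.natAdd n i : ℕ) : ℤ)) ++
    ((den * den + num.natAbs * num.natAbs : ℕ) : ℤ) :: entryList (rotEntry P num den) = _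
  simp [-Fin.natAdd_eq_addNat]

theorem entryList_rotEntry (P : Axis) (num den : ℤ) {f : ℕ → ℤ} (h3 : f 3 = 0)
    (h45 : f 45 = 2 * (num * den)) (h46 : f 46 = den * den - num * num)
    (h48 : f 48 = -(2 * (num * den))) :
    entryList (rotEntry P num den) = (rotCells P).map f := by
  have hb : ∀ r : Fin 2, labelBit (k := 1) r 0 = r := by decide
  change (List.ofFn (n := 2) fun r => (List.ofFn (n := 2) fun c => _).flatten).flatten = _
  simp only [List.ofFn_succ, List.ofFn_zero, List.flatten_cons, List.flatten_nil, List.append_nil,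
    List.cons_append, List.nil_append, rotEntry, hb]
  cases P <;> simp [rotCells, h3, h45, h46, h48, Axis.index, pauliG, Zsqrtd.re_mul]

theorem sure_rotProg {i : Fin n} {P : Axis} {num : ℤ} {den : ℕ} (h : den ≠ 0) {s : State}
    (h3 : s.mem 3 = 0) (h35 : s.mem 35 = (n : ℤ) + (i : ℕ)) (h45 : s.mem 45 = 2 * (num * den))
    (h46 : s.mem 46 = den * den - num * num) (h47 : s.mem 47 = den * den + num * num)
    (h48 : s.mem 48 = -(2 * (num * den))) :
    Sure U (rotProg P) s fun t => (∀ q, q ≠ 30 → q ≠ 49 → t.mem q = s.mem q) ∧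
      t.out = s.out ++ (rotGate i P num den h).encode ∧ t.time = s.time + 13 ∧
      t.queries = s.queries := by
  simp only [rotProg, sure_seq, sure_set, sure_print]
  refine (sure_printCells _ ?_ _).mono ?_
  · cases P <;> simp [rotCells]
  rintro t ⟨k, o, e, q⟩
  refine ⟨fun q hq hq' => by simp [k q hq', hq], ?_, ?_, q⟩
  · rw [o, encode_rotGate, entryList_rotEntry P num den (f := s.mem) h3 h45 h46 h48]
    simp only [mem_tick, mem_write, out_write, out_tick, List.append_assoc]
    cases P <;> simp [rotCells, h35, h47]
  · rw [e]
    have : (rotCells P).length = 8 := by cases P <;> rfl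
    simp [this]

theorem encodeCircuit_append {m : ℕ} (gs gs' : List (MatrixGate m)) :
    encodeCircuit (gs ++ gs') = encodeCircuit gs ++ encodeCircuit gs' := by
  simp [encodeCircuit]

theorem encodeCircuit_cons {m : ℕ} (g : MatrixGate m) (gs : List (MatrixGate m)) :
    encodeCircuit (g :: gs) = g.encode ++ encodeCircuit gs := by
  simp [encodeCircuit]

/-- A bound for the time of the treatment of one Pauli string. -/
def termCost (n M T : ℕ) : ℕ := 400 * (n * (T * (M * M)))

/-- The estimates for the unitary `U` with `T` samples have error at most `τ`, with failure
probability at most `ε` each. -/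
def EstimatesWithin (U : UnitaryOp n) (T : ℕ) (τ : ℝ) (ε : ℝ≥0∞) : Prop :=
  ∀ (i : Fin n) (P : Axis) (Q : Fin n → Fin 4) (s : State), SampleEnv n i Q s → s.mem 5 = T →
    Whp U (estimateProg P) s (EstimatePost n T (correlation U i P Q) τ s) ε

/-- Only the estimate is random; all the rest is deterministic given cell 40. The slack 2 in the
time pays for the loop test and the pointer increment of the enclosing loop. -/
theorem whp_termProg {i : Fin n} {P : Axis} {Q : Fin n → Fin 4} {s : State} {M T j : ℕ} {τ : ℝ}
    {ε : ℝ≥0∞} (hest : EstimatesWithin U T τ ε) (hs : SampleEnv n i Q s) (hM0 : M ≠ 0)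
    (hT0 : T ≠ 0) (hM : s.mem 4 = M) (hT : s.mem 5 = T) (hj : s.mem 21 = j) (hjM : j < M) :
    Whp U (termProg P) s (fun t => Frame n s t ∧ t.time + 2 ≤ s.time + termCost n M T ∧
      t.queries ≤ s.queries + T ∧ ∃ v : ℤ, |v| ≤ T ∧
      |(v : ℝ) - T * correlation U i P Q| ≤ τ * T ∧ t.out = s.out ++
        encodeCircuit (termGates i P Q (v * M) (angleDen M T j) (angleDen_ne_zero hM0 hT0 j))) ε
      := by
  rw [termProg, ← add_zero ε]
  refine (hest i P Q s hs hT).seq fun t ht => (sure_iff_whp _ _ _).1 ?_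
  have env := hs.congr ht.inv.frame
  have fr := ht.inv.frame.mem
  rw [sure_seq]
  refine (sure_angleProg (M := M) (T := T) (j := j) env.one env.zero (by rw [fr _ (by omega), hM])
    (by rw [fr _ (by omega), hT]) (by rw [fr _ (by omega), hj]) ht.inv.bound).mono ?_
  rintro t1 ⟨k1, d46, d47, d45, d48, o1, e1, q1⟩
  have env1 := env.congr (t := t1) ⟨fun q hq => k1 q (by omega)⟩
  rw [sure_seq]
  refine (sure_lettersProg env1 P.mate).mono ?_
  rintro t2 ⟨k2, d35, o2, e2, q2⟩
  rw [sure_seq]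
  refine (sure_rotProg (i := i) (P := P) (num := t.mem 40 * M) (den := angleDen M T j)
    (angleDen_ne_zero hM0 hT0 j) (by rw [k2 _ (by omega), env1.zero]) d35
    (by rw [k2 _ (by omega), d45]) (by rw [k2 _ (by omega), d46])
    (by rw [k2 _ (by omega), d47]) (by rw [k2 _ (by omega), d48])).mono ?_
  rintro t3 ⟨k3, o3, e3, q3⟩
  have env3 := env1.congr (t := t3) ⟨fun q hq => by rw [k3 q (by omega) (by omega), k2 q (by omega)]⟩
  refine (sure_lettersProg env3 P.mate).mono ?_
  rintro t4 ⟨k4, -, o4, e4, q4⟩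
  refine ⟨⟨fun q hq => ?_⟩, ?_, ?_, t.mem 40, ht.inv.bound, ht.accurate, ?_⟩
  · rw [k4 q (by omega), k3 q (by omega) (by omega), k2 q (by omega), k1 q (by omega), fr q hq]
  · have := ht.inv.time
    have hn : 1 ≤ n := i.pos
    have hT1 : 1 ≤ T := Nat.one_le_iff_ne_zero.2 hT0
    have hM1 : 1 ≤ M := Nat.one_le_iff_ne_zero.2 hM0
    -- All terms of the time are compared with `n * (T * (M * M))`; the addition loops over
    -- `angleDen` and the sampling loop are the largest contributions.
    have a1 : j * (j + 1) ≤ M * M := Nat.mul_le_mul hjM.le hjM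
    have a2 : angleDen M T j ≤ 4 * (T * (M * M)) := by
      unfold angleDen
      calc (T + T) * (j * (j + 1) + M * M) ≤ (T + T) * (M * M + M * M) := by gcongr
        _ = _ := by ring
    have a3 : M ≤ M * M := Nat.le_mul_self M
    have a4 : M * M ≤ T * (M * M) := Nat.le_mul_of_pos_left _ hT1
    have a5 : T * M ≤ T * (M * M) := Nat.mul_le_mul_left _ a3
    have a6 : T * (M * M) ≤ n * (T * (M * M)) := Nat.le_mul_of_pos_left _ hn
    have a7 : n * T ≤ n * (T * (M * M)) :=
      Nat.mul_le_mul_left _ (Nat.le_mul_of_pos_right _ (by positivity))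
    have a8 : T ≤ n * T := Nat.le_mul_of_pos_left _ hn
    have a9 : n ≤ n * T := Nat.le_mul_of_pos_right _ hT1
    have a10 : (41 + 20 * n) * T = 41 * T + 20 * (n * T) := by ring
    unfold termCost
    omega
  · have := ht.inv.queries
    omega
  · rw [o4, o3, o2, o1, ht.inv.out, termGates, encodeCircuit_append, encodeCircuit_cons]
    simp only [List.append_assoc]

/-- The gates `gs` were printed for the Pauli strings and axes in the list, in the step `j` for the
qubit `i`, with estimates of error at most `τ`. -/
inductive TermsPrinted (U : UnitaryOp n) {M T : ℕ} (hM : M ≠ 0) (hT : T ≠ 0) (τ : ℝ) (i : Fin n)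
    (j : ℕ) : List (Axis × (Fin n → Fin 4)) → List (MatrixGate (n + n)) → Prop
  | nil : TermsPrinted U hM hT τ i j [] []
  | snoc {l gs} (P : Axis) (Q : Fin n → Fin 4) (v : ℤ) (h : TermsPrinted U hM hT τ i j l gs)
      (hv : |v| ≤ T) (hacc : |(v : ℝ) - T * correlation U i P Q| ≤ τ * T) :
      TermsPrinted U hM hT τ i j (l ++ [(P, Q)])
        (gs ++ termGates i P Q (v * M) (angleDen M T j) (angleDen_ne_zero hM hT j))

theorem TermsPrinted.append {M T : ℕ} {hM : M ≠ 0} {hT : T ≠ 0} {τ : ℝ} {i : Fin n}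
    {j : ℕ} {l l' : List (Axis × (Fin n → Fin 4))} {gs gs' : List (MatrixGate (n + n))}
    (h : TermsPrinted U hM hT τ i j l gs) (h' : TermsPrinted U hM hT τ i j l' gs') :
    TermsPrinted U hM hT τ i j (l ++ l') (gs ++ gs') := by
  induction h' with
  | nil => simpa using h
  | snoc P Q v _ hv hacc ih =>
    rw [← List.append_assoc, ← List.append_assoc]
    exact ih.snoc P Q v hv hacc

/-- The terms of the exchange of the two qubits `i`, after conjugation by the unknown unitary. -/
def allTerms (rows : List (Fin n → Fin 4)) : List (Axis × (Fin n → Fin 4)) :=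
  rows.map (fun Q => (Axis.X, Q)) ++ (rows.map (fun Q => (Axis.Y, Q)) ++
    rows.map fun Q => (Axis.Z, Q))

/-- The gates `gs` were printed in the first steps for the qubit `i`. -/
inductive StepsPrinted (U : UnitaryOp n) {M T : ℕ} (hM : M ≠ 0) (hT : T ≠ 0) (τ : ℝ)
    (rows : List (Fin n → Fin 4)) (i : Fin n) : ℕ → List (MatrixGate (n + n)) → Prop
  | zero : StepsPrinted U hM hT τ rows i 0 []
  | succ {j gs gs'} (h : StepsPrinted U hM hT τ rows i j gs)
      (h' : TermsPrinted U hM hT τ i j (allTerms rows) gs') :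
      StepsPrinted U hM hT τ rows i (j + 1) (gs ++ gs')

/-- The gates `gs` were printed for the first qubits. -/
inductive QubitsPrinted (U : UnitaryOp n) {M T : ℕ} (hM : M ≠ 0) (hT : T ≠ 0) (τ : ℝ)
    (rows : List (Fin n → Fin 4)) : ℕ → List (MatrixGate (n + n)) → Prop
  | zero : QubitsPrinted U hM hT τ rows 0 []
  | succ {k gs gs'} (hk : k < n) (h : QubitsPrinted U hM hT τ rows k gs)
      (h' : StepsPrinted U hM hT τ rows ⟨k, hk⟩ M gs') :
      QubitsPrinted U hM hT τ rows (k + 1) (gs ++ gs')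

/-- The rotations about all Pauli strings in memory and the axis `P`. -/
def rowsProg (P : Axis) : Prog := .add 22 10 3 ;; .loop 6 (termProg P ;; .add 22 22 0)

/-- The steps for the qubit in cell `20`. -/
def stepsProg : Prog := .set 21 0 ;;
  .loop 4 (rowsProg .X ;; rowsProg .Y ;; rowsProg .Z ;; .add 21 21 2)

/-- All qubits. -/
def qubitsProg : Prog := .set 20 0 ;; .loop 0 (stepsProg ;; .add 20 20 2)

/-- Print the gates that exchange the two registers. -/
def swapsProg : Prog := .set 20 0 ;; .loop 0 (.set 30 2 ;; .print 30 ;; .print 20 ;;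
  .add 31 0 20 ;; .print 31 ;; printConst (1 :: entryList swapEntry) ;; .add 20 20 2)

/-- What the main part of the program relies on. -/
structure Env (n M T : ℕ) (rows : List (Fin n → Fin 4)) (s : State) : Prop where
  num : s.mem 0 = n
  one : s.mem 2 = 1
  zero : s.mem 3 = 0
  steps : s.mem 4 = M
  samples : s.mem 5 = T
  count : s.mem 6 = rows.length
  inBits : s.mem 7 = 50
  outBits : s.mem 8 = 50 + n
  inAxes : s.mem 9 = 50 + 2 * n
  base : s.mem 10 = 50 + 3 * n
  row : ∀ (r : ℕ) (h : r < rows.length) (q : Fin n),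
    s.mem (50 + 3 * n + n * r + q) = ((rows[r] q : ℕ) : ℤ)

theorem Env.congr {M T : ℕ} {rows : List (Fin n → Fin 4)} {s t : State} (h : Env n M T rows s)
    (hf : ∀ q, q < 20 ∨ 50 + 3 * n ≤ q → t.mem q = s.mem q) : Env n M T rows t := by
  refine ⟨?_, ?_, ?_, ?_, ?_, ?_, ?_, ?_, ?_, ?_, fun r hr q => ?_⟩
  · rw [hf _ (by omega), h.num]
  · rw [hf _ (by omega), h.one]
  · rw [hf _ (by omega), h.zero]
  · rw [hf _ (by omega), h.steps]
  · rw [hf _ (by omega), h.samples]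
  · rw [hf _ (by omega), h.count]
  · rw [hf _ (by omega), h.inBits]
  · rw [hf _ (by omega), h.outBits]
  · rw [hf _ (by omega), h.inAxes]
  · rw [hf _ (by omega), h.base]
  · rw [hf _ (by omega), h.row r hr q]

theorem whp_rowsProg {M T : ℕ} {rows : List (Fin n → Fin 4)} {τ : ℝ} {ε : ℝ≥0∞} {i : Fin n}
    {j : ℕ} {P : Axis} {s : State} (hest : EstimatesWithin U T τ ε) (hM : M ≠ 0) (hT : T ≠ 0)
    (hs : Env n M T rows s) (hi : s.mem 20 = (i : ℕ)) (hj : s.mem 21 = j) (hjM : j < M) :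
    Whp U (rowsProg P) s (fun t => (∀ q, q < 22 ∨ 50 + 3 * n ≤ q → t.mem q = s.mem q) ∧
      t.time ≤ s.time + 2 + rows.length * termCost n M T ∧
      t.queries ≤ s.queries + rows.length * T ∧
      ∃ gs, TermsPrinted U hM hT τ i j (rows.map fun Q => (P, Q)) gs ∧
        t.out = s.out ++ encodeCircuit gs) (rows.length * ε) := by
  rw [rowsProg, ← zero_add ((rows.length : ℝ≥0∞) * ε)]
  refine Whp.seq (F := fun t => t = (s.write 22 (s.mem 10 + s.mem 3)).tick 1)
    ((sure_iff_whp _ _ _).1 (sure_add.2 rfl)) ?_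
  rintro _ rfl
  refine (Whp.loop (N := rows.length) (fun k t =>
    (∀ q, q < 22 ∨ 50 + 3 * n ≤ q → t.mem q = s.mem q) ∧ t.mem 22 = (50 + 3 * n + n * k : ℕ) ∧
      t.time ≤ s.time + 2 + k * termCost n M T ∧
      t.queries ≤ s.queries + k * T ∧
      ∃ gs, TermsPrinted U hM hT τ i j ((rows.take k).map fun Q => (P, Q)) gs ∧
        t.out = s.out ++ encodeCircuit gs) (by simp [hs.count]) ?_ ?_).mono ?_ le_rfl
  · refine ⟨fun q hq => ?_, ?_, ?_, ?_, [], ?_, ?_⟩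
    · simp; omega
    · simp [hs.base, hs.zero]
    · simp
    · simp
    · simpa using TermsPrinted.nil
    · simp [encodeCircuit]
  · rintro k hk t ⟨h1, h22, ht, hq, gs, hgs, ho⟩
    have env : Env n M T rows (t.tick 1) := hs.congr fun q hq => h1 q (by omega)
    have senv : SampleEnv n i rows[k] (t.tick 1) :=
      ⟨env.num, env.one, env.zero, env.inBits, env.outBits, env.inAxes,
        by rw [mem_tick, h1 _ (by omega), hi], 50 + 3 * n + n * k, by omega, h22,
        fun q => env.row k hk q⟩
    rw [← add_zero ε]
    refine (whp_termProg (P := P) (j := j) hest senv hM hT env.steps env.samples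
      (by rw [mem_tick, h1 _ (by omega), hj]) hjM).seq ?_
    rintro u ⟨hf, hut, huq, v, hv, hacc, huo⟩
    refine (sure_iff_whp _ _ _).1 (sure_add.2 ⟨fun q hq => ?_, ?_, ?_, ?_,
      gs ++ termGates i P rows[k] (v * M) (angleDen M T j) (angleDen_ne_zero hM hT j), ?_, ?_⟩)
    · simp
      rw [if_neg (by omega), hf.mem _ (by omega), mem_tick, h1 q hq]
    · have e1 := hf.mem 22 (by omega)
      have e2 := hf.mem 0 (by omega)
      have e3 := env.num
      simp at e1 e2 e3
      simp [e1, e2, h22, e3]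
      ring
    · simp at hut ⊢
      rw [add_mul, one_mul]
      omega
    · simp at huq ⊢
      rw [add_mul, one_mul]
      omega
    · rw [List.take_add_one, List.getElem?_eq_getElem hk, List.map_append]
      exact hgs.snoc P _ v hv hacc
    · simp only [out_tick, out_write] at huo ⊢
      rw [huo, ho, encodeCircuit_append, List.append_assoc]
  · rintro t ⟨h1, -, ht, hq, gs, hgs, ho⟩
    rw [List.take_length] at hgs
    exact ⟨h1, ht, hq, gs, hgs, ho⟩

theorem whp_stepsProg {M T : ℕ} {rows : List (Fin n → Fin 4)} {τ : ℝ} {ε : ℝ≥0∞} {i : Fin n}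
    {s : State} (hest : EstimatesWithin U T τ ε) (hM : M ≠ 0) (hT : T ≠ 0)
    (hs : Env n M T rows s) (hi : s.mem 20 = (i : ℕ)) :
    Whp U stepsProg s (fun t => (∀ q, q < 21 ∨ 50 + 3 * n ≤ q → t.mem q = s.mem q) ∧
      t.time ≤ s.time + 2 + M * (8 + 3 * (rows.length * termCost n M T)) ∧
      t.queries ≤ s.queries + M * (3 * (rows.length * T)) ∧
      ∃ gs, StepsPrinted U hM hT τ rows i M gs ∧
        t.out = s.out ++ encodeCircuit gs) (M * (3 * (rows.length * ε))) := by
  rw [stepsProg, ← zero_add ((M : ℝ≥0∞) * (3 * (rows.length * ε)))]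
  refine Whp.seq (F := fun t => t = (s.write 21 0).tick 1)
    ((sure_iff_whp _ _ _).1 (sure_set.2 rfl)) ?_
  rintro _ rfl
  refine (Whp.loop (N := M) (fun k t =>
    (∀ q, q < 21 ∨ 50 + 3 * n ≤ q → t.mem q = s.mem q) ∧ t.mem 21 = k ∧
      t.time ≤ s.time + 2 + k * (8 + 3 * (rows.length * termCost n M T)) ∧
      t.queries ≤ s.queries + k * (3 * (rows.length * T)) ∧
      ∃ gs, StepsPrinted U hM hT τ rows i k gs ∧
        t.out = s.out ++ encodeCircuit gs) (by simp [hs.steps]) ?_ ?_).mono ?_ le_rfl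
  · refine ⟨fun q hq => ?_, by simp, by simp, by simp, [], StepsPrinted.zero, by simp [encodeCircuit]⟩
    simp; omega
  · rintro k hk t ⟨h1, h21, ht, hq, gs, hgs, ho⟩
    have env : Env n M T rows (t.tick 1) := hs.congr fun q hq => h1 q (by omega)
    -- One share of the union bound for each axis, and none for the final increment.
    rw [show (3 * ((rows.length : ℝ≥0∞) * ε)) = rows.length * ε + (rows.length * ε +
      (rows.length * ε + 0)) by ring]
    refine (whp_rowsProg (i := i) (j := k) hest hM hT env (by rw [mem_tick, h1 _ (by omega), hi])
      h21 hk).seq ?_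
    rintro t1 ⟨k1, e1, q1, g1, p1, o1⟩
    have env1 : Env n M T rows t1 := env.congr fun q hq => k1 q (by omega)
    refine (whp_rowsProg (i := i) (j := k) hest hM hT env1
      (by rw [k1 _ (by omega), mem_tick, h1 _ (by omega), hi])
      (by rw [k1 _ (by omega), mem_tick, h21]) hk).seq ?_
    rintro t2 ⟨k2, e2, q2, g2, p2, o2⟩
    have env2 : Env n M T rows t2 := env1.congr fun q hq => k2 q (by omega)
    refine (whp_rowsProg (i := i) (j := k) hest hM hT env2
      (by rw [k2 _ (by omega), k1 _ (by omega), mem_tick, h1 _ (by omega), hi])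
      (by rw [k2 _ (by omega), k1 _ (by omega), mem_tick, h21]) hk).seq ?_
    rintro t3 ⟨k3, e3, q3, g3, p3, o3⟩
    have f3 : ∀ q, q < 22 ∨ 50 + 3 * n ≤ q → t3.mem q = t.mem q := fun q hq => by
      rw [k3 q hq, k2 q hq, k1 q hq, mem_tick]
    refine (sure_iff_whp _ _ _).1 (sure_add.2 ⟨fun q hq => ?_, ?_, ?_, ?_, gs ++ (g1 ++ (g2 ++ g3)),
      hgs.succ (p1.append (p2.append p3)), ?_⟩)
    · simp
      rw [if_neg (by omega), f3 q (by omega), h1 q hq]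
    · have e2 := env.one
      simp at e2
      simp [f3 21, h21, f3 2, e2]
    · simp only [time_tick, time_write] at e1 ⊢
      rw [add_mul, one_mul]
      omega
    · simp only [queries_tick, queries_write] at q1 ⊢
      rw [add_mul, one_mul]
      omega
    · simp only [out_tick, out_write] at o1 ⊢
      rw [o3, o2, o1, ho]
      simp only [encodeCircuit_append, List.append_assoc]
  · rintro t ⟨h1, -, h⟩
    exact ⟨h1, h⟩

theorem whp_qubitsProg {M T : ℕ} {rows : List (Fin n → Fin 4)} {τ : ℝ} {ε : ℝ≥0∞}
    {s : State} (hest : EstimatesWithin U T τ ε) (hM : M ≠ 0) (hT : T ≠ 0)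
    (hs : Env n M T rows s) :
    Whp U qubitsProg s (fun t =>
      t.time ≤ s.time + 2 + n * (4 + M * (8 + 3 * (rows.length * termCost n M T))) ∧
      t.queries ≤ s.queries + n * (M * (3 * (rows.length * T))) ∧
      ∃ gs, QubitsPrinted U hM hT τ rows n gs ∧
        t.out = s.out ++ encodeCircuit gs) (n * (M * (3 * (rows.length * ε)))) := by
  rw [qubitsProg, ← zero_add ((n : ℝ≥0∞) * (M * (3 * (rows.length * ε))))]
  refine Whp.seq (F := fun t => t = (s.write 20 0).tick 1)
    ((sure_iff_whp _ _ _).1 (sure_set.2 rfl)) ?_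
  rintro _ rfl
  refine (Whp.loop (N := n) (fun k t =>
    (∀ q, q < 20 ∨ 50 + 3 * n ≤ q → t.mem q = s.mem q) ∧ t.mem 20 = k ∧
      t.time ≤ s.time + 2 + k * (4 + M * (8 + 3 * (rows.length * termCost n M T))) ∧
      t.queries ≤ s.queries + k * (M * (3 * (rows.length * T))) ∧
      ∃ gs, QubitsPrinted U hM hT τ rows k gs ∧
        t.out = s.out ++ encodeCircuit gs) (by simp [hs.num]) ?_ ?_).mono ?_ le_rfl
  · refine ⟨fun q hq => ?_, by simp, by simp, by simp, [], QubitsPrinted.zero, by simp [encodeCircuit]⟩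
    simp; omega
  · rintro k hk t ⟨h1, h20, ht, hq, gs, hgs, ho⟩
    have env : Env n M T rows (t.tick 1) := hs.congr fun q hq => h1 q (by omega)
    rw [← add_zero ((M : ℝ≥0∞) * (3 * (rows.length * ε)))]
    refine (whp_stepsProg (i := ⟨k, hk⟩) hest hM hT env h20).seq ?_
    rintro t1 ⟨k1, e1, q1, g1, p1, o1⟩
    refine (sure_iff_whp _ _ _).1 (sure_add.2 ⟨fun q hq => ?_, ?_, ?_, ?_, gs ++ g1,
      hgs.succ hk p1, ?_⟩)
    · simp
      rw [if_neg (by omega), k1 q (by omega), mem_tick, h1 q hq]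
    · have e2 := env.one
      simp at e2
      simp [k1 20, h20, k1 2, e2]
    · simp only [time_tick, time_write] at e1 ⊢
      rw [add_mul, one_mul]
      omega
    · simp only [queries_tick, queries_write] at q1 ⊢
      rw [add_mul, one_mul]
      omega
    · simp only [out_tick, out_write] at o1 ⊢
      rw [o1, ho]
      simp only [encodeCircuit_append, List.append_assoc]
  · rintro t ⟨-, -, h⟩
    exact h

theorem encode_swapGate (q : Fin n) :
    (swapGate q).encode = 2 :: ((q : ℕ) : ℤ) :: ((n : ℤ) + (q : ℕ)) :: 1 ::
      entryList swapEntry := by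
  change (((2 : ℕ) : ℤ) :: List.ofFn fun j : Fin 2 => ((pairWire q q j : ℕ) : ℤ)) ++
    ((1 : ℕ) : ℤ) :: entryList swapEntry = _
  simp [List.ofFn_succ, add_comm]

theorem sure_swapsProg {M T : ℕ} {rows : List (Fin n → Fin 4)} {s : State}
    (hs : Env n M T rows s) :
    Sure U swapsProg s fun t => Env n M T rows t ∧
      t.time ≤ s.time + 2 + n * 100 ∧ t.queries = s.queries ∧
      t.out = s.out ++ encodeCircuit (List.ofFn fun q : Fin n => swapGate q) := by
  simp only [swapsProg, sure_seq, sure_set]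
  set g : Fin n → MatrixGate (n + n) := fun q => swapGate q with hg
  refine Sure.mono (sure_loop (N := n) (fun k t =>
    (∀ q, q < 20 ∨ 50 + 3 * n ≤ q → t.mem q = s.mem q) ∧ t.mem 20 = k ∧
      t.time ≤ s.time + 2 + k * 100 ∧ t.queries = s.queries ∧
      t.out = s.out ++ encodeCircuit ((List.ofFn g).take k)) ?_ ?_ ?_) ?_
  · simp [hs.num]
  · refine ⟨fun q hq => ?_, by simp, by simp, by simp, by simp [encodeCircuit]⟩
    simp; omega
  · rintro k hk t ⟨h1, h20, ht, hq, ho⟩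
    have t2 : t.mem 2 = 1 := by rw [h1 _ (by omega), hs.one]
    have t0 : t.mem 0 = n := by rw [h1 _ (by omega), hs.num]
    simp only [sure_seq, sure_set, sure_add, sure_print]
    refine (sure_printConst _ _).mono ?_
    rintro v ⟨hv, hvo, hvt, hvq⟩
    have v2 := hv 2 (by omega) (by omega)
    have v20 := hv 20 (by omega) (by omega)
    simp at v2 v20 hvo hvq
    refine ⟨fun q hq => ?_, ?_, ?_, ?_, ?_⟩
    · simp
      rw [if_neg (by omega), hv q (by omega) (by omega)]
      simp
      rw [if_neg (by omega), if_neg (by omega), h1 q hq]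
    · simp [v20, v2, h20, t2]
    · simp [length_entryList] at hvt
      simp
      omega
    · simp [hvq, hq]
    · have hlen : k < (List.ofFn g).length := by simpa using hk
      rw [List.take_add_one, List.getElem?_eq_getElem hlen]
      simp only [List.getElem_ofFn, Option.toList_some, encodeCircuit, List.flatMap_append]
      simp [hvo, ho, encodeCircuit, hg, encode_swapGate, h20, t0]
  · rintro t ⟨h1, -, ht, hq, ho⟩
    refine ⟨hs.congr h1, ht, hq, ?_⟩
    rw [ho, List.take_of_length_le (by simp)]

end

section

/-! ### The list of Pauli strings of bounded weight -/

/-- The number of nontrivial tensor factors of a Pauli string. -/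
def weight {n : ℕ} (Q : Fin n → Fin 4) : ℕ := (Finset.univ.filter fun q => Q q ≠ 0).card

/-- The strings of weight at most `l` that arise from a string by a nontrivial factor on qubit `q`. -/
def extendRow {n : ℕ} (l q : ℕ) (Q : Fin n → Fin 4) : List (Fin n → Fin 4) :=
  if h : q < n ∧ weight Q < l then
    [Function.update Q ⟨q, h.1⟩ 1, Function.update Q ⟨q, h.1⟩ 2, Function.update Q ⟨q, h.1⟩ 3]
  else []

/-- The Pauli strings of weight at most `l` on the first `q` qubits. -/
def pauliRows (n l : ℕ) : ℕ → List (Fin n → Fin 4)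
  | 0 => [0]
  | q + 1 => pauliRows n l q ++ (pauliRows n l q).flatMap (extendRow l q)

/-- Compute the weight of the row at the address in cell `22` in cell `30`. -/
def weightProg : Prog := .set 30 0 ;; .add 32 22 3 ;;
  .loop 0 (.load 33 32 ;; .ifPos 33 (.add 30 30 2) skip ;; .add 32 32 2)

/-- Append a copy of the row at the address in cell `22` in which the entry number `q`, for `q` in
cell `20`, is `σ`. -/
def appendProg (σ : Fin 4) : Prog := .add 32 22 3 ;; .add 34 12 3 ;;
  .loop 0 (.load 33 32 ;; .store 34 33 ;; .add 32 32 2 ;; .add 34 34 2) ;;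
  .add 34 12 20 ;; .set 33 (σ : ℕ) ;; .store 34 33 ;; .add 12 12 0 ;; .add 6 6 2

/-- Append the extensions of the row at the address in cell `22`. -/
def extendProg : Prog := weightProg ;; .sub 31 11 30 ;;
  .ifPos 31 (appendProg 1 ;; appendProg 2 ;; appendProg 3) skip

/-- Write all Pauli strings of weight at most the number in cell `11` into memory. -/
def buildProg : Prog := .set 20 0 ;;
  .loop 0 (.add 22 10 3 ;; .loop 6 (extendProg ;; .add 22 22 0) ;; .add 20 20 2)

variable {n : ℕ} {U : UnitaryOp n}

theorem sure_weightProg {Q : Fin n → Fin 4} {s : State} {r : ℕ} (h0 : s.mem 0 = n)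
    (h2 : s.mem 2 = 1) (h3 : s.mem 3 = 0) (h22 : s.mem 22 = r) (hr : 50 ≤ r)
    (hQ : ∀ q : Fin n, s.mem (r + q) = ((Q q : ℕ) : ℤ)) :
    Sure U weightProg s fun t => (∀ q, q < 30 ∨ 50 ≤ q → t.mem q = s.mem q) ∧
      t.mem 30 = weight Q ∧ t.out = s.out ∧ t.time ≤ s.time + 4 + 6 * n ∧
      t.queries = s.queries := by
  simp only [weightProg, sure_seq, sure_set, sure_add]
  let g : ℕ → ℤ := fun j => if h : j < n then (if Q ⟨j, h⟩ = 0 then 0 else 1) else 0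
  have hg : (weight Q : ℤ) = ∑ j ∈ Finset.range n, g j := by
    rw [Finset.sum_range, weight, Finset.card_filter]
    push_cast
    refine Finset.sum_congr rfl fun q _ => ?_
    by_cases h : Q q = 0 <;> simp [g, h]
  rw [hg]
  refine Sure.mono (sure_loop (N := n) (fun k t =>
    (∀ q, q < 30 ∨ 50 ≤ q → t.mem q = s.mem q) ∧ t.mem 32 = r + k ∧
    t.mem 30 = ∑ j ∈ Finset.range k, g j ∧ t.out = s.out ∧ t.time ≤ s.time + 4 + 6 * k ∧
      t.queries = s.queries) (by simp [h0]) ?_ ?_) ?_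
  · refine ⟨fun q hq => ?_, by simp [h22, h3], by simp, rfl, by simp, rfl⟩
    simp
    rw [if_neg (by omega), if_neg (by omega)]
  · rintro k hk t ⟨h1, h32, h30, ho, ht, hq⟩
    have t2 : t.mem 2 = 1 := by rw [h1 _ (by omega), h2]
    have t3 : t.mem 3 = 0 := by rw [h1 _ (by omega), h3]
    have a32 : (t.tick 1).addr 32 = r + k := by rw [State.addr, mem_tick, h32]; omega
    have tQ : t.mem (r + k) = ((Q ⟨k, hk⟩ : ℕ) : ℤ) := by rw [h1 _ (by omega), hQ ⟨k, hk⟩]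
    simp only [sure_seq, sure_load, sure_ifPos, sure_add, sure_skip, a32]
    constructor
    · intro hp
      simp only [mem_tick, mem_write, if_true, tQ] at hp
      have hne : Q ⟨k, hk⟩ ≠ 0 := fun h => by simp [h] at hp
      refine ⟨fun q hq => ?_, ?_, ?_, ho, ?_, hq⟩
      · simp
        rw [if_neg (by omega), if_neg (by omega), if_neg (by omega), h1 q hq]
      · simp [h32, t2]; ring
      · simp [h30, t2, Finset.sum_range_succ, g, hk, hne]
      · simp; omega
    · intro hp
      simp only [mem_tick, mem_write, if_true, tQ] at hp
      have hne : Q ⟨k, hk⟩ = 0 := by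
        apply Fin.ext; simp; omega
      refine ⟨fun q hq => ?_, ?_, ?_, ho, ?_, hq⟩
      · simp
        rw [if_neg (by omega), if_neg (by omega), if_neg (by omega), h1 q hq]
      · simp [h32, t2]; ring
      · simp [h30, Finset.sum_range_succ, g, hk, hne]
      · simp; omega
  · rintro t ⟨h1, -, h30, h⟩
    exact ⟨h1, h30, h⟩

/-- `hre` keeps the source row apart from the free space, so the copy never overwrites what it still
has to read. Entry `q` is changed only after the copy is complete. -/
theorem sure_appendProg {Q : Fin n → Fin 4} {s : State} {r e : ℕ} {q : Fin n} (σ : Fin 4)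
    (h0 : s.mem 0 = n) (h2 : s.mem 2 = 1) (h3 : s.mem 3 = 0) (h20 : s.mem 20 = (q : ℕ))
    (h22 : s.mem 22 = r) (h12 : s.mem 12 = e) (hr : 50 ≤ r) (hre : r + n ≤ e)
    (hQ : ∀ q : Fin n, s.mem (r + q) = ((Q q : ℕ) : ℤ)) :
    Sure U (appendProg σ) s fun t =>
      (∀ a, a < e → a ≠ 6 → a ≠ 12 → a < 30 ∨ 50 ≤ a → t.mem a = s.mem a) ∧
      (∀ p : Fin n, t.mem (e + p) = ((Function.update Q q σ p : ℕ) : ℤ)) ∧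
      t.mem 6 = s.mem 6 + 1 ∧ t.mem 12 = (e + n : ℕ) ∧ t.out = s.out ∧
      t.time ≤ s.time + 8 + 5 * n ∧ t.queries = s.queries := by
  simp only [appendProg, sure_seq, sure_set, sure_add]
  refine Sure.mono (sure_loop (N := n) (fun k t =>
    (∀ a, a < e → a < 30 ∨ 50 ≤ a → t.mem a = s.mem a) ∧ t.mem 32 = r + k ∧ t.mem 34 = e + k ∧
    (∀ p : Fin n, (p : ℕ) < k → t.mem (e + p) = ((Q p : ℕ) : ℤ)) ∧ t.out = s.out ∧
    t.time ≤ s.time + 3 + 5 * k ∧ t.queries = s.queries) (by simp [h0]) ?_ ?_) ?_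
  · refine ⟨fun a _ ha => ?_, by simp [h22, h3], by simp [h12, h3], by simp, rfl, by simp, rfl⟩
    simp
    rw [if_neg (by omega), if_neg (by omega)]
  · rintro k hk t ⟨h1, h32, h34, hp, ho, ht, hq⟩
    have t2 : t.mem 2 = 1 := by rw [h1 _ (by omega) (by omega), h2]
    have a32 : (t.tick 1).addr 32 = r + k := by rw [State.addr, mem_tick, h32]; omega
    have tQ : t.mem (r + k) = ((Q ⟨k, hk⟩ : ℕ) : ℤ) := by
      rw [h1 _ (by omega) (by omega), hQ ⟨k, hk⟩]
    have a34 : ((((t.tick 1).write 33 (t.mem (r + k))).tick 1)).addr 34 = e + k := by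
      simp [State.addr, h34]; omega
    simp only [sure_seq, sure_load, sure_add, sure_store, a32, mem_tick, a34]
    have e1 : ¬ (32 = e + k) := by omega
    have e2 : ¬ (34 = e + k) := by omega
    have e3 : ¬ (2 = e + k) := by omega
    refine ⟨fun a ha ha' => ?_, ?_, ?_, fun p hpk => ?_, ho, ?_, hq⟩
    · simp
      rw [if_neg (by omega), if_neg (by omega), if_neg (by omega), if_neg (by omega), h1 a ha ha']
    · simp [h32, t2, e1, e3]; ring
    · simp [h34, t2, e2, e3]; ring
    · simp
      rw [if_neg (by omega), if_neg (by omega)]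
      split
      · rw [tQ]
        congr 3
        exact Fin.ext (by simp; omega)
      · rw [if_neg (by omega), hp p (by omega)]
    · simp; omega
  · rintro t ⟨h1, -, -, hp, ho, ht, hq⟩
    have t12 : t.mem 12 = e := by rw [h1 _ (by omega) (by omega), h12]
    have t20 : t.mem 20 = (q : ℕ) := by rw [h1 _ (by omega) (by omega), h20]
    have t0 : t.mem 0 = n := by rw [h1 _ (by omega) (by omega), h0]
    have t2 : t.mem 2 = 1 := by rw [h1 _ (by omega) (by omega), h2]
    have t6 := h1 6 (by omega) (by omega)
    have hqn := q.2
    have a34 : ((((t.write 34 (t.mem 12 + t.mem 20)).tick 1).write 33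
        ((σ : ℕ) : ℤ)).tick 1).addr 34 = e + q := by
      simp [State.addr, t12, t20]; omega
    simp only [sure_store, mem_tick, a34]
    have e1 : ∀ m < 50, ¬ (m = e + (q : ℕ)) := by omega
    refine ⟨fun a ha _ _ ha' => ?_, fun p => ?_, ?_, ?_, ho, ?_, hq⟩
    · simp
      rw [if_neg (by omega), if_neg (by omega), if_neg (by omega), if_neg (by omega),
        if_neg (by omega), h1 a ha ha']
    · simp
      rw [if_neg (by omega), if_neg (by omega)]
      by_cases h : p = q
      · subst h
        simp
      · have : (p : ℕ) ≠ q := fun h' => h (Fin.ext h')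
        rw [if_neg (by omega), if_neg (by omega), if_neg (by omega), hp p p.2,
          Function.update_of_ne h]
    · simp [e1, t6, t2]
    · simp [e1, t12, t0]
    · simp; omega

/-- The rows in memory. -/
structure RowsEnv (n l : ℕ) (rows : List (Fin n → Fin 4)) (s : State) : Prop where
  num : s.mem 0 = n
  one : s.mem 2 = 1
  zero : s.mem 3 = 0
  count : s.mem 6 = rows.length
  base : s.mem 10 = 50 + 3 * n
  maxWeight : s.mem 11 = l
  finish : s.mem 12 = (50 + 3 * n + n * rows.length : ℕ)
  row : ∀ (r : ℕ) (h : r < rows.length) (q : Fin n),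
    s.mem (50 + 3 * n + n * r + q) = ((rows[r] q : ℕ) : ℤ)

theorem RowsEnv.congr {l : ℕ} {rows : List (Fin n → Fin 4)} {s t : State}
    (h : RowsEnv n l rows s) (hf : ∀ a, a < 20 ∨ 50 + 3 * n ≤ a → t.mem a = s.mem a) :
    RowsEnv n l rows t := by
  refine ⟨?_, ?_, ?_, ?_, ?_, ?_, ?_, fun r hr q => ?_⟩
  · rw [hf _ (by omega), h.num]
  · rw [hf _ (by omega), h.one]
  · rw [hf _ (by omega), h.zero]
  · rw [hf _ (by omega), h.count]
  · rw [hf _ (by omega), h.base]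
  · rw [hf _ (by omega), h.maxWeight]
  · rw [hf _ (by omega), h.finish]
  · rw [hf _ (by omega), h.row r hr q]

theorem sure_appendProg_rows {l k : ℕ} {rows : List (Fin n → Fin 4)} {s : State} {q : Fin n}
    (hs : RowsEnv n l rows s) (σ : Fin 4) (hk : k < rows.length)
    (h20 : s.mem 20 = (q : ℕ)) (h22 : s.mem 22 = (50 + 3 * n + n * k : ℕ)) :
    Sure U (appendProg σ) s fun t => RowsEnv n l (rows ++ [Function.update rows[k] q σ]) t ∧
      (∀ a, a < 30 → a ≠ 6 → a ≠ 12 → t.mem a = s.mem a) ∧ t.out = s.out ∧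
      t.time ≤ s.time + 8 + 5 * n ∧ t.queries = s.queries := by
  have hle : n * k + n ≤ n * rows.length := by
    calc n * k + n = n * (k + 1) := by ring
      _ ≤ _ := Nat.mul_le_mul_left _ hk
  refine (sure_appendProg (Q := rows[k]) (q := q) σ hs.num hs.one hs.zero h20 h22 hs.finish
    (by omega) (by omega) (hs.row k hk)).mono ?_
  rintro t ⟨h1, hp, h6, h12, ho, ht, hq⟩
  have hlt : ∀ a, a < 30 → a ≠ 6 → a ≠ 12 → t.mem a = s.mem a := fun a ha ha' ha'' =>
    h1 a (by omega) ha' ha'' (by omega)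
  refine ⟨⟨?_, ?_, ?_, ?_, ?_, ?_, ?_, fun r hr p => ?_⟩, hlt, ho, ht, hq⟩
  · rw [hlt _ (by omega) (by omega) (by omega), hs.num]
  · rw [hlt _ (by omega) (by omega) (by omega), hs.one]
  · rw [hlt _ (by omega) (by omega) (by omega), hs.zero]
  · rw [h6, hs.count]; simp
  · rw [hlt _ (by omega) (by omega) (by omega), hs.base]
  · rw [hlt _ (by omega) (by omega) (by omega), hs.maxWeight]
  · rw [h12, List.length_append, List.length_singleton, mul_add, mul_one, add_assoc]
  · by_cases hr' : r < rows.length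
    · have hle : n * r + n ≤ n * rows.length := by
        calc n * r + n = n * (r + 1) := by ring
          _ ≤ _ := Nat.mul_le_mul_left _ hr'
      have hpn := p.2
      rw [h1 _ (by omega) (by omega) (by omega) (by omega), hs.row r hr' p,
        List.getElem_append_left hr']
    · have : r = rows.length := by simp at hr; omega
      subst this
      rw [hp]
      simp

theorem sure_extendProg {l k : ℕ} {rows : List (Fin n → Fin 4)} {s : State} {q : Fin n}
    (hs : RowsEnv n l rows s) (hk : k < rows.length)
    (h20 : s.mem 20 = (q : ℕ)) (h22 : s.mem 22 = (50 + 3 * n + n * k : ℕ)) :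
    Sure U extendProg s fun t => RowsEnv n l (rows ++ extendRow l q rows[k]) t ∧
      (∀ a, a < 30 → a ≠ 6 → a ≠ 12 → t.mem a = s.mem a) ∧ t.out = s.out ∧
      t.time ≤ s.time + 30 + 21 * n ∧ t.queries = s.queries := by
  rw [extendProg, sure_seq]
  refine (sure_weightProg hs.num hs.one hs.zero h22 (by omega) (hs.row k hk)).mono ?_
  rintro t ⟨h1, h30, ho, ht, hq⟩
  have env : RowsEnv n l rows ((t.write 31 (t.mem 11 - t.mem 30)).tick 1) :=
    hs.congr fun a ha => by
      simp
      rw [if_neg (by omega), h1 a (by omega)]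
  have h11 : t.mem 11 = l := by rw [h1 _ (by omega), hs.maxWeight]
  simp only [sure_seq, sure_sub, sure_ifPos, sure_skip]
  constructor
  · intro hp
    have hlt : (q : ℕ) < n ∧ weight rows[k] < l := by
      simp [h11, h30] at hp
      exact ⟨q.2, hp⟩
    have env' := env.congr (t := ((t.write 31 (t.mem 11 - t.mem 30)).tick 1).tick 1)
      fun _ _ => rfl
    refine (sure_appendProg_rows (q := q) env' 1 hk ?_ ?_).mono ?_
    · simp [h1 20, h20]
    · simp [h1 22, h22]
    rintro t1 ⟨env1, k1, o1, e1, q1⟩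
    -- Appending leaves row `k` where it is, so all three letters are substituted into the same
    -- source.
    have g1 : ∀ (h : k < (rows ++ [Function.update rows[k] q 1]).length),
      (rows ++ [Function.update rows[k] q 1])[k] = rows[k] := fun h =>
        List.getElem_append_left hk
    refine (sure_appendProg_rows (k := k) (q := q) env1 2 (by simp; omega) ?_ ?_).mono ?_
    · rw [k1 20 (by omega) (by omega) (by omega)]
      simp [h1 20, h20]
    · rw [k1 22 (by omega) (by omega) (by omega)]
      simp [h1 22, h22]
    rintro t2 ⟨env2, k2, o2, e2, q2⟩
    rw [g1] at env2
    refine (sure_appendProg_rows (k := k) (q := q) env2 3 (by simp; omega) ?_ ?_).mono ?_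
    · rw [k2 20 (by omega) (by omega) (by omega), k1 20 (by omega) (by omega) (by omega)]
      simp [h1 20, h20]
    · rw [k2 22 (by omega) (by omega) (by omega), k1 22 (by omega) (by omega) (by omega)]
      simp [h1 22, h22]
    rintro t3 ⟨env3, k3, o3, e3, q3⟩
    rw [List.getElem_append_left (by simp; omega), g1] at env3
    refine ⟨?_, fun a ha ha' ha'' => ?_, ?_, ?_, ?_⟩
    · rw [extendRow, dif_pos hlt]
      simpa using env3
    · rw [k3 a ha ha' ha'', k2 a ha ha' ha'', k1 a ha ha' ha'']
      simp
      rw [if_neg (by omega), h1 a (by omega)]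
    · rw [o3, o2, o1]; simp [ho]
    · simp at e1; omega
    · rw [q3, q2, q1]; simp [hq]
  · intro hp
    have hlt : ¬ ((q : ℕ) < n ∧ weight rows[k] < l) := by
      simp [h11, h30] at hp
      omega
    rw [extendRow, dif_neg hlt, List.append_nil]
    refine ⟨env.congr fun a ha => ?_, fun a ha _ _ => ?_, by simp [ho], by simp; omega,
      by simp [hq]⟩
    · simp
      omega
    · simp
      rw [if_neg (by omega), if_neg (by omega), h1 a (by omega)]

theorem pauliRows_length_mono (n l q : ℕ) :
    (pauliRows n l q).length ≤ (pauliRows n l (q + 1)).length := by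
  simp [pauliRows]

/-- A loop reads its count once, on entry. Although the body increases cell 6, exactly the rows of
`R` are extended and the new ones are not. -/
theorem sure_extendAll {l : ℕ} {R : List (Fin n → Fin 4)} {s t : State} {q : Fin n}
    (env : RowsEnv n l R t) (hk : ∀ a, a < 20 → a ≠ 6 → a ≠ 12 → t.mem a = s.mem a)
    (h20 : t.mem 20 = (q : ℕ)) (h22 : t.mem 22 = (50 + 3 * n : ℕ)) (ho : t.out = s.out)
    (hq : t.queries = s.queries) :
    Sure U (.loop 6 (extendProg ;; .add 22 22 0)) t fun u =>
      RowsEnv n l (R ++ R.flatMap (extendRow l q)) u ∧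
      (∀ a, a < 20 → a ≠ 6 → a ≠ 12 → u.mem a = s.mem a) ∧ u.mem 20 = (q : ℕ) ∧
      u.out = s.out ∧ u.time ≤ t.time + 1 + R.length * (32 + 21 * n) ∧
      u.queries = s.queries := by
  refine Sure.mono (sure_loop (N := R.length) (fun k u =>
    RowsEnv n l (R ++ (R.take k).flatMap (extendRow l q)) u ∧
    (∀ a, a < 20 → a ≠ 6 → a ≠ 12 → u.mem a = s.mem a) ∧ u.mem 20 = (q : ℕ) ∧
    u.mem 22 = (50 + 3 * n + n * k : ℕ) ∧ u.out = s.out ∧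
    u.time ≤ t.time + 1 + k * (32 + 21 * n) ∧
    u.queries = s.queries) (by simp [env.count]) ?_ ?_) ?_
  · refine ⟨?_, hk, h20, h22, ho, by simp, hq⟩
    simp only [List.take_zero, List.flatMap_nil, List.append_nil]
    exact env.congr fun _ _ => rfl
  · rintro k hkR u ⟨envu, hku, hu20, hu22, huo, hut, huq⟩
    have envu' := envu.congr (t := u.tick 1) fun _ _ => rfl
    have hlen : k < (R ++ (R.take k).flatMap (extendRow l q)).length := by
      rw [List.length_append]; omega
    rw [sure_seq]
    refine (sure_extendProg (q := q) envu' hlen hu20 hu22).mono ?_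
    rintro v ⟨envv, hkv, hvo, hvt, hvq⟩
    rw [List.getElem_append_left hkR] at envv
    rw [sure_add]
    refine ⟨?_, fun a ha ha' ha'' => ?_, ?_, ?_, ?_, ?_, ?_⟩
    · rw [List.take_add_one, List.getElem?_eq_getElem hkR, List.flatMap_append,
        ← List.append_assoc]
      simp only [Option.toList_some, List.flatMap_cons, List.flatMap_nil, List.append_nil]
      refine envv.congr fun a ha => ?_
      simp; omega
    · simp
      rw [if_neg (by omega), hkv a (by omega) ha' ha'', mem_tick, hku a ha ha' ha'']
    · simp [hkv 20, hu20]
    · have := envv.num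
      simp [hkv 22, hu22, this]; ring
    · simp [hvo, huo]
    · simp at hvt
      simp
      rw [add_mul, one_mul]
      omega
    · simp [hvq, huq]
  · rintro u ⟨envu, hku, hu20, -, huo, hut, huq⟩
    rw [List.take_length] at envu
    exact ⟨envu, hku, hu20, huo, hut, huq⟩

theorem sure_buildProg {l : ℕ} {s : State} (hs : RowsEnv n l (pauliRows n l 0) s) :
    Sure U buildProg s fun t => RowsEnv n l (pauliRows n l n) t ∧
      (∀ a, a < 20 → a ≠ 6 → a ≠ 12 → t.mem a = s.mem a) ∧ t.out = s.out ∧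
      t.time ≤ s.time + 2 + n * (4 + (pauliRows n l n).length * (32 + 21 * n)) ∧
      t.queries = s.queries := by
  simp only [buildProg, sure_seq, sure_set]
  -- The list only grows, so each pass is charged with the final number of rows.
  have hmono : Monotone fun q => (pauliRows n l q).length :=
    monotone_nat_of_le_succ (pauliRows_length_mono n l)
  refine Sure.mono (sure_loop (N := n) (fun q t => RowsEnv n l (pauliRows n l q) t ∧
    (∀ a, a < 20 → a ≠ 6 → a ≠ 12 → t.mem a = s.mem a) ∧ t.mem 20 = q ∧ t.out = s.out ∧
    t.time ≤ s.time + 2 + q * (4 + (pauliRows n l n).length * (32 + 21 * n)) ∧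
      t.queries = s.queries) (by simp [hs.num]) ?_ ?_) ?_
  · refine ⟨hs.congr fun a ha => ?_, fun a ha _ _ => ?_, by simp, rfl, by simp, rfl⟩
    · simp; omega
    · simp; omega
  · rintro q hq t ⟨env, hk, h20, ho, ht, hqu⟩
    simp only [sure_seq, sure_add]
    have hrow : pauliRows n l (q + 1) =
        pauliRows n l q ++ (pauliRows n l q).flatMap (extendRow l q) := rfl
    have hle : (pauliRows n l q).length * (32 + 21 * n) ≤
        (pauliRows n l n).length * (32 + 21 * n) := Nat.mul_le_mul_right _ (hmono hq.le)
    rw [hrow]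
    generalize pauliRows n l q = R at env hle ⊢
    refine (sure_extendAll (q := ⟨q, hq⟩) (env.congr fun a ha => ?_) (s := s) (fun a ha ha' ha'' => ?_)
      ?_ ?_ ?_ ?_).mono ?_
    · simp; omega
    · simp
      rw [if_neg (by omega), hk a ha ha' ha'']
    · simp [h20]
    · simp [env.base, env.zero]
    · simp [ho]
    · simp [hqu]
    rintro u ⟨envu, hku, hu20, huo, hut, huq⟩
    refine ⟨envu.congr fun a ha => ?_, fun a ha ha' ha'' => ?_, ?_, huo, ?_, huq⟩
    · simp; omega
    · simp
      rw [if_neg (by omega), hku a ha ha' ha'']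
    · simp [hu20, envu.one]
    · simp at hut
      simp
      rw [add_mul, one_mul]
      omega
  · rintro t ⟨env, hk, -, h⟩
    exact ⟨env, hk, h⟩

/-! ### The whole program -/

/-- The number of binary digits of `n`. -/
def bitLen (n : ℕ) : ℕ := Nat.log 2 n + 1

/-- The width up to which gates are taken into account. -/
def gateWidth (c n : ℕ) : ℕ := c * bitLen n

/-- The size of the light cone of a qubit. -/
def coneSize (c d n : ℕ) : ℕ := gateWidth c n ^ d

/-- The parameter that controls the precision. -/
def precision (c d n : ℕ) : ℕ := 2 ^ (gateWidth c n * coneSize c d n)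

/-- The number of samples for each estimate. -/
def sampleCount (c d n L : ℕ) : ℕ := precision c d n ^ 4 * (L + 1)

/-- Multiply cell `11` by the `d`-th power of cell `13`. -/
def powProg : ℕ → Prog
  | 0 => skip
  | d + 1 => powProg d ;; mulProg 30 13 11 ;; .add 11 30 3

/-- Compute the parameters and the addresses of the arrays. -/
def setupProg (c d : ℕ) : Prog :=
  .set 2 1 ;; .set 15 1 ;;
  .loop 0 (.sub 30 15 0 ;; .ifPos 30 skip (.add 15 15 15 ;; .add 14 14 2)) ;;
  .set 30 c ;; mulProg 13 30 14 ;; .set 11 1 ;; powProg d ;; mulProg 31 13 11 ;;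
  .set 4 1 ;; .loop 31 (.add 4 4 4) ;; mulProg 30 4 4 ;; mulProg 31 30 30 ;; .add 32 1 2 ;;
  mulProg 5 31 32 ;; .set 7 50 ;; .add 8 7 0 ;; .add 9 8 0 ;; .add 10 9 0 ;; .set 6 1 ;;
  .add 12 10 0

/-- The learning algorithm. -/
def learnProg (c d : ℕ) : Prog := setupProg c d ;; buildProg ;; swapsProg ;; qubitsProg

theorem sure_powProg {s : State} {k : ℕ} (hk : 0 < k) (d : ℕ) (h3 : s.mem 3 = 0)
    (h13 : s.mem 13 = k) (h11 : s.mem 11 = 1) :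
    Sure U (powProg d) s fun t => (∀ q, q ≠ 11 → q < 30 ∨ 50 ≤ q → t.mem q = s.mem q) ∧
      t.mem 11 = (k ^ d : ℕ) ∧ t.out = s.out ∧ t.time ≤ s.time + 1 + d * (3 + 2 * k ^ d) ∧
      t.queries = s.queries := by
  induction d with
  | zero =>
    rw [powProg, sure_skip]
    refine ⟨fun q _ hq => ?_, by simp [h11], rfl, by simp, rfl⟩
    simp; omega
  | succ d ih =>
    rw [powProg, sure_seq]
    refine ih.mono ?_
    rintro t ⟨h1, d11, o, e, q⟩
    rw [sure_seq]
    refine sure_mulProg (N := k ^ d) (by omega) (by omega) d11 ?_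
    intro t1 k1 d1 o1 e1 q1
    rw [sure_add]
    have t3 : t1.mem 3 = 0 := by rw [k1 _ (by omega), h1 _ (by omega) (by omega), h3]
    refine ⟨fun q hq hq' => ?_, ?_, by simp [o1, o], ?_, by simp [q1, q]⟩
    · simp
      rw [if_neg hq, k1 q (by omega), h1 q hq hq']
    · simp [d1, t3, h1 13, h13]; ring
    · have hle : k ^ d ≤ k ^ (d + 1) := Nat.pow_le_pow_right hk (by omega)
      have hle2 : d * (3 + 2 * k ^ d) ≤ d * (3 + 2 * k ^ (d + 1)) := by gcongr
      simp
      rw [add_mul, one_mul]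
      omega

theorem sure_bitLen {s : State} (h0 : s.mem 0 = n) (hn : 1 ≤ n) (h2 : s.mem 2 = 1)
    (h14 : s.mem 14 = 0) (h15 : s.mem 15 = 1) :
    Sure U (.loop 0 (.sub 30 15 0 ;; .ifPos 30 skip (.add 15 15 15 ;; .add 14 14 2))) s fun t =>
      (∀ q, q ≠ 14 → q ≠ 15 → q < 30 ∨ 50 ≤ q → t.mem q = s.mem q) ∧ t.mem 14 = bitLen n ∧
      t.out = s.out ∧ t.time ≤ s.time + 1 + 5 * n ∧ t.queries = s.queries := by
  refine Sure.mono (sure_loop (N := n) (fun k t =>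
      (∀ q, q ≠ 14 → q ≠ 15 → q < 30 ∨ 50 ≤ q → t.mem q = s.mem q) ∧
      -- Either the power of two already exceeds `n`, or every pass so far has doubled it. After `n`
      -- passes the second case implies the first, since `n < 2 ^ n`.
      (∃ g : ℕ, t.mem 14 = g ∧ t.mem 15 = (2 ^ g : ℕ) ∧ 2 ^ g ≤ 2 * n ∧ (n < 2 ^ g ∨ g = k)) ∧
      t.out = s.out ∧ t.time ≤ s.time + 1 + 5 * k ∧ t.queries = s.queries) (by simp [h0]) ?_ ?_) ?_
  · refine ⟨fun _ _ _ _ => rfl, ⟨0, by simp [h14], by simp [h15], by omega, by simp⟩, rfl, by simp, rfl⟩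
  · rintro k hk t ⟨h1, ⟨g, hg14, hg15, hg, hg'⟩, o, e, q⟩
    have t0 : t.mem 0 = n := by rw [h1 _ (by omega) (by omega) (by omega), h0]
    have t2 : t.mem 2 = 1 := by rw [h1 _ (by omega) (by omega) (by omega), h2]
    simp only [sure_seq, sure_sub, sure_ifPos, sure_skip, sure_add]
    constructor
    · intro hp
      simp [hg15, t0] at hp
      have hp' : n < 2 ^ g := by exact_mod_cast hp
      refine ⟨fun q h h' hq => ?_, ⟨g, by simp [hg14], by simp [hg15], hg, Or.inl hp'⟩, o, ?_, q⟩
      · simp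
        rw [if_neg (by omega), if_neg (by omega), h1 q h h' hq]
      · simp; omega
    · intro hp
      simp [hg15, t0] at hp
      have hp' : 2 ^ g ≤ n := by exact_mod_cast hp
      refine ⟨fun q h h' hq => ?_, ⟨g + 1, by simp [hg14, t2], ?_, ?_, ?_⟩, o, ?_, q⟩
      · simp
        rw [if_neg (by omega), if_neg (by omega), if_neg (by omega), h1 q h h' hq]
      · simp [hg15]; ring
      · rw [pow_succ]; omega
      · rcases hg' with h | h
        · omega
        · right; omega
      · simp; omega
  · rintro t ⟨h1, ⟨g, hg14, hg15, hg, hg'⟩, o, e, q⟩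
    refine ⟨h1, ?_, o, e, q⟩
    have hlt : n < 2 ^ g := by
      rcases hg' with h | h
      · exact h
      · rw [h]; exact Nat.lt_two_pow_self
    have hg0 : g ≠ 0 := fun h => by simp [h] at hlt; omega
    obtain ⟨g, rfl⟩ := Nat.exists_eq_succ_of_ne_zero hg0
    have : Nat.log 2 n = g := by
      rw [Nat.log_eq_iff (by omega)]
      refine ⟨?_, hlt⟩
      rw [Nat.succ_eq_add_one, pow_succ] at hg
      omega
    rw [hg14, bitLen, this]

/-- The memory holds the input. -/
structure InitialEnv (n L : ℕ) (s : State) : Prop where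
  num : s.mem 0 = n
  digits : s.mem 1 = L
  zero : ∀ q, 2 ≤ q → s.mem q = 0

theorem sure_setupProg {c d L : ℕ} {s : State} (hc : 0 < c) (hn : 1 ≤ n)
    (hs : InitialEnv n L s) :
    Sure U (setupProg c d) s fun t => RowsEnv n (coneSize c d n) (pauliRows n (coneSize c d n) 0) t ∧
      t.mem 4 = precision c d n ∧ t.mem 5 = sampleCount c d n L ∧ t.mem 7 = 50 ∧
      t.mem 8 = 50 + n ∧ t.mem 9 = 50 + 2 * n ∧ t.out = s.out ∧
      t.time ≤ s.time + 80 + 5 * n + 2 * bitLen n + d * (3 + 2 * coneSize c d n) +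
        4 * (gateWidth c n * coneSize c d n) + 4 * precision c d n + 2 * precision c d n ^ 2 +
        2 * L ∧ t.queries = s.queries := by
  have hk : 0 < gateWidth c n := by unfold gateWidth bitLen; positivity
  simp only [setupProg, sure_seq, sure_set]
  refine (sure_bitLen (by simp [hs.num]) hn (by simp) (by simp [hs.zero]) (by simp)).mono ?_
  rintro t1 ⟨k1, d14, o1, e1, q1⟩
  have base : ∀ q, q ≠ 14 → q ≠ 15 → q ≠ 2 → q < 30 ∨ 50 ≤ q → t1.mem q = s.mem q := by
    intro q h h' h'' hq
    rw [k1 q h h' hq]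
    simp [h', h'']
  have one1 : t1.mem 2 = 1 := by rw [k1 _ (by omega) (by omega) (by omega)]; simp
  have e1' : t1.time ≤ s.time + 3 + 5 * n := by simp at e1; omega
  have o1' : t1.out = s.out := by simp [o1]
  have q1' : t1.queries = s.queries := by simp [q1]
  refine sure_mulProg (N := bitLen n) (by omega) (by omega) (by simp [d14]) ?_
  intro t2 k2 d2 o2 e2 q2
  have k2' : ∀ q, q ≠ 13 → q ≠ 30 → t2.mem q = t1.mem q := by
    intro q h h'
    rw [k2 q h]
    simp [h']
  have d2' : t2.mem 13 = gateWidth c n := by rw [d2]; simp [gateWidth]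
  refine (sure_powProg (k := gateWidth c n) hk d ?_ ?_ ?_).mono ?_
  · simp [k2', base, hs.zero]
  · simp [d2']
  · simp
  rintro t3 ⟨k3, d3, o3, e3, q3⟩
  have k3' : ∀ q, q ≠ 11 → q ≠ 13 → q < 30 ∨ 50 ≤ q → t3.mem q = t1.mem q := by
    intro q h h' hq
    rw [k3 q h hq]
    simp
    rw [if_neg h, k2' q h' (by omega)]
  have d3' : t3.mem 13 = gateWidth c n := by rw [k3 _ (by omega) (by omega)]; simp [d2']
  refine sure_mulProg (N := coneSize c d n) (by omega) (by omega) (by rw [d3, coneSize]) ?_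
  intro t4 k4 d4 o4 e4 q4
  have d4' : t4.mem 31 = (gateWidth c n * coneSize c d n : ℕ) := by rw [d4, d3']; push_cast; rfl
  refine Sure.mono (sure_loop (N := gateWidth c n * coneSize c d n) (fun k t =>
    (∀ q, q ≠ 4 → t.mem q = t4.mem q) ∧ t.mem 4 = (2 ^ k : ℕ) ∧ t.out = t4.out ∧
      t.time = t4.time + 2 + 2 * k ∧ t.queries = t4.queries)
    (by rw [mem_tick, mem_write, if_neg (by omega), d4', Int.toNat_natCast]) ?_ ?_) ?_
  · refine ⟨fun q hq => by simp [hq], by simp, rfl, rfl, rfl⟩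
  · rintro k _ t ⟨h1, h4, o, e, q⟩
    rw [sure_add]
    refine ⟨fun q hq => by simp [hq, h1 q hq], ?_, o, ?_, q⟩
    · simp [h4]; ring
    · simp [e]; ring
  rintro t5 ⟨k5, d5, o5, e5, q5⟩
  rw [← precision] at d5
  refine sure_mulProg (N := precision c d n) (by omega) (by omega) d5 ?_
  intro t6 k6 d6 o6 e6 q6
  have d6' : t6.mem 30 = (precision c d n ^ 2 : ℕ) := by rw [d6, d5]; push_cast; ring
  refine sure_mulProg (N := precision c d n ^ 2) (by omega) (by omega) d6' ?_
  intro t7 k7 d7 o7 e7 q7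
  have d7' : t7.mem 31 = (precision c d n ^ 4 : ℕ) := by rw [d7, d6']; push_cast; ring
  have k7' : ∀ q, q ≠ 4 → q ≠ 11 → q ≠ 13 → q < 30 ∨ 50 ≤ q → t7.mem q = t1.mem q := by
    intro q h h' h'' hq
    rw [k7 q (by omega), k6 q (by omega), k5 q h, k4 q (by omega), k3' q h' h'' hq]
  have m1 : t7.mem 1 = L := by
    rw [k7' _ (by omega) (by omega) (by omega) (by omega),
      base _ (by omega) (by omega) (by omega) (by omega), hs.digits]
  have m2 : t7.mem 2 = 1 := by rw [k7' _ (by omega) (by omega) (by omega) (by omega), one1]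
  rw [sure_add]
  refine sure_mulProg (d := 5) (a := 31) (b := 32) (N := L + 1) (by omega) (by omega) ?_ ?_
  · simp [m1, m2]
  intro t8 k8 d8 o8 e8 q8
  have d8' : t8.mem 5 = sampleCount c d n L := by
    rw [d8]; simp [d7', sampleCount]
  have k8' : ∀ q, q ≠ 4 → q ≠ 5 → q ≠ 11 → q ≠ 13 → q ≠ 14 → q ≠ 15 → q ≠ 2 → q < 30 ∨ 50 ≤ q →
      t8.mem q = s.mem q := by
    intro q h4 h5 h11 h13 h14 h15 h2 hq
    rw [k8 q h5]
    simp
    rw [if_neg (by omega), k7' q h4 h11 h13 hq, base q h14 h15 h2 hq]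
  have n8 : t8.mem 0 = n := by
    rw [k8' _ (by omega) (by omega) (by omega) (by omega) (by omega) (by omega) (by omega)
      (by omega), hs.num]
  have one8 : t8.mem 2 = 1 := by rw [k8 _ (by omega)]; simp [m2]
  have z8 : ∀ q, 16 ≤ q → q < 30 ∨ 50 ≤ q → t8.mem q = 0 := by
    intro q h hq
    rw [k8' _ (by omega) (by omega) (by omega) (by omega) (by omega) (by omega) (by omega) hq,
      hs.zero _ (by omega)]
  have z83 : t8.mem 3 = 0 := by
    rw [k8' _ (by omega) (by omega) (by omega) (by omega) (by omega) (by omega) (by omega)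
      (by omega), hs.zero _ (by omega)]
  have m11 : t8.mem 11 = coneSize c d n := by
    rw [k8 _ (by omega)]
    simp
    rw [k7 _ (by omega), k6 _ (by omega), k5 _ (by omega), k4 _ (by omega), d3, coneSize]
  have m4 : t8.mem 4 = precision c d n := by
    rw [k8 _ (by omega)]
    simp
    rw [k7 _ (by omega), k6 _ (by omega), d5]
  simp only [sure_add]
  refine ⟨⟨?_, ?_, ?_, ?_, ?_, ?_, ?_, fun r hr q => ?_⟩, ?_, ?_, ?_, ?_, ?_, ?_, ?_, ?_⟩
  · simp [n8]
  · simp [one8]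
  · simp [z83]
  · simp [pauliRows]
  · simp [n8]; ring
  · simp [m11]
  · simp [n8, pauliRows]; ring
  -- The initial list is the single zero string, which the untouched memory already contains.
  · have : r = 0 := by simp [pauliRows] at hr; omega
    subst this
    simp [pauliRows]
    rw [if_neg (by omega), if_neg (by omega), if_neg (by omega), if_neg (by omega),
      if_neg (by omega), if_neg (by omega), z8 _ (by omega) (by omega)]
  · simp [m4]
  · simp [d8']
  · simp
  · simp [n8]
  · simp [n8]; ring
  · simp [o8, o7, o6, o5, o4, o3, o2, o1']
  · simp at e2 e3 e8
    rw [← coneSize] at e3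
    have hcone := Nat.le_mul_of_pos_left (coneSize c d n) hk
    simp
    omega
  · simp [q8, q7, q6, q5, q4, q3, q2, q1']

/-- The resources that the algorithm uses. -/
def totalTime (c d n L : ℕ) : ℕ :=
  80 + 5 * n + 2 * bitLen n + d * (3 + 2 * coneSize c d n) +
    4 * (gateWidth c n * coneSize c d n) + 4 * precision c d n + 2 * precision c d n ^ 2 + 2 * L +
  (2 + n * (4 + (pauliRows n (coneSize c d n) n).length * (32 + 21 * n))) + (2 + n * 100) +
  (2 + n * (4 + precision c d n * (8 + 3 * ((pauliRows n (coneSize c d n) n).length *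
    termCost n (precision c d n) (sampleCount c d n L)))))

theorem precision_ne_zero (c d n : ℕ) : precision c d n ≠ 0 := by unfold precision; positivity

theorem sampleCount_ne_zero (c d n L : ℕ) : sampleCount c d n L ≠ 0 := by
  have := precision_ne_zero c d n
  unfold sampleCount; positivity

/-- General in `τ` and `ε` because it is used twice: with the trivial accuracy and `ε = 0` for the
resources of every run, and with the Chernoff bound for the quality of the output. -/
theorem whp_learnProg {c d L : ℕ} {s : State} {τ : ℝ} {ε : ℝ≥0∞} (hc : 0 < c) (hn : 1 ≤ n)
    (hest : EstimatesWithin U (sampleCount c d n L) τ ε) (hs : InitialEnv n L s)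
    (hout : s.out = []) (htime : s.time = 0) (hqueries : s.queries = 0) :
    Whp U (learnProg c d) s (fun t => t.time ≤ totalTime c d n L ∧
      t.queries ≤ n * (precision c d n * (3 * ((pauliRows n (coneSize c d n) n).length *
        sampleCount c d n L))) ∧
      ∃ gs, QubitsPrinted U (precision_ne_zero c d n) (sampleCount_ne_zero c d n L) τ
        (pauliRows n (coneSize c d n) n) n gs ∧
        t.out = encodeCircuit ((List.ofFn fun q : Fin n => swapGate q) ++ gs))
      (n * (precision c d n * (3 * ((pauliRows n (coneSize c d n) n).length * ε)))) := by
  rw [learnProg, ← zero_add ((n : ℝ≥0∞) * _)]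
  refine ((sure_iff_whp _ _ _).1 (sure_setupProg (d := d) hc hn hs)).seq ?_
  rintro t1 ⟨env1, h4, h5, h7, h8, h9, o1, e1, q1⟩
  rw [← zero_add ((n : ℝ≥0∞) * _)]
  refine ((sure_iff_whp _ _ _).1 (sure_buildProg env1)).seq ?_
  rintro t2 ⟨env2, k2, o2, e2, q2⟩
  have env : Env n (precision c d n) (sampleCount c d n L) (pauliRows n (coneSize c d n) n) t2 :=
    ⟨env2.num, env2.one, env2.zero, by rw [k2 _ (by omega) (by omega) (by omega), h4],
      by rw [k2 _ (by omega) (by omega) (by omega), h5], env2.count,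
      by rw [k2 _ (by omega) (by omega) (by omega), h7],
      by rw [k2 _ (by omega) (by omega) (by omega), h8],
      by rw [k2 _ (by omega) (by omega) (by omega), h9], env2.base, env2.row⟩
  rw [← zero_add ((n : ℝ≥0∞) * _)]
  refine ((sure_iff_whp _ _ _).1 (sure_swapsProg env)).seq ?_
  rintro t3 ⟨env3, e3, q3, o3⟩
  refine (whp_qubitsProg hest (precision_ne_zero c d n) (sampleCount_ne_zero c d n L)
    env3).mono ?_ le_rfl
  rintro t4 ⟨e4, q4, gs, hgs, o4⟩
  refine ⟨?_, by omega, gs, hgs, ?_⟩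
  · unfold totalTime
    omega
  · rw [o4, o3, o2, o1, hout, encodeCircuit_append, List.nil_append]

end

section

/-! ### The normalized Hilbert–Schmidt norm -/

section HSNorm

set_option linter.unusedSectionVars false

variable {ι : Type} [Fintype ι] [DecidableEq ι]

/-- The normalized Hilbert–Schmidt norm. -/
def hsNorm (A : Matrix ι ι ℂ) : ℝ :=
  Real.sqrt ((Fintype.card ι : ℝ)⁻¹ * ∑ i, ∑ j, ‖A i j‖ ^ 2)

theorem hsNorm_nonneg (A : Matrix ι ι ℂ) : 0 ≤ hsNorm A := Real.sqrt_nonneg _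

theorem hsNorm_sq (A : Matrix ι ι ℂ) :
    hsNorm A ^ 2 = (Fintype.card ι : ℝ)⁻¹ * ∑ i, ∑ j, ‖A i j‖ ^ 2 :=
  Real.sq_sqrt (by positivity)

/-- A rescaled Euclidean norm on the entries, from which the triangle inequality and homogeneity are
inherited. -/
theorem hsNorm_eq (A : Matrix ι ι ℂ) : hsNorm A = Real.sqrt (Fintype.card ι : ℝ)⁻¹ *
    ‖(WithLp.toLp 2 fun p : ι × ι => A p.1 p.2 : EuclideanSpace ℂ (ι × ι))‖ := by
  rw [hsNorm, Real.sqrt_mul (by positivity), EuclideanSpace.norm_eq, Fintype.sum_prod_type]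

theorem hsNorm_add_le (A B : Matrix ι ι ℂ) : hsNorm (A + B) ≤ hsNorm A + hsNorm B := by
  simp only [hsNorm_eq]
  rw [← mul_add]
  exact mul_le_mul_of_nonneg_left (norm_add_le (WithLp.toLp 2 fun p : ι × ι => A p.1 p.2)
    (WithLp.toLp 2 fun p : ι × ι => B p.1 p.2 : EuclideanSpace ℂ (ι × ι))) (Real.sqrt_nonneg _)

theorem hsNorm_smul (c : ℂ) (A : Matrix ι ι ℂ) : hsNorm (c • A) = ‖c‖ * hsNorm A := by
  simp only [hsNorm_eq]
  rw [mul_left_comm, ← norm_smul]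
  rfl

@[simp]
theorem hsNorm_zero : hsNorm (0 : Matrix ι ι ℂ) = 0 := by simp [hsNorm]

theorem hsNorm_neg (A : Matrix ι ι ℂ) : hsNorm (-A) = hsNorm A := by
  rw [← neg_one_smul ℂ, hsNorm_smul, norm_neg, norm_one, one_mul]

theorem sum_normSq_eq_trace (A : Matrix ι ι ℂ) :
    ((∑ i, ∑ j, ‖A i j‖ ^ 2 : ℝ) : ℂ) = (star A * A).trace := by
  rw [Matrix.trace, Finset.sum_comm]
  simp only [Matrix.diag_apply, Matrix.mul_apply, Matrix.star_apply]
  push_cast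
  refine Finset.sum_congr rfl fun i _ => Finset.sum_congr rfl fun j _ => ?_
  rw [Complex.star_def, Complex.conj_mul']

theorem hsNorm_sq_eq_trace (A : Matrix ι ι ℂ) :
    hsNorm A ^ 2 = (Fintype.card ι : ℝ)⁻¹ * (star A * A).trace.re := by
  rw [hsNorm_sq, ← sum_normSq_eq_trace, Complex.ofReal_re]

theorem hsNorm_congr {A B : Matrix ι ι ℂ} (h : (star A * A).trace = (star B * B).trace) :
    hsNorm A = hsNorm B := by
  rw [← sq_eq_sq₀ (hsNorm_nonneg _) (hsNorm_nonneg _), hsNorm_sq_eq_trace, hsNorm_sq_eq_trace, h]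

theorem hsNorm_unitary_mul {U : Matrix ι ι ℂ} (hU : U ∈ Matrix.unitaryGroup ι ℂ)
    (A : Matrix ι ι ℂ) : hsNorm (U * A) = hsNorm A := by
  apply hsNorm_congr
  rw [star_mul, mul_assoc, ← mul_assoc (star U), Matrix.mem_unitaryGroup_iff'.1 hU, one_mul]

theorem hsNorm_mul_unitary {U : Matrix ι ι ℂ} (hU : U ∈ Matrix.unitaryGroup ι ℂ)
    (A : Matrix ι ι ℂ) : hsNorm (A * U) = hsNorm A := by
  apply hsNorm_congr
  rw [star_mul, mul_assoc, Matrix.trace_mul_comm, mul_assoc, mul_assoc,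
    Matrix.mem_unitaryGroup_iff.1 hU, mul_one]

theorem hsNorm_one [Nonempty ι] : hsNorm (1 : Matrix ι ι ℂ) = 1 := by
  rw [← sq_eq_sq₀ (hsNorm_nonneg _) zero_le_one, hsNorm_sq_eq_trace, star_one, mul_one,
    Matrix.trace_one]
  simp

theorem hsNorm_unitary [Nonempty ι] {U : Matrix ι ι ℂ} (hU : U ∈ Matrix.unitaryGroup ι ℂ) :
    hsNorm U = 1 := by
  rw [← mul_one U, hsNorm_unitary_mul hU, hsNorm_one]

/-- Coefficients with respect to an orthonormal family give the best approximation. -/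
theorem hsNorm_sub_sum_le {κ : Type} [DecidableEq κ] (F : Finset κ) (E : κ → Matrix ι ι ℂ) (A : Matrix ι ι ℂ)
    (c b : κ → ℂ) (hc : ∀ k ∈ F, (Fintype.card ι : ℂ) * c k = (star (E k) * A).trace)
    (horth : ∀ k ∈ F, ∀ l ∈ F, (star (E k) * E l).trace = if k = l then (Fintype.card ι : ℂ) else 0) :
    hsNorm (A - ∑ k ∈ F, c k • E k) ≤ hsNorm (A - ∑ k ∈ F, b k • E k) := by
  set D := A - ∑ k ∈ F, c k • E k with hD
  set G := ∑ k ∈ F, (c k - b k) • E k with hG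
  have h1 : A - ∑ k ∈ F, b k • E k = D + G := by
    rw [hD, hG]
    simp only [sub_smul, Finset.sum_sub_distrib]
    abel
  -- The residual `D` is orthogonal to the span of the family, so by Pythagoras any other choice of
  -- coefficients adds the squared norm of `G`.
  have h2 : ∀ k ∈ F, (star (E k) * D).trace = 0 := by
    intro k hk
    rw [hD, mul_sub, Matrix.trace_sub, ← hc k hk, Finset.mul_sum, Matrix.trace_sum]
    simp only [mul_smul_comm, Matrix.trace_smul, smul_eq_mul]
    rw [Finset.sum_congr rfl fun l hl => by rw [horth k hk l hl]]
    simp [hk, mul_comm]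
  have h3 : (star G * D).trace = 0 := by
    rw [hG, star_sum, Finset.sum_mul, Matrix.trace_sum]
    refine Finset.sum_eq_zero fun k hk => ?_
    rw [star_smul, smul_mul_assoc, Matrix.trace_smul, h2 k hk, smul_zero]
  have h4 : (star D * G).trace = 0 := by
    have : star D * G = (star G * D)ᴴ := by
      rw [← Matrix.star_eq_conjTranspose, star_mul, star_star]
    rw [this, Matrix.trace_conjTranspose, h3, star_zero]
  refine le_of_sq_le_sq ?_ (hsNorm_nonneg _)
  rw [h1, hsNorm_sq_eq_trace, hsNorm_sq_eq_trace, star_add, add_mul, mul_add, mul_add]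
  simp only [Matrix.trace_add, h3, h4, add_zero, zero_add, Complex.add_re]
  refine mul_le_mul_of_nonneg_left ?_ (by positivity)
  rw [← sum_normSq_eq_trace G, Complex.ofReal_re]
  have : 0 ≤ ∑ i, ∑ j, ‖G i j‖ ^ 2 := by positivity
  linarith

/-- `U` and `V` agree up to a phase and an error of at most `e`. -/
def Near (e : ℝ) (U V : Matrix ι ι ℂ) : Prop := ∃ c : ℂ, ‖c‖ = 1 ∧ hsNorm (U - c • V) ≤ e

theorem Near.refl (U : Matrix ι ι ℂ) : Near 0 U U := ⟨1, by simp, by simp⟩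

/-- Replace one factor at a time. The untouched factor is unitary and does not change the norm, so
errors add and phases multiply. -/
theorem Near.mul {e e' : ℝ} {U V U' V' : Matrix ι ι ℂ} (h : Near e U V) (h' : Near e' U' V')
    (hV : V ∈ Matrix.unitaryGroup ι ℂ) (hU' : U' ∈ Matrix.unitaryGroup ι ℂ) :
    Near (e + e') (U * U') (V * V') := by
  obtain ⟨c, hc, h⟩ := h
  obtain ⟨c', hc', h'⟩ := h'
  refine ⟨c * c', by rw [norm_mul, hc, hc', one_mul], ?_⟩
  have : U * U' - (c * c') • (V * V') = (U - c • V) * U' + c • (V * (U' - c' • V')) := by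
    rw [sub_mul, mul_sub, smul_sub, mul_smul_comm, smul_mul_assoc, smul_smul]
    abel
  rw [this]
  refine (hsNorm_add_le _ _).trans ?_
  rw [hsNorm_mul_unitary hU', hsNorm_smul, hsNorm_unitary_mul hV, hc, one_mul]
  exact add_le_add h h'

theorem Near.mono {e e' : ℝ} {U V : Matrix ι ι ℂ} (h : Near e U V) (he : e ≤ e') : Near e' U V := by
  obtain ⟨c, hc, h⟩ := h
  exact ⟨c, hc, h.trans he⟩

/-! ### Rotations -/

/-- The unitary `(1 + i s A) / (1 - i s A)` for `A² = 1`. -/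
def rotOp (A : Matrix ι ι ℂ) (s : ℝ) : Matrix ι ι ℂ :=
  ((1 + s ^ 2 : ℝ)⁻¹ : ℂ) • (((1 - s ^ 2 : ℝ) : ℂ) • 1 + (2 * Complex.I * s) • A)

theorem rotOp_sub_one (A : Matrix ι ι ℂ) (s : ℝ) :
    rotOp A s - 1 = ((1 + s ^ 2 : ℝ)⁻¹ : ℂ) • ((2 * s : ℂ) • (Complex.I • A - (s : ℂ) • 1)) := by
  have h : ((1 + s ^ 2 : ℝ) : ℂ) ≠ 0 := by
    norm_cast
    positivity
  have h1 : (1 : Matrix ι ι ℂ) = ((1 + s ^ 2 : ℝ)⁻¹ : ℂ) • (((1 + s ^ 2 : ℝ) : ℂ) • 1) := by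
    rw [smul_smul, inv_mul_cancel₀ h, one_smul]
  rw [rotOp]
  nth_rw 2 [h1]
  rw [← smul_sub]
  congr 1
  rw [smul_sub, smul_smul, smul_smul]
  ext i j
  simp only [Matrix.sub_apply, Matrix.add_apply, Matrix.smul_apply, smul_eq_mul]
  push_cast
  ring

theorem norm_inv_one_add_sq_le (s : ℝ) : ‖((1 + s ^ 2 : ℝ)⁻¹ : ℂ)‖ ≤ 1 := by
  rw [norm_inv, Complex.norm_real, Real.norm_eq_abs, abs_of_pos (by positivity)]
  exact inv_le_one_of_one_le₀ (by nlinarith [sq_nonneg s])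

theorem hsNorm_rotOp_sub_one_le [Nonempty ι] {A : Matrix ι ι ℂ} (hA : hsNorm A = 1) {s : ℝ} :
    hsNorm (rotOp A s - 1) ≤ 2 * |s| * (1 + |s|) := by
  rw [rotOp_sub_one, hsNorm_smul, hsNorm_smul]
  have h1 : hsNorm (Complex.I • A - (s : ℂ) • 1) ≤ 1 + |s| := by
    rw [sub_eq_add_neg]
    refine (hsNorm_add_le _ _).trans ?_
    rw [hsNorm_neg, hsNorm_smul, hsNorm_smul, hA, hsNorm_one]
    simp
  have h2 : ‖(2 * s : ℂ)‖ = 2 * |s| := by simp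
  rw [h2, ← one_mul (2 * |s| * (1 + |s|))]
  exact mul_le_mul (norm_inv_one_add_sq_le s) (mul_le_mul_of_nonneg_left h1 (by positivity))
    (mul_nonneg (by positivity) (hsNorm_nonneg _)) zero_le_one

theorem hsNorm_rotOp_sub_one_le' [Nonempty ι] {A : Matrix ι ι ℂ} (hA : hsNorm A = 1) {s : ℝ}
    (hs : |s| ≤ 1) : hsNorm (rotOp A s - 1) ≤ 4 * |s| :=
  (hsNorm_rotOp_sub_one_le hA).trans (by nlinarith [abs_nonneg s])

/-- The remainder is exactly -2s²(1 + isA)/(1 + s²). Only the norm of `A` enters here, not the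
relation `A² = 1`. -/
theorem hsNorm_rotOp_sub_le [Nonempty ι] {A : Matrix ι ι ℂ} (hA : hsNorm A = 1) {s : ℝ}
    (hs : |s| ≤ 1) : hsNorm (rotOp A s - 1 - (2 * Complex.I * s) • A) ≤ 4 * s ^ 2 := by
  have h : ((1 + s ^ 2 : ℝ) : ℂ) ≠ 0 := by
    norm_cast
    positivity
  have h1 : rotOp A s - 1 - (2 * Complex.I * s) • A =
      ((1 + s ^ 2 : ℝ)⁻¹ : ℂ) • ((-2 * s ^ 2 : ℂ) • (1 + (Complex.I * s) • A)) := by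
    have h2 : (2 * Complex.I * s) • A = ((1 + s ^ 2 : ℝ)⁻¹ : ℂ) • (((1 + s ^ 2 : ℝ) : ℂ) •
        (2 * Complex.I * s) • A) := by
      rw [smul_smul, inv_mul_cancel₀ h, one_smul]
    rw [rotOp_sub_one, h2, ← smul_sub]
    congr 1
    simp only [smul_sub, smul_add, smul_smul]
    ext i j
    simp only [Matrix.sub_apply, Matrix.add_apply, Matrix.smul_apply, smul_eq_mul]
    push_cast
    ring
  rw [h1, hsNorm_smul, hsNorm_smul]
  have h3 : hsNorm (1 + (Complex.I * s) • A) ≤ 2 := by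
    refine (hsNorm_add_le _ _).trans ?_
    rw [hsNorm_smul, hA, hsNorm_one]
    simp
    linarith
  have h4 : ‖(-2 * s ^ 2 : ℂ)‖ = 2 * s ^ 2 := by simp
  rw [h4, ← one_mul (4 * s ^ 2)]
  exact mul_le_mul (norm_inv_one_add_sq_le s) (by nlinarith [sq_nonneg s])
    (mul_nonneg (by positivity) (hsNorm_nonneg _)) zero_le_one

/-- For an involution `rotOp A s` is exp(2i arctan(s) A), so this is the addition formula of the
tangent. -/
theorem rotOp_mul_rotOp {A : Matrix ι ι ℂ} (hA : A * A = 1) {s u w : ℝ} (h : 1 - s * u ≠ 0)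
    (hw : w * (1 - s * u) = s + u) : rotOp A s * rotOp A u = rotOp A w := by
  obtain rfl : w = (s + u) / (1 - s * u) := by rw [eq_div_iff h, hw]
  have h1 : (1 - s * u : ℂ) ≠ 0 := by exact_mod_cast h
  have hpos : ∀ r : ℝ, (1 + r ^ 2 : ℂ) ≠ 0 := by
    intro r
    have : (1 + r ^ 2 : ℝ) ≠ 0 := by positivity
    exact_mod_cast this
  have h2 := hpos ((s + u) / (1 - s * u))
  push_cast at h2
  have h3 : (1 + ((s + u) / (1 - s * u)) ^ 2 : ℂ) = (1 + s ^ 2) * (1 + u ^ 2) / (1 - s * u) ^ 2 := by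
    field_simp
    ring
  simp only [rotOp, smul_mul_smul, add_mul, mul_add, one_mul, mul_one, hA]
  ext i j
  simp only [Matrix.add_apply, Matrix.smul_apply, smul_eq_mul]
  push_cast
  rw [h3]
  have hs := hpos s
  have hu := hpos u
  field_simp
  linear_combination (4 * s * u * (1 : Matrix ι ι ℂ) i j) * Complex.I_sq

theorem rotOp_zero (A : Matrix ι ι ℂ) : rotOp A 0 = 1 := by simp [rotOp]

theorem star_rotOp {A : Matrix ι ι ℂ} (hA : star A = A) (s : ℝ) : star (rotOp A s) = rotOp A (-s) := by
  simp [rotOp, hA]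

theorem rotOp_mem {A : Matrix ι ι ℂ} (hA : A * A = 1) (hA' : star A = A) (s : ℝ) :
    rotOp A s ∈ Matrix.unitaryGroup ι ℂ := by
  rw [Matrix.mem_unitaryGroup_iff, star_rotOp hA',
    rotOp_mul_rotOp hA (w := 0) (by nlinarith [sq_nonneg s]) (by ring), rotOp_zero]

/-- The end of the path: at `s = 1` the rotation is the involution itself up to a phase. -/
theorem rotOp_one (A : Matrix ι ι ℂ) : rotOp A 1 = Complex.I • A := by
  rw [rotOp]
  simp only [smul_add, smul_smul]
  norm_num
  congr 1
  ring

/-- The step number `j` on the way from the identity to an involution. -/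
def stepAngle (M j : ℕ) : ℝ := M / (M ^ 2 + j * (j + 1))

theorem stepAngle_nonneg (M j : ℕ) : 0 ≤ stepAngle M j := by unfold stepAngle; positivity

theorem stepAngle_le (M j : ℕ) : stepAngle M j ≤ 1 / M := by
  rcases Nat.eq_zero_or_pos M with rfl | hM
  · simp [stepAngle]
  have : (0 : ℝ) < M := by exact_mod_cast hM
  rw [stepAngle, div_le_div_iff₀ (by positivity) this]
  nlinarith [(by positivity : (0 : ℝ) ≤ j * (j + 1))]

/-- `stepAngle M j` is the tangent of arctan((j+1)/M) - arctan(j/M). Equal steps of the tangent,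
rather than of the angle, keep it rational. -/
theorem rotOp_stepAngle_mul {A : Matrix ι ι ℂ} (hA : A * A = 1) {M j : ℕ} (hj : j < M) :
    rotOp A (stepAngle M j) * rotOp A (j / M) = rotOp A ((j + 1 : ℕ) / M) := by
  have hM : (0 : ℝ) < M := by
    have : 0 < M := by omega
    exact_mod_cast this
  have h0 : (0 : ℝ) < M ^ 2 + j * (j + 1) := by positivity
  have h1 : 1 - stepAngle M j * (j / M) = (M ^ 2 + j ^ 2) / (M ^ 2 + j * (j + 1)) := by
    rw [stepAngle]
    field_simp
    ring
  have h2 : (0 : ℝ) < (M ^ 2 + j ^ 2) / (M ^ 2 + j * (j + 1)) := by positivity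
  refine rotOp_mul_rotOp hA (by rw [h1]; exact h2.ne') ?_
  rw [h1, stepAngle]
  push_cast
  field_simp
  ring

/-- One step of the bound for the error of a product formula. -/
theorem hsNorm_product_formula [Nonempty ι] {A V S : Matrix ι ι ℂ} {s σ : ℝ}
    (hA : A ∈ Matrix.unitaryGroup ι ℂ) (hV : V ∈ Matrix.unitaryGroup ι ℂ) (hs : |s| ≤ 1)
    (h1 : hsNorm (V - 1) ≤ 4 * σ) (h2 : hsNorm (V - 1 - (2 * Complex.I) • S) ≤ 4 * σ ^ 2) :
    hsNorm (rotOp A s * V - 1) ≤ 4 * (|s| + σ) ∧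
    hsNorm (rotOp A s * V - 1 - (2 * Complex.I) • ((s : ℂ) • A + S)) ≤ 4 * (|s| + σ) ^ 2 := by
  have hA1 := hsNorm_unitary hA
  constructor
  · have : rotOp A s * V - 1 = (rotOp A s - 1) * V + (V - 1) := by
      rw [sub_mul, one_mul]; abel
    rw [this]
    refine (hsNorm_add_le _ _).trans ?_
    rw [hsNorm_mul_unitary hV]
    linarith [hsNorm_rotOp_sub_one_le' hA1 hs]
  -- The pieces have size 4s², 2|s| · 4σ and 4σ², which add up to exactly 4(|s| + σ)²; the constant
  -- 4 reproduces itself.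
  · have : rotOp A s * V - 1 - (2 * Complex.I) • ((s : ℂ) • A + S) =
        (rotOp A s - 1 - (2 * Complex.I * s) • A) * V + ((2 * Complex.I * s) • (A * (V - 1)) +
          (V - 1 - (2 * Complex.I) • S)) := by
      simp only [sub_mul, mul_sub, one_mul, mul_one, smul_add, smul_sub, smul_mul_assoc, smul_smul]
      abel
    rw [this]
    refine (hsNorm_add_le _ _).trans ((add_le_add_right (hsNorm_add_le _ _) _).trans ?_)
    rw [hsNorm_mul_unitary hV, hsNorm_smul, hsNorm_unitary_mul hA]
    have h3 := hsNorm_rotOp_sub_le hA1 hs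
    have h4 : ‖(2 * Complex.I * s : ℂ)‖ = 2 * |s| := by simp
    rw [h4]
    have h5 : 2 * |s| * hsNorm (V - 1) ≤ 2 * |s| * (4 * σ) := by gcongr
    have h6 : s ^ 2 = |s| ^ 2 := (sq_abs s).symm
    rw [h6] at h3
    nlinarith

end HSNorm

end

section

/-! ### Tensor products -/

section Tensor

variable {m : ℕ}

theorem tensorAll_mul (A B : Fin m → Matrix (Fin 2) (Fin 2) ℂ) :
    tensorAll A * tensorAll B = tensorAll fun q => A q * B q := by
  ext x z
  simp only [tensorAll, Matrix.mul_apply, Matrix.of_apply, ← Finset.prod_mul_distrib]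
  rw [← Fintype.prod_sum (fun i b => A i (x i) b * B i b (z i))]

theorem tensorAll_one : tensorAll (fun _ : Fin m => (1 : Matrix (Fin 2) (Fin 2) ℂ)) = 1 := by
  ext x y
  simp only [tensorAll, Matrix.of_apply, Matrix.one_apply, Finset.prod_ite_zero,
    Finset.prod_const_one, funext_iff, Finset.mem_univ, true_imp_iff]

theorem star_tensorAll (A : Fin m → Matrix (Fin 2) (Fin 2) ℂ) :
    star (tensorAll A) = tensorAll fun q => star (A q) := by
  ext x y
  simp [tensorAll, Matrix.star_apply]

theorem trace_tensorAll (A : Fin m → Matrix (Fin 2) (Fin 2) ℂ) :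
    (tensorAll A).trace = ∏ q, (A q).trace := by
  simp only [Matrix.trace, Matrix.diag_apply, tensorAll, Matrix.of_apply]
  rw [← Fintype.prod_sum fun q b => A q b b]

/-- The operator `A` on the qubit `q`. -/
def single (q : Fin m) (A : Matrix (Fin 2) (Fin 2) ℂ) : Op m :=
  tensorAll (Function.update (fun _ => 1) q A)

theorem single_apply (q : Fin m) (A : Matrix (Fin 2) (Fin 2) ℂ) (x y : Bits m) :
    single q A x y = if ∀ j, j ≠ q → x j = y j then A (x q) (y q) else 0 := by
  rw [single, tensorAll, Matrix.of_apply, ← Finset.mul_prod_erase _ _ (Finset.mem_univ q),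
    Function.update_self]
  have : ∀ j ∈ Finset.univ.erase q, Function.update (fun _ => (1 : Matrix (Fin 2) (Fin 2) ℂ)) q A j
      (x j) (y j) = if x j = y j then 1 else 0 := by
    intro j hj
    rw [Function.update_of_ne (Finset.ne_of_mem_erase hj), Matrix.one_apply]
  rw [Finset.prod_congr rfl this, Finset.prod_ite_zero]
  simp

theorem single_mul_single (q : Fin m) (A B : Matrix (Fin 2) (Fin 2) ℂ) :
    single q A * single q B = single q (A * B) := by
  rw [single, single, single, tensorAll_mul]
  congr 1
  funext j
  by_cases h : j = q
  · subst h; simp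
  · simp [h]

theorem single_one (q : Fin m) : single q 1 = 1 := by
  rw [single, Function.update_eq_self, tensorAll_one]

theorem star_single (q : Fin m) (A : Matrix (Fin 2) (Fin 2) ℂ) :
    star (single q A) = single q (star A) := by
  rw [single, single, star_tensorAll]
  congr 1
  funext j
  by_cases h : j = q
  · subst h; simp
  · simp [h]

theorem single_neg (q : Fin m) (A : Matrix (Fin 2) (Fin 2) ℂ) : single q (-A) = -single q A := by
  ext x y
  simp only [single_apply, Matrix.neg_apply]
  split <;> simp

variable {n : ℕ}

theorem tensorPair_mul (A B A' B' : Op n) :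
    tensorPair A B * tensorPair A' B' = tensorPair (A * A') (B * B') := by
  have h : ∀ A B : Op n, tensorPair A B = (Matrix.kroneckerMap (· * ·) A B).submatrix
    (Fin.appendEquiv (α := Fin 2) n n).symm (Fin.appendEquiv (α := Fin 2) n n).symm := fun _ _ => rfl
  rw [h, h, h, Matrix.submatrix_mul_equiv, Matrix.mul_kronecker_mul]

theorem tensorPair_one_one : tensorPair (1 : Op n) 1 = 1 := by
  have h : tensorPair (1 : Op n) 1 = (Matrix.kroneckerMap (· * ·) (1 : Op n) (1 : Op n)).submatrix
    (Fin.appendEquiv (α := Fin 2) n n).symm (Fin.appendEquiv (α := Fin 2) n n).symm := rfl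
  rw [h, Matrix.one_kronecker_one, Matrix.submatrix_one_equiv]

theorem star_tensorPair (A B : Op n) : star (tensorPair A B) = tensorPair (star A) (star B) := by
  ext x y
  simp [tensorPair, Matrix.star_apply]

theorem tensorPair_add_left (A A' B : Op n) :
    tensorPair (A + A') B = tensorPair A B + tensorPair A' B := by
  ext x y
  simp [tensorPair, add_mul]

theorem tensorPair_sub_left (A A' B : Op n) :
    tensorPair (A - A') B = tensorPair A B - tensorPair A' B := by
  ext x y
  simp [tensorPair, sub_mul]

theorem tensorPair_smul_left (c : ℂ) (A B : Op n) :
    tensorPair (c • A) B = c • tensorPair A B := by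
  ext x y
  simp [tensorPair, mul_assoc]

theorem tensorPair_neg_right (A B : Op n) : tensorPair A (-B) = -tensorPair A B := by
  ext x y
  simp [tensorPair]

/-- The unitary factor can be split off, and the trace over the second register is cancelled by the
normalization. -/
theorem hsNorm_tensorPair_unitary (A : Op n) {B : Op n} (hB : B ∈ Matrix.unitaryGroup (Bits n) ℂ) :
    hsNorm (tensorPair A B) = hsNorm A := by
  have h1 : tensorPair A B = tensorPair A 1 * tensorPair 1 B := by
    rw [tensorPair_mul, mul_one, one_mul]
  have h2 : tensorPair 1 B ∈ Matrix.unitaryGroup (Bits (n + n)) ℂ :=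
    tensorPair_mem 1 ⟨B, hB⟩
  rw [h1, hsNorm_mul_unitary h2, ← sq_eq_sq₀ (hsNorm_nonneg _) (hsNorm_nonneg _), hsNorm_sq_eq_trace,
    hsNorm_sq_eq_trace, star_tensorPair, tensorPair_mul, star_one, mul_one]
  have h3 : (tensorPair (star A * A) 1).trace = (star A * A).trace * (2 ^ n : ℕ) := by
    have : tensorPair (star A * A) 1 = (Matrix.kroneckerMap (· * ·) (star A * A) (1 : Op n)).submatrix
      (Fin.appendEquiv (α := Fin 2) n n).symm (Fin.appendEquiv (α := Fin 2) n n).symm := rfl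
    have h4 : ((1 : Op n)).trace = (2 ^ n : ℕ) := by rw [Matrix.trace_one]; simp
    rw [this, ← h4, ← Matrix.trace_kronecker]
    exact Equiv.sum_comp (Fin.appendEquiv (α := Fin 2) n n).symm
      fun k => Matrix.kroneckerMap (· * ·) (star A * A) (1 : Op n) k k
  rw [h3, ← Complex.ofReal_natCast, Complex.re_mul_ofReal]
  simp only [Fintype.card_pi, Fintype.card_fin, Finset.prod_const, Finset.card_univ, pow_add]
  push_cast
  field_simp

end Tensor

/-! ### Pauli operators -/

theorem pauli_mul_self (c : Fin 4) : pauli c * pauli c = 1 := by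
  ext r s
  fin_cases c <;> fin_cases r <;> fin_cases s <;>
    simp [pauli, pauliG, Matrix.mul_apply, GaussianInt.toComplex_def]

theorem star_pauli (c : Fin 4) : star (pauli c) = pauli c := by
  ext r s
  fin_cases c <;> fin_cases r <;> fin_cases s <;>
    simp [pauli, pauliG, Matrix.star_apply, GaussianInt.toComplex_def]

theorem pauli_zero : pauli 0 = 1 := by
  ext r s
  fin_cases r <;> fin_cases s <;> simp [pauli, pauliG]

theorem trace_pauli_mul (a b : Fin 4) : (pauli a * pauli b).trace = if a = b then 2 else 0 := by
  fin_cases a <;> fin_cases b <;>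
    simp [pauli, pauliG, Matrix.trace, Matrix.mul_apply, GaussianInt.toComplex_def] <;> norm_num

/-- This anticommutation makes conjugation by the controlled gates attach the Pauli string to `P`.
-/
theorem pauli_mate (P : Axis) : pauli P.mate * pauli P.index = -(pauli P.index * pauli P.mate) := by
  ext r s
  cases P <;> fin_cases r <;> fin_cases s <;>
    simp [pauli, pauliG, Axis.mate, Axis.index, Matrix.mul_apply, GaussianInt.toComplex_def]

variable {n : ℕ}

/-- A tensor product of Pauli operators. -/
def pauliString (Q : Fin n → Fin 4) : Op n := tensorAll fun q => pauli (Q q)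

theorem pauliString_mul_self (Q : Fin n → Fin 4) : pauliString Q * pauliString Q = 1 := by
  rw [pauliString, tensorAll_mul]
  simp only [pauli_mul_self, tensorAll_one]

theorem star_pauliString (Q : Fin n → Fin 4) : star (pauliString Q) = pauliString Q := by
  rw [pauliString, star_tensorAll]
  simp only [star_pauli]

theorem pauliString_mem (Q : Fin n → Fin 4) : pauliString Q ∈ Matrix.unitaryGroup (Bits n) ℂ := by
  rw [Matrix.mem_unitaryGroup_iff, star_pauliString, pauliString_mul_self]

theorem trace_pauliString_mul (Q Q' : Fin n → Fin 4) :
    (star (pauliString Q) * pauliString Q').trace =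
      if Q = Q' then (Fintype.card (Bits n) : ℂ) else 0 := by
  rw [star_pauliString, pauliString, pauliString, tensorAll_mul, trace_tensorAll]
  simp only [trace_pauli_mul, Finset.prod_ite_zero, funext_iff, Finset.mem_univ, true_imp_iff]
  simp

theorem single_pauli_mul_self (q : Fin n) (c : Fin 4) :
    single q (pauli c) * single q (pauli c) = 1 := by
  rw [single_mul_single, pauli_mul_self, single_one]

theorem single_pauli_mem (q : Fin n) (c : Fin 4) :
    single q (pauli c) ∈ Matrix.unitaryGroup (Bits n) ℂ := by
  rw [Matrix.mem_unitaryGroup_iff, star_single, star_pauli, single_pauli_mul_self]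

/-! ### The operators of the printed gates -/

open Classical in
theorem onWires_pairWire_apply (q i : Fin n) (M : Matrix (Fin (2 ^ 2)) (Fin (2 ^ 2)) ℂ)
    (x y : Bits (n + n)) : onWires (pairWire q i) M x y =
      if (∀ j, j ≠ q → x (Fin.castAdd n j) = y (Fin.castAdd n j)) ∧
        ∀ j, j ≠ i → x (Fin.natAdd n j) = y (Fin.natAdd n j) then
      M (finFunctionFinEquiv ![x (Fin.castAdd n q), x (Fin.natAdd n i)])
        (finFunctionFinEquiv ![y (Fin.castAdd n q), y (Fin.natAdd n i)]) else 0 := by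
  have hw : ∀ z : Bits (n + n), (fun j => z (pairWire q i j)) =
      ![z (Fin.castAdd n q), z (Fin.natAdd n i)] := by
    intro z
    funext j
    fin_cases j <;> rfl
  rw [onWires, Matrix.of_apply, hw, hw]
  refine if_congr ?_ rfl rfl
  have hr : ∀ j, j ∈ Set.range (pairWire q i) ↔ j = Fin.castAdd n q ∨ j = Fin.natAdd n i := by
    intro j
    constructor
    · rintro ⟨k, rfl⟩
      fin_cases k
      · exact Or.inl rfl
      · exact Or.inr rfl
    · rintro (rfl | rfl)
      · exact ⟨0, rfl⟩
      · exact ⟨1, rfl⟩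
  simp only [hr]
  constructor
  · refine fun h => ⟨fun j hj => h _ ?_, fun j hj => h _ ?_⟩
    · rintro (h | h)
      · exact hj (Fin.castAdd_injective _ _ h)
      · have := congrArg Fin.val h
        simp at this
        omega
    · rintro (h | h)
      · have := congrArg Fin.val h
        simp at this
        omega
      · exact hj (Fin.natAdd_injective _ _ h)
  · rintro ⟨h, h'⟩ j
    refine Fin.addCases (fun j => ?_) (fun j => ?_) j
    · exact fun hj => h j fun e => hj (Or.inl (by rw [e]))
    · exact fun hj => h' j fun e => hj (Or.inr (by rw [e]))

theorem tensorPair_single_apply (q i : Fin n) (A B : Matrix (Fin 2) (Fin 2) ℂ)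
    (x y : Bits (n + n)) : tensorPair (single q A) (single i B) x y =
      if (∀ j, j ≠ q → x (Fin.castAdd n j) = y (Fin.castAdd n j)) ∧
        ∀ j, j ≠ i → x (Fin.natAdd n j) = y (Fin.natAdd n j) then
      A (x (Fin.castAdd n q)) (y (Fin.castAdd n q)) * B (x (Fin.natAdd n i)) (y (Fin.natAdd n i))
      else 0 := by
  rw [tensorPair, Matrix.of_apply, single_apply, single_apply, ite_and]
  split_ifs <;> simp

theorem labelBit_finFunctionFinEquiv {k : ℕ} (f : Fin k → Fin 2) (j : Fin k) :
    labelBit (finFunctionFinEquiv f) j = f j := by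
  rw [labelBit, Equiv.symm_apply_apply]

/-- The gate is symmetric in its two qubits. Written with the spectral projections of `τ`, it
applies `σ` on the -1 part of `τ`, so gates with a common target `τ` multiply by multiplying their
`σ`. -/
theorem ctrlGate_unitary (q i : Fin n) (σ τ : Fin 4) : ((ctrlGate q i σ τ).unitary : Op (n + n)) =
    (1 / 2 : ℂ) • (1 + tensorPair 1 (single i (pauli τ))) +
      tensorPair (single q (pauli σ)) 1 *
        ((1 / 2 : ℂ) • (1 - tensorPair 1 (single i (pauli τ)))) := by
  have h1 : (1 : Op (n + n)) = tensorPair (single q (pauli 0)) (single i (pauli 0)) := by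
    rw [pauli_zero, single_one, single_one, tensorPair_one_one]
  have h2 : tensorPair 1 (single i (pauli τ)) = tensorPair (single q (pauli 0))
    (single i (pauli τ)) := by rw [pauli_zero, single_one]
  have h3 : tensorPair (single q (pauli σ)) 1 = tensorPair (single q (pauli σ))
    (single i (pauli 0)) := by rw [pauli_zero, single_one]
  rw [mul_smul_comm, mul_sub, mul_one, tensorPair_mul, mul_one, one_mul, h2, h3, h1]
  ext x y
  change onWires (pairWire q i) (ratMatrix (2 ^ 2) 2 (fun r c => (ctrlEntry σ τ r c).re)
    fun r c => (ctrlEntry σ τ r c).im) x y = _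
  rw [ratMatrix_eq, onWires_pairWire_apply]
  simp only [Matrix.add_apply, Matrix.sub_apply, Matrix.smul_apply, smul_eq_mul,
    tensorPair_single_apply, Matrix.of_apply]
  split_ifs
  · simp only [ctrlEntry, labelBit_finFunctionFinEquiv, map_add, map_sub, map_mul, pauli,
      Matrix.of_apply]
    simp
    ring
  · simp

/-- The expansion 2 · SWAP = ∑ P ⊗ P, checked on Gaussian integers. -/
theorem two_mul_swapEntry : ∀ r c, 2 * swapEntry r c =
    ∑ a, pauliG a (labelBit r 0) (labelBit c 0) * pauliG a (labelBit r 1) (labelBit c 1) := by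
  decide +kernel

theorem swapGate_unitary (q : Fin n) : ((swapGate q).unitary : Op (n + n)) =
    (1 / 2 : ℂ) • ∑ c, tensorPair (single q (pauli c)) (single q (pauli c)) := by
  ext x y
  change onWires (pairWire q q) (ratMatrix (2 ^ 2) 1 (fun r c => (swapEntry r c).re)
    fun r c => (swapEntry r c).im) x y = _
  rw [ratMatrix_eq, onWires_pairWire_apply]
  simp only [Matrix.sum_apply, Matrix.smul_apply, smul_eq_mul, tensorPair_single_apply,
    Matrix.of_apply]
  split_ifs
  · have h := congrArg GaussianInt.toComplex (two_mul_swapEntry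
      (finFunctionFinEquiv ![x (Fin.castAdd n q), x (Fin.natAdd n q)])
      (finFunctionFinEquiv ![y (Fin.castAdd n q), y (Fin.natAdd n q)]))
    simp only [map_sum, map_mul, map_ofNat, labelBit_finFunctionFinEquiv] at h
    simp only [pauli, Matrix.of_apply]
    simp only [Matrix.cons_val_zero, Matrix.cons_val_one] at h
    rw [← h]
    simp
  · simp

open Classical in
theorem onWires_natAdd_apply (i : Fin n) (w : Fin 1 ↪ Fin (n + n)) (hw : w 0 = Fin.natAdd n i)
    (M : Matrix (Fin (2 ^ 1)) (Fin (2 ^ 1)) ℂ) (x y : Bits (n + n)) : onWires w M x y =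
      if (∀ j, x (Fin.castAdd n j) = y (Fin.castAdd n j)) ∧
        ∀ j, j ≠ i → x (Fin.natAdd n j) = y (Fin.natAdd n j) then
      M (finFunctionFinEquiv ![x (Fin.natAdd n i)]) (finFunctionFinEquiv ![y (Fin.natAdd n i)])
      else 0 := by
  have hz : ∀ z : Bits (n + n), (fun j => z (w j)) = ![z (Fin.natAdd n i)] := by
    intro z
    funext j
    rw [Subsingleton.elim j 0, hw]
    rfl
  rw [onWires, Matrix.of_apply, hz, hz]
  refine if_congr ?_ rfl rfl
  have hr : ∀ j, j ∈ Set.range w ↔ j = Fin.natAdd n i := by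
    intro j
    rw [← hw]
    exact ⟨fun ⟨k, hk⟩ => by rw [← hk, Subsingleton.elim k 0], fun h => ⟨0, h.symm⟩⟩
  simp only [hr]
  constructor
  · refine fun h => ⟨fun j => h _ ?_, fun j hj => h _ fun e => hj (Fin.natAdd_injective _ _ e)⟩
    intro h
    have := congrArg Fin.val h
    simp at this
    omega
  · rintro ⟨h, h'⟩ j
    refine Fin.addCases (fun j => ?_) (fun j => ?_) j
    · exact fun _ => h j
    · exact fun hj => h' j fun e => hj (by rw [e])

theorem tensorPair_one_single_apply (i : Fin n) (B : Matrix (Fin 2) (Fin 2) ℂ)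
    (x y : Bits (n + n)) : tensorPair 1 (single i B) x y =
      if (∀ j, x (Fin.castAdd n j) = y (Fin.castAdd n j)) ∧
        ∀ j, j ≠ i → x (Fin.natAdd n j) = y (Fin.natAdd n j) then
      B (x (Fin.natAdd n i)) (y (Fin.natAdd n i)) else 0 := by
  rw [tensorPair, Matrix.of_apply, single_apply, Matrix.one_apply, ite_and]
  simp only [funext_iff]
  split_ifs <;> simp

theorem rotGate_unitary (i : Fin n) (P : Axis) (num : ℤ) (den : ℕ) (h : den ≠ 0) :
    ((rotGate i P num den h).unitary : Op (n + n)) =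
      rotOp (tensorPair 1 (single i (pauli P.index))) (num / den) := by
  have h1 : (1 : Op (n + n)) = tensorPair 1 (single i (pauli 0)) := by
    rw [pauli_zero, single_one, tensorPair_one_one]
  rw [rotOp, h1]
  ext x y
  let w : Fin 1 ↪ Fin (n + n) := ⟨fun _ => Fin.natAdd n i, fun _ _ _ => Subsingleton.elim _ _⟩
  change onWires w (ratMatrix (2 ^ 1) (den * den + num.natAbs * num.natAbs)
    (fun r c => (rotEntry P num den r c).re) fun r c => (rotEntry P num den r c).im) x y = _
  rw [ratMatrix_eq, onWires_natAdd_apply i w rfl]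
  simp only [Matrix.add_apply, Matrix.smul_apply, smul_eq_mul, tensorPair_one_single_apply]
  split_ifs
  · have hden : ((den : ℂ)) ≠ 0 := by exact_mod_cast h
    have hsum : ((den : ℂ) ^ 2 + (num : ℂ) ^ 2) ≠ 0 := by
      have : ((den : ℝ) ^ 2 + (num : ℝ) ^ 2) ≠ 0 := by positivity
      exact_mod_cast this
    have habs : ((num.natAbs : ℕ) : ℂ) * ((num.natAbs : ℕ) : ℂ) = (num : ℂ) * num := by
      rw [← Int.cast_natCast (R := ℂ), ← Int.cast_mul, Int.natAbs_mul_self', Int.cast_mul]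
    have hI : GaussianInt.toComplex (⟨0, 1⟩ : GaussianInt) = Complex.I := by
      simp [GaussianInt.toComplex_def]
    have hp : ∀ a b : Fin 2, GaussianInt.toComplex (pauliG 0 a b) = if a = b then 1 else 0 := by
      intro a b
      simp only [pauliG, Matrix.cons_val_zero]
      split <;> simp
    simp only [Matrix.of_apply, rotEntry, labelBit_finFunctionFinEquiv, map_add, map_mul, map_intCast,
      pauli, hI, hp, Matrix.cons_val_zero, EmbeddingLike.apply_eq_iff_eq]
    push_cast
    rw [habs]
    have hif : GaussianInt.toComplex
        (if ![x (Fin.natAdd n i)] = ![y (Fin.natAdd n i)] then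
          (den : GaussianInt) * den - num * num else 0) =
        ((den : ℂ) * den - num * num) *
          (if x (Fin.natAdd n i) = y (Fin.natAdd n i) then 1 else 0) := by
      by_cases hxy : x (Fin.natAdd n i) = y (Fin.natAdd n i)
      · rw [if_pos (by rw [hxy]), if_pos hxy]
        simp
      · rw [if_neg (by simpa using hxy), if_neg hxy]
        simp
    rw [hif, ← pow_two, ← pow_two]
    have h3 : (1 + (num / den : ℂ) ^ 2) = ((den : ℂ) ^ 2 + (num : ℂ) ^ 2) / den ^ 2 := by
      field_simp
    rw [h3]
    field_simp
  · simp

end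

section

/-! ### The operators of the printed circuits -/

theorem circuitUnitary_append {m : ℕ} (gs gs' : List (MatrixGate m)) :
    circuitUnitary (gs ++ gs') = circuitUnitary gs' * circuitUnitary gs := by
  induction gs with
  | nil => simp [circuitUnitary]
  | cons g gs ih => rw [List.cons_append, circuitUnitary, ih, circuitUnitary, mul_assoc]

theorem ctrl_mul_ctrl {R : Type} [Ring R] {e f A B : R} (he : e * e = e) (hf : f * f = f)
    (hef : e * f = 0) (hfe : f * e = 0) (hAf : Commute B f) (hBe : Commute B e) :
    (e + A * f) * (e + B * f) = e + A * B * f := by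
  have h1 : e * (B * f) = 0 := by rw [← mul_assoc, ← hBe.eq, mul_assoc, hef, mul_zero]
  have h2 : A * f * e = 0 := by rw [mul_assoc, hfe, mul_zero]
  have h3 : A * f * (B * f) = A * B * f := by
    rw [mul_assoc, ← mul_assoc f, ← hAf.eq, mul_assoc B, hf, mul_assoc]
  rw [add_mul, mul_add, mul_add, he, h1, h2, h3, add_zero, zero_add]

theorem half_projections {ι : Type} [Fintype ι] [DecidableEq ι] {T : Matrix ι ι ℂ} (hT : T * T = 1) :
    ((1 / 2 : ℂ) • (1 + T)) * ((1 / 2 : ℂ) • (1 + T)) = (1 / 2 : ℂ) • (1 + T) ∧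
    ((1 / 2 : ℂ) • (1 - T)) * ((1 / 2 : ℂ) • (1 - T)) = (1 / 2 : ℂ) • (1 - T) ∧
    ((1 / 2 : ℂ) • (1 + T)) * ((1 / 2 : ℂ) • (1 - T)) = 0 ∧
    ((1 / 2 : ℂ) • (1 - T)) * ((1 / 2 : ℂ) • (1 + T)) = 0 ∧
    (1 / 2 : ℂ) • (1 + T) + (1 / 2 : ℂ) • (1 - T) = 1 := by
  refine ⟨?_, ?_, ?_, ?_, ?_⟩ <;> try rw [smul_mul_smul_comm]
  all_goals
    try simp only [add_mul, mul_add, sub_mul, mul_sub, one_mul, mul_one, hT]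
    ext a b
    simp only [Matrix.add_apply, Matrix.sub_apply, Matrix.smul_apply, smul_eq_mul, Matrix.zero_apply]
    ring

variable {n : ℕ}

theorem commute_tensorPair (A B : Op n) : Commute (tensorPair A 1) (tensorPair 1 B) := by
  rw [Commute, SemiconjBy, tensorPair_mul, tensorPair_mul, mul_one, one_mul, mul_one, one_mul]

theorem tensorPair_single_mul_self (i : Fin n) (c : Fin 4) :
    tensorPair 1 (single i (pauli c)) * tensorPair 1 (single i (pauli c)) = 1 := by
  rw [tensorPair_mul, single_pauli_mul_self, one_mul, tensorPair_one_one]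

/-- Stated for lists without repetition, because the induction needs each qubit to receive its
letter only once. -/
theorem circuitUnitary_ctrlGates (i : Fin n) (Q : Fin n → Fin 4) (τ : Fin 4) (l : List (Fin n))
    (hl : l.Nodup) : (circuitUnitary (l.map fun q => ctrlGate q i (Q q) τ) : Op (n + n)) =
      (1 / 2 : ℂ) • (1 + tensorPair 1 (single i (pauli τ))) +
        tensorPair (tensorAll fun q => if q ∈ l then pauli (Q q) else 1) 1 *
          ((1 / 2 : ℂ) • (1 - tensorPair 1 (single i (pauli τ)))) := by
  obtain ⟨he, hf, hef, hfe, hsum⟩ := half_projections (tensorPair_single_mul_self i τ)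
  induction l with
  | nil =>
    simp only [List.map_nil, circuitUnitary, List.not_mem_nil, if_false, tensorAll_one,
      tensorPair_one_one, one_mul]
    exact hsum.symm
  | cons q l ih =>
    have hs : single q (pauli (Q q)) = tensorAll (Function.update (fun _ => 1) q (pauli (Q q))) := rfl
    rw [List.map_cons, circuitUnitary, Submonoid.coe_mul, ih hl.of_cons, ctrlGate_unitary,
      ctrl_mul_ctrl he hf hef hfe, tensorPair_mul, one_mul, hs, tensorAll_mul]
    · congr 4
      funext j
      by_cases h : j = q
      · subst h
        simp [(List.nodup_cons.1 hl).1]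
      · simp [h]
    · exact (((Commute.one_right _).sub_right (commute_tensorPair _ _)).smul_right _)
    · exact (((Commute.one_right _).add_right (commute_tensorPair _ _)).smul_right _)

theorem circuitUnitary_ofFn_ctrlGate (i : Fin n) (Q : Fin n → Fin 4) (τ : Fin 4) :
    (circuitUnitary (List.ofFn fun q => ctrlGate q i (Q q) τ) : Op (n + n)) =
      (1 / 2 : ℂ) • (1 + tensorPair 1 (single i (pauli τ))) + tensorPair (pauliString Q) 1 *
        ((1 / 2 : ℂ) • (1 - tensorPair 1 (single i (pauli τ)))) := by
  rw [List.ofFn_eq_map, circuitUnitary_ctrlGates _ _ _ _ (List.nodup_finRange n)]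
  simp only [List.mem_finRange, if_true]
  rfl

/-- The product of the Pauli string `Q` on the first register and the axis `P` on the qubit `i` of the
second register. -/
def termOp (i : Fin n) (P : Axis) (Q : Fin n → Fin 4) : Op (n + n) :=
  tensorPair (pauliString Q) (single i (pauli P.index))

theorem termOp_mem (i : Fin n) (P : Axis) (Q : Fin n → Fin 4) :
    termOp i P Q ∈ Matrix.unitaryGroup (Bits (n + n)) ℂ :=
  tensorPair_mem ⟨_, pauliString_mem Q⟩ ⟨_, single_pauli_mem i P.index⟩

/-- Let G = e + Af be the row of controlled gates. The rotation axis B anticommutes with T and hence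
exchanges the projections e and f, which gives G² = 1 and GBG = AB. Conjugation by G turns the
rotation about B into the one about AB = Q ⊗ P. -/
theorem termGates_unitary (i : Fin n) (P : Axis) (Q : Fin n → Fin 4) (num : ℤ) (den : ℕ)
    (h : den ≠ 0) : (circuitUnitary (termGates i P Q num den h) : Op (n + n)) =
      rotOp (termOp i P Q) (num / den) := by
  rw [termGates, circuitUnitary_append, circuitUnitary, Submonoid.coe_mul, Submonoid.coe_mul,
    circuitUnitary_ofFn_ctrlGate, rotGate_unitary]
  obtain ⟨he, hf, hef, hfe, hsum⟩ := half_projections (tensorPair_single_mul_self i P.mate)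
  set T := tensorPair (1 : Op n) (single i (pauli P.mate)) with hT
  set e := (1 / 2 : ℂ) • (1 + T) with he'
  set f := (1 / 2 : ℂ) • (1 - T) with hf'
  set A := tensorPair (pauliString Q) (1 : Op n) with hA
  set B := tensorPair (1 : Op n) (single i (pauli P.index)) with hB
  have hAA : A * A = 1 := by
    rw [hA, tensorPair_mul, pauliString_mul_self, one_mul, tensorPair_one_one]
  have hAe : Commute A e := ((Commute.one_right _).add_right (commute_tensorPair _ _)).smul_right _
  have hAf : Commute A f := ((Commute.one_right _).sub_right (commute_tensorPair _ _)).smul_right _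
  have hTB : T * B = -(B * T) := by
    rw [hT, hB, tensorPair_mul, tensorPair_mul, single_mul_single, single_mul_single, pauli_mate,
      single_neg, tensorPair_neg_right]
  have hBe : B * e = f * B := by
    rw [he', hf', mul_smul_comm, smul_mul_assoc, mul_add, sub_mul, hTB, mul_one, one_mul,
      sub_neg_eq_add]
  have hBf : B * f = e * B := by
    rw [he', hf', mul_smul_comm, smul_mul_assoc, mul_sub, add_mul, hTB, mul_one, one_mul,
      sub_eq_add_neg]
  have hGG : (e + A * f) * (e + A * f) = 1 := by
    rw [ctrl_mul_ctrl he hf hef hfe hAf hAe, hAA, one_mul, hsum]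
  have hGBG : (e + A * f) * (B * (e + A * f)) = A * B := by
    have h1 : B * (e + A * f) = (f + A * e) * B := by
      rw [mul_add, add_mul, hBe, ← mul_assoc, ← (commute_tensorPair _ _).eq, mul_assoc, hBf,
        mul_assoc]
    have h2 : (e + A * f) * (f + A * e) = A * (e + f) := by
      have h3 : e * (A * e) = A * e := by rw [← mul_assoc, ← hAe.eq, mul_assoc, he]
      have h4 : A * f * (A * e) = 0 := by
        rw [mul_assoc, ← mul_assoc f, ← hAf.eq, mul_assoc A, hfe, mul_zero, mul_zero]
      rw [add_mul, mul_add, mul_add, hef, h3, mul_assoc A f f, hf, h4, zero_add, add_zero, mul_add]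
    rw [h1, ← mul_assoc, h2, hsum, mul_one]
  have hAB : termOp i P Q = A * B := by
    rw [termOp, hA, hB, tensorPair_mul, mul_one, one_mul]
  generalize e + A * f = G at hGG hGBG ⊢
  rw [hAB, rotOp, rotOp, mul_assoc, smul_mul_assoc, mul_smul_comm, add_mul, mul_add]
  rw [smul_mul_assoc, mul_smul_comm, one_mul, hGG, smul_mul_assoc, mul_smul_comm, hGBG]

/-- The two registers of a basis label exchanged in those qubits for which `p` holds. -/
def exchange (p : Fin n → Prop) [DecidablePred p] (x : Bits (n + n)) : Bits (n + n) :=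
  Fin.append (fun j => if p j then x (Fin.natAdd n j) else x (Fin.castAdd n j))
    fun j => if p j then x (Fin.castAdd n j) else x (Fin.natAdd n j)

theorem swapGate_apply (q : Fin n) (x y : Bits (n + n)) :
    ((swapGate q).unitary : Op (n + n)) x y = if y = exchange (fun j => j = q) x then 1 else 0 := by
  change onWires (pairWire q q) (ratMatrix (2 ^ 2) 1 (fun r c => (swapEntry r c).re)
    fun r c => (swapEntry r c).im) x y = _
  rw [ratMatrix_eq, onWires_pairWire_apply]
  simp only [Matrix.of_apply, swapEntry, labelBit_finFunctionFinEquiv, Matrix.cons_val_zero,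
    Matrix.cons_val_one]
  have key : y = exchange (fun j => j = q) x ↔ ((∀ j, j ≠ q → x (Fin.castAdd n j) = y (Fin.castAdd n j)) ∧
      ∀ j, j ≠ q → x (Fin.natAdd n j) = y (Fin.natAdd n j)) ∧
      (x (Fin.castAdd n q) = y (Fin.natAdd n q) ∧ x (Fin.natAdd n q) = y (Fin.castAdd n q)) := by
    constructor
    · rintro rfl
      refine ⟨⟨fun j hj => ?_, fun j hj => ?_⟩, ?_, ?_⟩ <;> simp [exchange, -Fin.natAdd_eq_addNat]
      · simp [hj]
      · simp [hj]
    · rintro ⟨⟨h1, h2⟩, h3, h4⟩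
      funext j
      refine Fin.addCases (fun j => ?_) (fun j => ?_) j
      · by_cases hj : j = q
        · subst hj; simp [exchange, h4, -Fin.natAdd_eq_addNat]
        · simp [exchange, hj, h1 j hj]
      · by_cases hj : j = q
        · subst hj; simp [exchange, h3, -Fin.natAdd_eq_addNat]
        · simp [exchange, hj, h2 j hj, -Fin.natAdd_eq_addNat]
  rw [if_congr key rfl rfl]
  split_ifs <;> first | (exfalso; tauto) | simp

theorem circuitUnitary_swapGates (l : List (Fin n)) (hl : l.Nodup) (x y : Bits (n + n)) :
    (circuitUnitary (l.map swapGate) : Op (n + n)) x y =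
      if y = exchange (fun j => j ∈ l) x then 1 else 0 := by
  induction l generalizing x y with
  | nil =>
    simp only [List.map_nil, circuitUnitary, Submonoid.coe_one, Matrix.one_apply]
    refine if_congr ?_ rfl rfl
    have : exchange (fun j : Fin n => j ∈ ([] : List (Fin n))) x = x := by
      funext j
      refine Fin.addCases (fun j => ?_) (fun j => ?_) j <;> simp [exchange, -Fin.natAdd_eq_addNat]
    rw [this, eq_comm]
  | cons q l ih =>
    rw [List.map_cons, circuitUnitary, Submonoid.coe_mul, Matrix.mul_apply]
    simp only [ih hl.of_cons, swapGate_apply, ite_mul, one_mul, zero_mul, Finset.sum_ite_eq',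
      Finset.mem_univ, if_true]
    have hq := (List.nodup_cons.1 hl).1
    have : exchange (fun j => j = q) (exchange (fun j => j ∈ l) x) =
        exchange (fun j => j ∈ q :: l) x := by
      funext j
      refine Fin.addCases (fun j => ?_) (fun j => ?_) j <;> by_cases hj : j = q <;>
        simp [exchange, hj, hq, -Fin.natAdd_eq_addNat]
    rw [this]

/-- The exchange of the two registers. -/
def swapOp (n : ℕ) : Op (n + n) := circuitUnitary (List.ofFn fun q : Fin n => swapGate q)

theorem swapOp_apply (x y : Bits (n + n)) :
    swapOp n x y = if y = exchange (fun _ => True) x then 1 else 0 := by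
  rw [swapOp, List.ofFn_eq_map, circuitUnitary_swapGates _ (List.nodup_finRange n)]
  have : exchange (fun j => j ∈ List.finRange n) x = exchange (fun _ => True) x := by
    funext j
    refine Fin.addCases (fun j => ?_) (fun j => ?_) j <;> simp [exchange, -Fin.natAdd_eq_addNat]
  rw [this]

theorem exchange_exchange (x : Bits (n + n)) :
    exchange (fun _ => True) (exchange (fun _ => True) x) = x := by
  funext j
  refine Fin.addCases (fun j => ?_) (fun j => ?_) j <;> simp [exchange, -Fin.natAdd_eq_addNat]

theorem swapOp_mul_self : swapOp n * swapOp n = 1 := by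
  ext x y
  rw [Matrix.mul_apply]
  simp only [swapOp_apply, ite_mul, one_mul, zero_mul, Finset.sum_ite_eq', Finset.mem_univ, if_true,
    exchange_exchange, Matrix.one_apply]
  exact if_congr eq_comm rfl rfl

theorem swapOp_mul_tensorPair (A B : Op n) :
    swapOp n * tensorPair A B = tensorPair B A * swapOp n := by
  ext x y
  rw [Matrix.mul_apply, Matrix.mul_apply]
  have h : ∀ z, (y = exchange (fun _ => True) z) ↔ z = exchange (fun _ => True) y := by
    intro z
    constructor <;> rintro rfl <;> rw [exchange_exchange]
  simp only [swapOp_apply, ite_mul, one_mul, zero_mul, Finset.sum_ite_eq', Finset.mem_univ, if_true,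
    h, mul_ite, mul_one, mul_zero]
  simp [tensorPair, exchange, mul_comm, -Fin.natAdd_eq_addNat]

/-- Conjugation by SWAP moves C† from the first register to the second. -/
theorem sewing (C : UnitaryOp n) : tensorPair (C : Op n) 1 * swapOp n *
    tensorPair (star (C : Op n)) 1 * swapOp n = tensorPair (C : Op n) (star (C : Op n)) := by
  rw [mul_assoc _ (swapOp n), swapOp_mul_tensorPair, mul_assoc, mul_assoc, swapOp_mul_self, mul_one,
    tensorPair_mul, mul_one, one_mul]

/-- The exchange of the two qubits `i` conjugated by `C` on the first register. -/
def sewOp (C : UnitaryOp n) (i : Fin n) : Op (n + n) :=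
  tensorPair (C : Op n) 1 * ((swapGate i).unitary : Op (n + n)) * tensorPair (star (C : Op n)) 1

theorem star_swapGate (i : Fin n) :
    star ((swapGate i).unitary : Op (n + n)) = ((swapGate i).unitary : Op (n + n)) := by
  rw [swapGate_unitary, star_smul, star_sum]
  simp only [star_tensorPair, star_single, star_pauli]
  simp

theorem swapGate_mul_self (i : Fin n) :
    ((swapGate i).unitary : Op (n + n)) * ((swapGate i).unitary : Op (n + n)) = 1 := by
  have := Matrix.mem_unitaryGroup_iff.1 (swapGate i).unitary.2
  rwa [star_swapGate] at this

theorem sewOp_mul_sewOp_aux (C : UnitaryOp n) :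
    tensorPair (star (C : Op n)) 1 * tensorPair (C : Op n) 1 = 1 := by
  rw [tensorPair_mul, one_mul, Matrix.mem_unitaryGroup_iff'.1 C.2, tensorPair_one_one]

theorem sewOp_mul_self (C : UnitaryOp n) (i : Fin n) : sewOp C i * sewOp C i = 1 := by
  have h := sewOp_mul_sewOp_aux C
  calc sewOp C i * sewOp C i = tensorPair (C : Op n) 1 * (((swapGate i).unitary : Op (n + n)) *
        (tensorPair (star (C : Op n)) 1 * tensorPair (C : Op n) 1) *
        ((swapGate i).unitary : Op (n + n))) * tensorPair (star (C : Op n)) 1 := by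
        simp only [sewOp, mul_assoc]
    _ = 1 := by
      rw [h, mul_one, swapGate_mul_self, mul_one, tensorPair_mul, one_mul,
        Matrix.mem_unitaryGroup_iff.1 C.2, tensorPair_one_one]

theorem star_sewOp (C : UnitaryOp n) (i : Fin n) : star (sewOp C i) = sewOp C i := by
  simp only [sewOp, star_mul, star_tensorPair, star_one, star_star, star_swapGate, mul_assoc]

theorem sewOp_mem (C : UnitaryOp n) (i : Fin n) :
    sewOp C i ∈ Matrix.unitaryGroup (Bits (n + n)) ℂ := by
  rw [Matrix.mem_unitaryGroup_iff, star_sewOp, sewOp_mul_self]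

/-- The Heisenberg picture of the Pauli operator `c` on the qubit `i`. -/
def heisenberg (C : UnitaryOp n) (i : Fin n) (c : Fin 4) : Op n :=
  (C : Op n) * single i (pauli c) * star (C : Op n)

theorem heisenberg_zero (C : UnitaryOp n) (i : Fin n) : heisenberg C i 0 = 1 := by
  rw [heisenberg, pauli_zero, single_one, mul_one, Matrix.mem_unitaryGroup_iff.1 C.2]

/-- Conjugation by `C` acts only on the first factors of SWAP = ½ ∑ P ⊗ P. Everything unknown thus
sits in the Heisenberg operators of single qubits. -/
theorem sewOp_eq (C : UnitaryOp n) (i : Fin n) : sewOp C i =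
    (1 / 2 : ℂ) • ∑ c, tensorPair (heisenberg C i c) (single i (pauli c)) := by
  rw [sewOp, swapGate_unitary, mul_smul_comm, smul_mul_assoc, Finset.mul_sum, Finset.sum_mul]
  simp only [tensorPair_mul, one_mul, mul_one, heisenberg]

/-- The product of the conjugated exchanges of the first `k` qubits. -/
def sewProd (C : UnitaryOp n) : ℕ → Op (n + n)
  | 0 => 1
  | k + 1 => (if h : k < n then sewOp C ⟨k, h⟩ else 1) * sewProd C k

/-- Between neighbouring factors C† C cancels, so the conjugated swaps multiply to a conjugate of
the product of the swaps. -/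
theorem sewProd_eq (C : UnitaryOp n) (k : ℕ) (hk : k ≤ n) : sewProd C k =
    tensorPair (C : Op n) 1 * (circuitUnitary (((List.finRange n).take k).map swapGate) :
      Op (n + n)) * tensorPair (star (C : Op n)) 1 := by
  induction k with
  | zero =>
    rw [sewProd, List.take_zero, List.map_nil, circuitUnitary, Submonoid.coe_one, mul_one,
      tensorPair_mul, one_mul, Matrix.mem_unitaryGroup_iff.1 C.2, tensorPair_one_one]
  | succ k ih =>
    have hk' : k < n := hk
    rw [sewProd, dif_pos hk', ih hk'.le, List.take_add_one, List.map_append, circuitUnitary_append,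
      List.getElem?_eq_getElem (by simpa using hk'), Submonoid.coe_mul]
    simp only [Option.toList_some, List.map_cons, List.map_nil, circuitUnitary, one_mul,
      List.getElem_finRange, Fin.cast_mk]
    rw [sewOp]
    simp only [mul_assoc]
    rw [← mul_assoc (tensorPair (star (C : Op n)) 1) (tensorPair (C : Op n) 1), sewOp_mul_sewOp_aux,
      one_mul]

theorem sewProd_mul_swapOp (C : UnitaryOp n) : sewProd C n * swapOp n =
    tensorPair (C : Op n) (star (C : Op n)) := by
  rw [sewProd_eq C n le_rfl, List.take_of_length_le (by simp), ← List.ofFn_eq_map]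
  exact sewing C

end

section

/-! ### Correlations are Pauli coefficients -/

theorem Axis.basis_diagonal (P : Axis) :
    P.basis * Matrix.diagonal (fun b => ((bitSign b : ℤ) : ℂ)) * star P.basis = pauli P.index := by
  have h : (Real.sqrt 2 : ℂ) * (Real.sqrt 2 : ℂ) = 2 := by
    rw [← Complex.ofReal_mul, Real.mul_self_sqrt (by norm_num)]
    norm_num
  have h0 : (Real.sqrt 2 : ℂ) ≠ 0 := by
    intro h0
    rw [h0] at h
    norm_num at h
  ext i j
  rw [Matrix.mul_apply]
  simp only [Matrix.mul_diagonal, Fin.sum_univ_two, Matrix.star_apply]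
  cases P <;> fin_cases i <;> fin_cases j <;>
    simp [Axis.basis, Complex.conj_ofReal, bitSign, pauli, pauliG, Axis.index, GaussianInt.toComplex_def] <;>
    (try field_simp) <;> (try simp [pow_two, h]) <;> norm_num

theorem index_pauliAxis {c : Fin 4} (hc : c ≠ 0) : (pauliAxis c).index = c := by
  fin_cases c <;> simp_all [pauliAxis, Axis.index]

variable {n : ℕ}

theorem diagonal_prod (f : Fin n → Fin 2 → ℂ) :
    (Matrix.diagonal fun x : Bits n => ∏ q, f q (x q)) = tensorAll fun q => Matrix.diagonal (f q) := by
  ext x y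
  simp only [tensorAll, Matrix.of_apply, Matrix.diagonal_apply, Finset.prod_ite_zero, funext_iff,
    Finset.mem_univ, true_imp_iff]

/-- At identity letters the diagonal factor is 1 and the change of basis cancels, whatever axis was
measured there. -/
theorem pauliString_eq_basis (Q : Fin n → Fin 4) : pauliString Q =
    (productBasis (fun q => pauliAxis (Q q)) : Op n) *
      (Matrix.diagonal fun y => ((stringSign Q y : ℤ) : ℂ)) *
      star (productBasis (fun q => pauliAxis (Q q)) : Op n) := by
  have h : (Matrix.diagonal fun y : Bits n => ((stringSign Q y : ℤ) : ℂ)) =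
      tensorAll fun q => Matrix.diagonal fun b => if Q q = 0 then 1 else ((bitSign b : ℤ) : ℂ) := by
    rw [← diagonal_prod]
    congr 1
    funext y
    rw [stringSign]
    push_cast
    rfl
  rw [h, productBasis, tensorUnitary, star_tensorAll, tensorAll_mul, tensorAll_mul, pauliString]
  congr 1
  funext q
  by_cases hq : Q q = 0
  · simp only [hq, if_true]
    rw [Matrix.diagonal_one, mul_one, pauli_zero]
    exact (Matrix.mem_unitaryGroup_iff.1 (Axis.basis_mem _)).symm
  · simp only [hq, if_false]
    rw [Axis.basis_diagonal, index_pauliAxis hq]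

theorem single_eq_basis (i : Fin n) (P : Axis) : single i (pauli P.index) =
    (productBasis (inputAxes i P) : Op n) *
      (Matrix.diagonal fun x => ((bitSign (x i) : ℤ) : ℂ)) *
      star (productBasis (inputAxes i P) : Op n) := by
  have h : (Matrix.diagonal fun y : Bits n => ((bitSign (y i) : ℤ) : ℂ)) =
      tensorAll fun q => Matrix.diagonal fun b => if q = i then ((bitSign b : ℤ) : ℂ) else 1 := by
    rw [← diagonal_prod]
    simp
  rw [h, productBasis, tensorUnitary, star_tensorAll, tensorAll_mul, tensorAll_mul, single]
  congr 1
  funext q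
  by_cases hq : q = i
  · subst hq
    simp only [if_true, Function.update_self, inputAxes]
    rw [Axis.basis_diagonal]
  · simp only [hq, if_false, Function.update_of_ne hq]
    rw [Matrix.diagonal_one, mul_one]
    exact (Matrix.mem_unitaryGroup_iff.1 (Axis.basis_mem _)).symm

/-- Diagonalize `P` on qubit `i` in the input basis and `Q` in the output basis. With V the matrix
of amplitudes the trace becomes ∑ sign(x) sign(y) |V y x|², which is Born's rule for a uniformly
random input. -/
theorem correlation_eq_trace (C : UnitaryOp n) (i : Fin n) (P : Axis) (Q : Fin n → Fin 4) :
    (Fintype.card (Bits n) : ℂ) * (correlation C i P Q : ℝ) =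
      (star (pauliString Q) * heisenberg C i P.index).trace := by
  set B := (productBasis (fun q => pauliAxis (Q q)) : UnitaryOp n) with hB
  set B' := (productBasis (inputAxes i P) : UnitaryOp n) with hB'
  set V := (star B * C * B' : UnitaryOp n) with hV
  set D : Op n := Matrix.diagonal fun y => ((stringSign Q y : ℤ) : ℂ) with hD
  set E : Op n := Matrix.diagonal fun x => ((bitSign (x i) : ℤ) : ℂ) with hE
  have h1 : (star (pauliString Q) * heisenberg C i P.index).trace =
      (D * ((V : Op n) * E * star (V : Op n))).trace := by
    rw [star_pauliString, pauliString_eq_basis, heisenberg, single_eq_basis, ← hB, ← hB', ← hD, ← hE,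
      mul_assoc (B : Op n), mul_assoc (B : Op n), Matrix.trace_mul_comm]
    congr 1
    rw [hV]
    simp only [Submonoid.coe_mul, star_mul, Unitary.coe_star, star_star, mul_assoc]
  rw [h1, Matrix.trace]
  have h2 : ∀ y, (D * ((V : Op n) * E * star (V : Op n))).diag y =
      ∑ x, ((‖amplitude C (inputAxes i P) x (fun q => pauliAxis (Q q)) y‖ ^ 2 : ℝ) : ℂ) *
        ((bitSign (x i) * stringSign Q y : ℤ) : ℂ) := by
    intro y
    rw [Matrix.diag_apply, hD, Matrix.diagonal_mul, Matrix.mul_apply, Finset.mul_sum]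
    refine Finset.sum_congr rfl fun x _ => ?_
    rw [hE, Matrix.mul_diagonal, Matrix.star_apply, Complex.star_def]
    have : amplitude C (inputAxes i P) x (fun q => pauliAxis (Q q)) y = (V : Op n) y x := rfl
    rw [this]
    have h3 := Complex.mul_conj' ((V : Op n) y x)
    push_cast
    rw [← h3]
    ring
  simp only [h2]
  rw [Finset.sum_comm, correlation]
  push_cast
  simp only [Fintype.card_pi, Fintype.card_fin, Finset.prod_const, Finset.card_univ]
  push_cast
  rw [← mul_assoc, mul_inv_cancel₀ (by simp), one_mul]

/-! ### One step of the sewing -/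

/-- A phase. -/
def phase (t : ℝ) : ℂ := (1 - Complex.I * (t / 2)) / (1 + Complex.I * (t / 2))

theorem one_le_norm_one_add (u : ℝ) : 1 ≤ ‖(1 + Complex.I * u : ℂ)‖ := by
  have := Complex.abs_re_le_norm (1 + Complex.I * u : ℂ)
  simpa using this

theorem norm_phase (t : ℝ) : ‖phase t‖ = 1 := by
  have h1 := one_le_norm_one_add (t / 2)
  have h2 : ‖(1 - Complex.I * (t / 2 : ℝ) : ℂ)‖ = ‖(1 + Complex.I * (t / 2 : ℝ) : ℂ)‖ := by
    rw [← Complex.norm_conj]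
    simp [sub_eq_add_neg, -Complex.ofReal_div]
  push_cast at h1 h2
  rw [phase, norm_div, h2, div_self (by linarith)]

theorem norm_phase_sub_one_le {t : ℝ} (ht : 0 ≤ t) : ‖phase t - 1‖ ≤ t := by
  have h1 := one_le_norm_one_add (t / 2)
  push_cast at h1
  have h0 : (1 + Complex.I * (t / 2) : ℂ) ≠ 0 := by
    intro h
    rw [h, norm_zero] at h1
    linarith
  have h0' : (2 + Complex.I * t : ℂ) ≠ 0 := by
    intro h
    apply h0
    linear_combination h / 2
  have : phase t - 1 = -(Complex.I * t) / (1 + Complex.I * (t / 2)) := by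
    rw [phase]
    field_simp
    ring
  rw [this, norm_div, norm_neg, norm_mul, Complex.norm_I, one_mul, Complex.norm_real,
    Real.norm_eq_abs, abs_of_nonneg ht]
  exact div_le_self ht h1

theorem norm_phase_sub_le (t : ℝ) : ‖phase t - 1 + Complex.I * t‖ ≤ t ^ 2 := by
  have h1 := one_le_norm_one_add (t / 2)
  push_cast at h1
  have h0 : (1 + Complex.I * (t / 2) : ℂ) ≠ 0 := by
    intro h
    rw [h, norm_zero] at h1
    linarith
  have h0' : (2 + Complex.I * t : ℂ) ≠ 0 := by
    intro h
    apply h0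
    linear_combination h / 2
  have : phase t - 1 + Complex.I * t = -(t ^ 2 / 2) / (1 + Complex.I * (t / 2)) := by
    rw [phase]
    field_simp
    linear_combination (t : ℂ) ^ 2 * Complex.I_sq
  rw [this, norm_div, norm_neg]
  have h2 : ‖(t ^ 2 / 2 : ℂ)‖ = t ^ 2 / 2 := by simp
  rw [h2]
  exact (div_le_self (by positivity) h1).trans (by nlinarith [sq_nonneg t])

/-- The printed rotations omit the identity term ½ of `W`. To second order this multiplies the step
by 1 - it, and `phase t` is an exact unit number with that expansion. The constant is 7 = 4 + 1 + 2.
-/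
theorem hsNorm_phase_smul_rotOp {ι : Type} [Fintype ι] [DecidableEq ι] [Nonempty ι]
    {W : Matrix ι ι ℂ} (hW : hsNorm W = 1) {t : ℝ} (ht : 0 ≤ t) (ht1 : t ≤ 1) :
    hsNorm (1 + (2 * Complex.I * t) • (W - (1 / 2 : ℂ) • 1) - phase t • rotOp W t) ≤ 7 * t ^ 2 := by
  have h : 1 + (2 * Complex.I * t) • (W - (1 / 2 : ℂ) • 1) - phase t • rotOp W t =
      -(phase t • (rotOp W t - 1 - (2 * Complex.I * t) • W)) +
        (-((phase t - 1 + Complex.I * t) • 1) + -(((phase t - 1) * (2 * Complex.I * t)) • W)) := by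
    ext a b
    simp only [Matrix.sub_apply, Matrix.add_apply, Matrix.smul_apply, Matrix.neg_apply, smul_eq_mul]
    ring
  rw [h]
  refine (hsNorm_add_le _ _).trans ((add_le_add_right (hsNorm_add_le _ _) _).trans ?_)
  simp only [hsNorm_neg, hsNorm_smul, hsNorm_one, hW, norm_phase, norm_mul]
  have h1 := hsNorm_rotOp_sub_le hW (s := t) (by rwa [abs_of_nonneg ht])
  have h2 := norm_phase_sub_le t
  have h3 := norm_phase_sub_one_le ht
  have h4 : ‖(2 : ℂ)‖ * ‖Complex.I‖ * ‖(t : ℂ)‖ = 2 * t := by simp [abs_of_nonneg ht]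
  rw [h4]
  have h5 : ‖phase t - 1‖ * (2 * t) ≤ t * (2 * t) := by gcongr
  nlinarith

variable {C : UnitaryOp n}

theorem termGates_angle {M T j : ℕ} (hM : M ≠ 0) (hT : T ≠ 0) (v : ℤ) :
    ((v * M : ℤ) : ℝ) / (angleDen M T j : ℝ) = v / T * (stepAngle M j / 2) := by
  have : (M : ℝ) ≠ 0 := by exact_mod_cast hM
  have h1 : (T : ℝ) ≠ 0 := by exact_mod_cast hT
  have h2 : ((M : ℝ) ^ 2 + j * (j + 1)) ≠ 0 := by positivity
  have h3 : (j * (j + 1) + M * M : ℝ) = (M : ℝ) ^ 2 + j * (j + 1) := by ring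
  rw [stepAngle, angleDen]
  push_cast
  rw [h3]
  field_simp
  norm_num

/-- `S` is the first-order part with the estimated coefficients, and `σ` is the sum of the absolute
half-angle tangents. The product formula controls the circuit by `σ`, and the sampling accuracy
compares `S` with the true coefficients. -/
theorem TermsPrinted.bound {M T j : ℕ} {hM : M ≠ 0} {hT : T ≠ 0} {τ : ℝ} {i : Fin n}
    {l : List (Axis × (Fin n → Fin 4))} {gs : List (MatrixGate (n + n))}
    (h : TermsPrinted C hM hT τ i j l gs) :
    ∃ (S : Op (n + n)) (σ : ℝ), 0 ≤ σ ∧ σ ≤ l.length * (stepAngle M j / 2) ∧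
      hsNorm ((circuitUnitary gs : Op (n + n)) - 1) ≤ 4 * σ ∧
      hsNorm ((circuitUnitary gs : Op (n + n)) - 1 - (2 * Complex.I) • S) ≤ 4 * σ ^ 2 ∧
      hsNorm (S - (l.map fun x => ((correlation C i x.1 x.2 * (stepAngle M j / 2) : ℝ) : ℂ) •
        termOp i x.1 x.2).sum) ≤ l.length * (stepAngle M j / 2 * τ) := by
  induction h with
  | nil => exact ⟨0, 0, le_rfl, by simp, by simp [circuitUnitary], by simp [circuitUnitary], by simp⟩
  | snoc P Q v h hv hacc ih =>
    obtain ⟨S, σ, h0, h1, h2, h3, h4⟩ := ih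
    have hT0 : (0 : ℝ) < T := by exact_mod_cast Nat.pos_of_ne_zero hT
    have hM1 : (1 : ℝ) ≤ M := by exact_mod_cast Nat.pos_of_ne_zero hM
    have ht0 := stepAngle_nonneg M j
    have ht1 : stepAngle M j ≤ 1 := (stepAngle_le M j).trans (by
      rw [div_le_one (by linarith)]; exact hM1)
    have hv' : |(v : ℝ)| ≤ T := by exact_mod_cast hv
    set s : ℝ := v / T * (stepAngle M j / 2) with hs
    -- The deterministic bound `|v| ≤ T` is used here, so the small-angle condition does not depend
    -- on the accuracy of the estimates.
    have hs1 : |s| ≤ stepAngle M j / 2 := by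
      rw [hs, abs_mul, abs_div, abs_of_pos hT0, abs_of_nonneg (by positivity : (0 : ℝ) ≤ stepAngle M j / 2)]
      exact mul_le_of_le_one_left (by positivity) (by rw [div_le_one hT0]; exact hv')
    obtain ⟨g1, g2⟩ := hsNorm_product_formula (termOp_mem i P Q) (circuitUnitary _).2
      (by linarith : |s| ≤ 1) h2 h3
    refine ⟨(s : ℂ) • termOp i P Q + S, |s| + σ, by positivity, ?_, ?_, ?_, ?_⟩
    · rw [List.length_append, List.length_singleton]
      push_cast
      linarith
    · rw [circuitUnitary_append, Submonoid.coe_mul, termGates_unitary, termGates_angle hM hT]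
      exact g1
    · rw [circuitUnitary_append, Submonoid.coe_mul, termGates_unitary, termGates_angle hM hT]
      exact g2
    · rw [List.map_append, List.sum_append, List.map_singleton, List.sum_singleton,
        List.length_append, List.length_singleton]
      generalize (List.map (fun x : Axis × (Fin n → Fin 4) =>
        ((correlation C i x.1 x.2 * (stepAngle M j / 2) : ℝ) : ℂ) • termOp i x.1 x.2) _).sum = X at h4 ⊢
      have : (s : ℂ) • termOp i P Q + S -
          (X + ((correlation C i P Q * (stepAngle M j / 2) : ℝ) : ℂ) • termOp i P Q) =
          (S - X) + ((s - correlation C i P Q * (stepAngle M j / 2) : ℝ) : ℂ) • termOp i P Q := by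
        push_cast
        rw [sub_smul]
        abel
      rw [this]
      refine (hsNorm_add_le _ _).trans ?_
      rw [hsNorm_smul, hsNorm_unitary (termOp_mem i P Q), mul_one, Complex.norm_real, Real.norm_eq_abs]
      have h5 : |s - correlation C i P Q * (stepAngle M j / 2)| ≤ stepAngle M j / 2 * τ := by
        have h6 : s - correlation C i P Q * (stepAngle M j / 2) =
            ((v : ℝ) - T * correlation C i P Q) / T * (stepAngle M j / 2) := by
          rw [hs]
          field_simp
        rw [h6, abs_mul, abs_div, abs_of_pos hT0,
          abs_of_nonneg (by positivity : (0 : ℝ) ≤ stepAngle M j / 2), mul_comm]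
        exact mul_le_mul_of_nonneg_left ((div_le_iff₀ hT0).2 hacc) (by positivity)
      push_cast
      linarith

theorem list_sum_tensorPair (l : List (Op n)) (B : Op n) :
    tensorPair l.sum B = (l.map fun A => tensorPair A B).sum := by
  induction l with
  | nil =>
    ext x y
    simp [tensorPair]
  | cons A l ih => rw [List.sum_cons, tensorPair_add_left, ih, List.map_cons, List.sum_cons]

/-- The error of the approximation of the Heisenberg operators by the Pauli strings in `rows`. -/
def TailBound (C : UnitaryOp n) (rows : List (Fin n → Fin 4)) (κ : ℝ) : Prop :=
  ∀ i P, hsNorm (heisenberg C i P.index -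
    (rows.map fun Q => ((correlation C i P Q : ℝ) : ℂ) • pauliString Q).sum) ≤ κ

/-- With N rows and t = `stepAngle M j` there are four errors: the product formula gives 4σ² ≤
9N²t², sampling 3Ntτ, truncation of the three Heisenberg operators 3tκ, and the second-order
comparison with the true step 7t² ≤ 7N²t². -/
theorem TermsPrinted.near {M T j : ℕ} {hM : M ≠ 0} {hT : T ≠ 0} {τ κ : ℝ} {i : Fin n}
    {rows : List (Fin n → Fin 4)} {gs : List (MatrixGate (n + n))}
    (h : TermsPrinted C hM hT τ i j (allTerms rows) gs) (hrows : 1 ≤ rows.length)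
    (htail : TailBound C rows κ) :
    Near (3 * stepAngle M j * (rows.length * τ + κ) + 16 * rows.length ^ 2 * stepAngle M j ^ 2)
      (circuitUnitary gs : Op (n + n)) (rotOp (sewOp C i) (stepAngle M j)) := by
  obtain ⟨S, σ, h0, h1, -, h3, h4⟩ := h.bound
  have hM1 : (1 : ℝ) ≤ M := by exact_mod_cast Nat.pos_of_ne_zero hM
  have ht0 := stepAngle_nonneg M j
  have ht1 : stepAngle M j ≤ 1 := (stepAngle_le M j).trans (by
    rw [div_le_one (by linarith)]; exact hM1)
  have hlen : ((allTerms rows).length : ℝ) = 3 * rows.length := by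
    simp [allTerms]
    ring
  rw [hlen] at h1 h4
  have hN : (1 : ℝ) ≤ rows.length := by exact_mod_cast hrows
  set t := stepAngle M j with ht
  set N : ℝ := (rows.length : ℝ) with hN'
  set X := (List.map (fun x => ((correlation C i x.1 x.2 * (t / 2) : ℝ) : ℂ) •
        termOp i x.1 x.2) (allTerms rows)).sum with hX
  set D : Axis → Op n := fun P => heisenberg C i P.index -
    (rows.map fun Q => ((correlation C i P Q : ℝ) : ℂ) • pauliString Q).sum with hD
  have hpart : ∀ P : Axis, (List.map (fun x => ((correlation C i x.1 x.2 * (t / 2) : ℝ) : ℂ) •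
        termOp i x.1 x.2) (rows.map fun Q => (P, Q))).sum =
      ((t / 2 : ℝ) : ℂ) • (tensorPair (heisenberg C i P.index) (single i (pauli P.index)) -
        tensorPair (D P) (single i (pauli P.index))) := by
    intro P
    rw [← tensorPair_sub_left, hD]
    simp only [sub_sub_cancel]
    rw [list_sum_tensorPair, List.smul_sum, List.map_map, List.map_map, List.map_map]
    congr 1
    refine List.map_congr_left fun Q _ => ?_
    simp only [Function.comp_apply, tensorPair_smul_left, smul_smul, termOp]
    push_cast
    rw [mul_comm]
  -- The letter `I` is preserved by conjugation and contributes exactly ½, so only three axes remain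
  -- to be learned.
  have hW : sewOp C i - (1 / 2 : ℂ) • 1 = (1 / 2 : ℂ) • (
      tensorPair (heisenberg C i Axis.X.index) (single i (pauli Axis.X.index)) +
      (tensorPair (heisenberg C i Axis.Y.index) (single i (pauli Axis.Y.index)) +
      tensorPair (heisenberg C i Axis.Z.index) (single i (pauli Axis.Z.index)))) := by
    rw [sewOp_eq, Fin.sum_univ_four, heisenberg_zero, pauli_zero, single_one, tensorPair_one_one]
    simp only [Axis.index, smul_add]
    abel
  have hXW : X - (t : ℂ) • (sewOp C i - (1 / 2 : ℂ) • 1) = -(((t / 2 : ℝ) : ℂ) • (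
      tensorPair (D .X) (single i (pauli Axis.X.index)) +
      (tensorPair (D .Y) (single i (pauli Axis.Y.index)) +
      tensorPair (D .Z) (single i (pauli Axis.Z.index))))) := by
    rw [hX, allTerms, List.map_append, List.map_append, List.sum_append, List.sum_append, hpart, hpart,
      hpart, hW, smul_smul]
    have : (t : ℂ) * (1 / 2) = ((t / 2 : ℝ) : ℂ) := by push_cast; ring
    rw [this]
    simp only [smul_add, smul_sub]
    abel
  have hXWn : hsNorm (X - (t : ℂ) • (sewOp C i - (1 / 2 : ℂ) • 1)) ≤ t / 2 * (3 * κ) := by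
    rw [hXW, hsNorm_neg, hsNorm_smul, Complex.norm_real, Real.norm_eq_abs,
      abs_of_nonneg (by positivity : 0 ≤ t / 2)]
    refine mul_le_mul_of_nonneg_left ?_ (by positivity)
    refine (hsNorm_add_le _ _).trans ((add_le_add_right (hsNorm_add_le _ _) _).trans ?_)
    simp only [hsNorm_tensorPair_unitary _ (single_pauli_mem _ _)]
    linarith [htail i .X, htail i .Y, htail i .Z]
  have hlast := hsNorm_phase_smul_rotOp (hsNorm_unitary (sewOp_mem C i)) ht0 ht1
  refine ⟨phase t, norm_phase t, ?_⟩
  have hsplit : (circuitUnitary gs : Op (n + n)) - phase t • rotOp (sewOp C i) t =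
      ((circuitUnitary gs : Op (n + n)) - 1 - (2 * Complex.I) • S) +
      ((2 * Complex.I) • (S - X) +
      ((2 * Complex.I) • (X - (t : ℂ) • (sewOp C i - (1 / 2 : ℂ) • 1)) +
      (1 + (2 * Complex.I * t) • (sewOp C i - (1 / 2 : ℂ) • 1) - phase t • rotOp (sewOp C i) t))) := by
    simp only [smul_sub, smul_smul, mul_assoc]
    abel
  rw [hsplit]
  have h2I : ‖(2 * Complex.I : ℂ)‖ = 2 := by simp
  refine (hsNorm_add_le _ _).trans ((add_le_add_right ((hsNorm_add_le _ _).trans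
    (add_le_add_right (hsNorm_add_le _ _) _)) _).trans ?_)
  rw [hsNorm_smul, hsNorm_smul, h2I]
  have hσ : 4 * σ ^ 2 ≤ 9 * N ^ 2 * t ^ 2 := by
    have : σ ^ 2 ≤ (3 * N * (t / 2)) ^ 2 := by gcongr
    linarith
  have hN2 : 7 * t ^ 2 ≤ 7 * N ^ 2 * t ^ 2 := by
    have : 1 ≤ N ^ 2 := one_le_pow₀ hN
    nlinarith [sq_nonneg t]
  linarith

/-- Exact steps compose by `rotOp_stepAngle_mul` and errors add. Since t ≤ 1/M, after M steps the
quadratic errors leave only O(N²/M), and the linear ones do not accumulate beyond a constant factor.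
-/
theorem StepsPrinted.near {M T : ℕ} {hM : M ≠ 0} {hT : T ≠ 0} {τ κ : ℝ} {i : Fin n}
    {rows : List (Fin n → Fin 4)} {gs : List (MatrixGate (n + n))} {k : ℕ} (hk : k ≤ M)
    (h : StepsPrinted C hM hT τ rows i k gs) (hrows : 1 ≤ rows.length) (hτ : 0 ≤ τ) (hκ : 0 ≤ κ)
    (htail : TailBound C rows κ) :
    Near (k * (1 / M * (3 * (rows.length * τ + κ) + 16 * rows.length ^ 2 / M)))
      (circuitUnitary gs : Op (n + n)) (rotOp (sewOp C i) (k / M)) := by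
  induction h with
  | zero =>
    simp only [circuitUnitary, Nat.cast_zero, zero_div, zero_mul, rotOp_zero]
    exact Near.refl _
  | succ h h' ih =>
    rename_i j gs gs'
    rw [circuitUnitary_append, Submonoid.coe_mul, ← rotOp_stepAngle_mul (sewOp_mul_self C i) hk]
    refine ((h'.near hrows htail).mul (ih (by omega)) (rotOp_mem (sewOp_mul_self C i)
      (star_sewOp C i) _) (circuitUnitary gs).2).mono ?_
    have ht0 := stepAngle_nonneg M j
    have ht := stepAngle_le M j
    have hM1 : (0 : ℝ) < M := by exact_mod_cast Nat.pos_of_ne_zero hM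
    have h1 : 3 * stepAngle M j * (rows.length * τ + κ) ≤ 3 * (1 / M) * (rows.length * τ + κ) := by
      gcongr
    have h2 : 16 * (rows.length : ℝ) ^ 2 * stepAngle M j ^ 2 ≤ 16 * rows.length ^ 2 * (1 / M) ^ 2 := by
      gcongr
    refine (add_le_add_left (add_le_add h1 h2) _).trans (le_of_eq ?_)
    push_cast
    field_simp
    ring

/-- After all `M` steps the path has reached i times the involution, and `Near` absorbs the factor
i. -/
theorem QubitsPrinted.near {M T : ℕ} {hM : M ≠ 0} {hT : T ≠ 0} {τ κ : ℝ}
    {rows : List (Fin n → Fin 4)} {gs : List (MatrixGate (n + n))} {k : ℕ}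
    (h : QubitsPrinted C hM hT τ rows k gs) (hrows : 1 ≤ rows.length) (hτ : 0 ≤ τ) (hκ : 0 ≤ κ)
    (htail : TailBound C rows κ) :
    Near (k * (3 * (rows.length * τ + κ) + 16 * rows.length ^ 2 / M))
      (circuitUnitary gs : Op (n + n)) (sewProd C k) := by
  induction h with
  | zero =>
    simp only [circuitUnitary, Nat.cast_zero, zero_mul, sewProd]
    exact Near.refl _
  | succ hk h h' ih =>
    rename_i k gs gs'
    have hM1 : (M : ℝ) ≠ 0 := by exact_mod_cast hM
    have h1 := h'.near le_rfl hrows hτ hκ htail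
    rw [div_self hM1, rotOp_one] at h1
    have h2 : Near (3 * (rows.length * τ + κ) + 16 * rows.length ^ 2 / M)
        (circuitUnitary gs' : Op (n + n)) (sewOp C ⟨k, hk⟩) := by
      obtain ⟨c, hc, h1⟩ := h1
      refine ⟨c * Complex.I, by simp [hc], ?_⟩
      rw [← smul_smul]
      refine h1.trans (le_of_eq ?_)
      field_simp
    rw [circuitUnitary_append, Submonoid.coe_mul, sewProd, dif_pos hk]
    refine (h2.mul ih (sewOp_mem C _) (circuitUnitary gs).2).mono (le_of_eq ?_)
    push_cast
    ring

/-- The printed circuit approximates `C ⊗ C†`. -/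
theorem QubitsPrinted.near_tensorPair {M T : ℕ} {hM : M ≠ 0} {hT : T ≠ 0} {τ κ : ℝ}
    {rows : List (Fin n → Fin 4)} {gs : List (MatrixGate (n + n))}
    (h : QubitsPrinted C hM hT τ rows n gs) (hrows : 1 ≤ rows.length) (hτ : 0 ≤ τ) (hκ : 0 ≤ κ)
    (htail : TailBound C rows κ) :
    Near (n * (3 * (rows.length * τ + κ) + 16 * rows.length ^ 2 / M))
      (circuitUnitary ((List.ofFn fun q : Fin n => swapGate q) ++ gs) : Op (n + n))
      (tensorPairUnitary C (star C) : Op (n + n)) := by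
  rw [circuitUnitary_append, Submonoid.coe_mul]
  obtain ⟨c, hc, h1⟩ := h.near hrows hτ hκ htail
  refine ⟨c, hc, ?_⟩
  -- The swaps head the list, so they act first and stand on the right of the product.
  have : (tensorPairUnitary C (star C) : Op (n + n)) = sewProd C n * swapOp n :=
    (sewProd_mul_swapOp C).symm
  rw [this, swapOp, ← smul_mul_assoc, ← sub_mul, hsNorm_mul_unitary (circuitUnitary _).2]
  exact h1

end

section

/-! ### Operators supported on a set of qubits -/

variable {n : ℕ}

/-- The operators that act as the identity outside `L`. -/
def supportedOn (L : Finset (Fin n)) : Submodule ℂ (Op n) :=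
  Submodule.span ℂ {A | ∃ f : Fin n → Matrix (Fin 2) (Fin 2) ℂ, (∀ q ∉ L, f q = 1) ∧ A = tensorAll f}

theorem tensorAll_mem_supportedOn {L : Finset (Fin n)} {f : Fin n → Matrix (Fin 2) (Fin 2) ℂ}
    (h : ∀ q ∉ L, f q = 1) : tensorAll f ∈ supportedOn L := Submodule.subset_span ⟨f, h, rfl⟩

theorem one_mem_supportedOn (L : Finset (Fin n)) : (1 : Op n) ∈ supportedOn L := by
  rw [← tensorAll_one]
  exact tensorAll_mem_supportedOn fun _ _ => rfl

theorem supportedOn_mono {L L' : Finset (Fin n)} (h : L ⊆ L') : supportedOn L ≤ supportedOn L' := by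
  refine Submodule.span_mono ?_
  rintro A ⟨f, hf, rfl⟩
  exact ⟨f, fun q hq => hf q fun hq' => hq (h hq'), rfl⟩

theorem mul_mem_supportedOn {L : Finset (Fin n)} {A B : Op n} (hA : A ∈ supportedOn L)
    (hB : B ∈ supportedOn L) : A * B ∈ supportedOn L := by
  have h := Submodule.mul_mem_mul hA hB
  rw [supportedOn, Submodule.span_mul_span] at h
  refine Submodule.span_mono ?_ h
  rintro _ ⟨_, ⟨f, hf, rfl⟩, _, ⟨g, hg, rfl⟩, rfl⟩
  refine ⟨fun q => f q * g q, fun q hq => ?_, tensorAll_mul f g⟩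
  simp only [hf q hq, hg q hq, one_mul]

theorem commute_of_mem_supportedOn {L L' : Finset (Fin n)} (h : Disjoint L L') {A B : Op n}
    (hA : A ∈ supportedOn L) (hB : B ∈ supportedOn L') : Commute A B := by
  refine Submodule.span_induction ?_ (Commute.zero_left _) (fun _ _ _ _ => Commute.add_left)
    (fun c _ _ h => h.smul_left c) hA
  rintro _ ⟨f, hf, rfl⟩
  refine Submodule.span_induction ?_ (Commute.zero_right _) (fun _ _ _ _ => Commute.add_right)
    (fun c _ _ h => h.smul_right c) hB
  rintro _ ⟨g, hg, rfl⟩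
  rw [Commute, SemiconjBy, tensorAll_mul, tensorAll_mul]
  congr 1
  funext q
  by_cases hq : q ∈ L
  · rw [hg q (Finset.disjoint_left.1 h hq), mul_one, one_mul]
  · rw [hf q hq, mul_one, one_mul]

theorem conj_tensorUnitary_mem {L : Finset (Fin n)} {A : Op n} (hA : A ∈ supportedOn L)
    (u : Fin n → Matrix.unitaryGroup (Fin 2) ℂ) :
    (tensorUnitary u : Op n) * A * star (tensorUnitary u : Op n) ∈ supportedOn L := by
  refine Submodule.span_induction ?_ ?_ ?_ ?_ hA
  · rintro _ ⟨f, hf, rfl⟩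
    rw [tensorUnitary, star_tensorAll, tensorAll_mul, tensorAll_mul]
    refine tensorAll_mem_supportedOn fun q hq => ?_
    rw [hf q hq, mul_one]
    exact Matrix.mem_unitaryGroup_iff.1 (u q).2
  · rw [mul_zero, zero_mul]
    exact zero_mem _
  · intro A B _ _ hA hB
    rw [mul_add, add_mul]
    exact add_mem hA hB
  · intro c A _ hA
    rw [mul_smul_comm, smul_mul_assoc]
    exact Submodule.smul_mem _ _ hA

/-- A CZ gate is 1 minus twice the projection onto all ones, which is a product of single-qubit
projections. -/
theorem diagonal_czPhase_mem (S : Finset (Fin n)) :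
    (Matrix.diagonal (czPhase S) : Op n) ∈ supportedOn S := by
  have h : (Matrix.diagonal (czPhase S) : Op n) = 1 - (2 : ℂ) •
      tensorAll fun q => Matrix.diagonal fun b => if q ∈ S then (if b = 1 then 1 else 0) else 1 := by
    rw [← diagonal_prod, ← Matrix.diagonal_one, ← Matrix.diagonal_smul, Matrix.diagonal_sub]
    congr 1
    funext x
    simp only [Pi.smul_apply, smul_eq_mul]
    have : ∀ q, (if q ∈ S then (if x q = 1 then (1 : ℂ) else 0) else 1) =
        if q ∈ S → x q = 1 then 1 else 0 := by
      intro q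
      by_cases hq : q ∈ S <;> simp [hq]
    simp only [this, Finset.prod_ite_zero, Finset.prod_const_one, Finset.mem_univ, true_imp_iff]
    unfold czPhase
    split <;> norm_num
  rw [h]
  refine sub_mem (one_mem_supportedOn S) (Submodule.smul_mem _ _ (tensorAll_mem_supportedOn ?_))
  intro q hq
  simp only [hq, if_false]
  exact Matrix.diagonal_one

/-- The product of the `CZ` gates on the sets in `F`. -/
def czProd (F : Finset (Finset (Fin n))) : Op n := Matrix.diagonal fun x => ∏ S ∈ F, czPhase S x

theorem czProd_mem {F : Finset (Finset (Fin n))} {L : Finset (Fin n)} (h : ∀ S ∈ F, S ⊆ L) :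
    czProd F ∈ supportedOn L := by
  induction F using Finset.induction_on with
  | empty =>
    simp only [czProd, Finset.prod_empty]
    exact Matrix.diagonal_one (α := ℂ) (n := Bits n) ▸ one_mem_supportedOn L
  | insert S F hS ih =>
    have : czProd (insert S F) = Matrix.diagonal (czPhase S) * czProd F := by
      simp only [czProd, Finset.prod_insert hS, Matrix.diagonal_mul_diagonal]
    rw [this]
    exact mul_mem_supportedOn (supportedOn_mono (h S (Finset.mem_insert_self _ _))
      (diagonal_czPhase_mem S)) (ih fun T hT => h T (Finset.mem_insert_of_mem hT))

theorem czPhase_mul_self (S : Finset (Fin n)) (x : Bits n) : czPhase S x * czPhase S x = 1 := by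
  unfold czPhase
  split <;> norm_num

theorem czProd_mul_self (F : Finset (Finset (Fin n))) : czProd F * czProd F = 1 := by
  rw [czProd, Matrix.diagonal_mul_diagonal, ← Matrix.diagonal_one]
  simp only [← Finset.prod_mul_distrib, czPhase_mul_self, Finset.prod_const_one]

theorem star_czProd (F : Finset (Finset (Fin n))) : star (czProd F) = czProd F := by
  rw [czProd, Matrix.star_eq_conjTranspose, Matrix.diagonal_conjTranspose]
  congr 1
  funext x
  rw [Pi.star_apply, star_prod]
  refine Finset.prod_congr rfl fun S _ => ?_
  unfold czPhase
  split <;> simp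

/-! ### Light cones -/

/-- The layer without the gates that are wider than `k`. -/
def CZLayer.narrow (L : CZLayer n) (k : ℕ) : CZLayer n where
  gates := L.gates.filter fun S => S.card ≤ k
  nonempty := fun S hS => L.nonempty S (Finset.mem_of_mem_filter S hS)
  disjoint := fun S hS T hT => L.disjoint S (Finset.mem_of_mem_filter S hS) T
    (Finset.mem_of_mem_filter T hT)

/-- The circuit without the gates that are wider than `k`. -/
def QACCircuit.narrow (k : ℕ) : {d : ℕ} → QACCircuit n d → QACCircuit n d
  | _, .single u => .single u
  | _, .layer C L u => .layer (C.narrow k) (L.narrow k) u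

/-- The qubit `q` and the qubits that share a gate with it. -/
def CZLayer.cell (L : CZLayer n) (q : Fin n) : Finset (Fin n) :=
  insert q ((L.gates.filter fun S => q ∈ S).biUnion id)

/-- By disjointness at most one gate contains `q`, and the cell is this gate or the singleton, which
is where `1 ≤ k` is needed. -/
theorem CZLayer.card_cell_le {L : CZLayer n} {k : ℕ} (hk : 1 ≤ k) (hL : ∀ S ∈ L.gates, S.card ≤ k)
    (q : Fin n) : (L.cell q).card ≤ k := by
  by_cases h : ∃ S ∈ L.gates, q ∈ S
  · obtain ⟨S, hS, hq⟩ := h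
    refine (Finset.card_le_card ?_).trans (hL S hS)
    intro r hr
    rw [CZLayer.cell, Finset.mem_insert, Finset.mem_biUnion] at hr
    rcases hr with rfl | ⟨T, hT, hr⟩
    · exact hq
    · rw [Finset.mem_filter] at hT
      by_contra hrS
      have hne : S ≠ T := by
        rintro rfl
        exact hrS hr
      exact Finset.disjoint_left.1 (L.disjoint S hS T hT.1 hne) hq hT.2
  · have : L.gates.filter (fun S => q ∈ S) = ∅ :=
      Finset.filter_eq_empty_iff.2 fun S hS hq => h ⟨S, hS, hq⟩
    rw [CZLayer.cell, this]
    simpa using hk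

/-- Gates that do not meet `M` commute with `A` and cancel against their inverses; those that meet
`M` lie in the union of the cells. -/
theorem conj_layer_mem {L : CZLayer n} {M : Finset (Fin n)} {A : Op n} (hA : A ∈ supportedOn M) :
    L.op * A * star L.op ∈ supportedOn (M.biUnion L.cell) := by
  have hop : L.op = czProd (L.gates.filter fun S => ¬ Disjoint S M) *
      czProd (L.gates.filter fun S => Disjoint S M) := by
    simp only [czProd, Matrix.diagonal_mul_diagonal, CZLayer.op]
    congr 1
    funext x
    rw [mul_comm, Finset.prod_filter_mul_prod_filter_not]
  have hself : M ⊆ M.biUnion L.cell := fun q hq =>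
    Finset.mem_biUnion.2 ⟨q, hq, Finset.mem_insert_self _ _⟩
  have h1 : czProd (L.gates.filter fun S => ¬ Disjoint S M) ∈ supportedOn (M.biUnion L.cell) := by
    refine czProd_mem fun S hS r hr => ?_
    rw [Finset.mem_filter, Finset.not_disjoint_iff] at hS
    obtain ⟨hS, q, hqS, hqM⟩ := hS
    exact Finset.mem_biUnion.2 ⟨q, hqM, Finset.mem_insert_of_mem
      (Finset.mem_biUnion.2 ⟨S, Finset.mem_filter.2 ⟨hS, hqS⟩, hr⟩)⟩
  have h2 : Commute A (czProd (L.gates.filter fun S => Disjoint S M)) := by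
    refine commute_of_mem_supportedOn (L' := Mᶜ) disjoint_compl_right hA (czProd_mem fun S hS => ?_)
    rw [Finset.mem_filter] at hS
    intro r hr
    exact Finset.mem_compl.2 (Finset.disjoint_left.1 hS.2 hr)
  rw [hop, star_mul, star_czProd, star_czProd]
  have h3 : ∀ D E : Op n, E * E = 1 → Commute A E → D * E * A * (E * D) = D * A * D := by
    intro D E hE hc
    calc D * E * A * (E * D) = D * (E * A) * (E * D) := by simp only [mul_assoc]
      _ = D * A * (E * E) * D := by rw [← hc.eq]; simp only [mul_assoc]
      _ = D * A * D := by rw [hE, mul_one]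
  rw [h3 _ _ (czProd_mul_self _) h2]
  exact mul_mem_supportedOn (mul_mem_supportedOn h1 (supportedOn_mono hself hA)) h1

/-- Later layers conjugate from outside, each enlarges the support at most by the factor `k`, and
single-qubit gates leave it unchanged. -/
theorem exists_light_cone {k : ℕ} (hk : 1 ≤ k) {d : ℕ} (C : QACCircuit n d) (i : Fin n) (c : Fin 4) :
    ∃ M : Finset (Fin n), M.card ≤ k ^ d ∧ heisenberg (C.narrow k).unitary i c ∈ supportedOn M := by
  induction C with
  | single u =>
    refine ⟨{i}, by simp, ?_⟩
    refine conj_tensorUnitary_mem (tensorAll_mem_supportedOn fun q hq => ?_) u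
    exact Function.update_of_ne (by simpa using hq) _ _
  | layer C L u ih =>
    obtain ⟨M, hM, h⟩ := ih
    refine ⟨M.biUnion (L.narrow k).cell, ?_, ?_⟩
    · rw [pow_succ]
      refine (Finset.card_biUnion_le_card_mul _ _ k fun q _ => CZLayer.card_cell_le hk ?_ q).trans
        (Nat.mul_le_mul_right _ hM)
      exact fun S hS => (Finset.mem_filter.1 hS).2
    · have := conj_tensorUnitary_mem (conj_layer_mem (L := L.narrow k) h) u
      rw [heisenberg] at this ⊢
      rw [QACCircuit.narrow, QACCircuit.unitary]
      simp only [Submonoid.coe_mul, star_mul]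
      simpa only [mul_assoc] using this

/-! ### Pauli expansions -/

theorem exists_pauli_expansion (A : Matrix (Fin 2) (Fin 2) ℂ) :
    ∃ a : Fin 4 → ℂ, A = ∑ c, a c • pauli c := by
  refine ⟨![(A 0 0 + A 1 1) / 2, (A 0 1 + A 1 0) / 2, Complex.I * (A 0 1 - A 1 0) / 2,
    (A 0 0 - A 1 1) / 2], ?_⟩
  ext r s
  rw [Fin.sum_univ_four]
  fin_cases r <;> fin_cases s <;>
    simp [pauli, pauliG, GaussianInt.toComplex_def] <;> ring_nf <;> (try rw [Complex.I_sq]) <;> ring_nf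

/-- Expand every tensor factor in Pauli operators. Outside `L` only the identity letter occurs, so
the strings that remain have weight at most the size of `L`. -/
theorem supportedOn_le_span_pauliString {L : Finset (Fin n)} {l : ℕ} (hL : L.card ≤ l) :
    supportedOn L ≤ Submodule.span ℂ (pauliString ''
      ((Finset.univ.filter fun Q : Fin n → Fin 4 => weight Q ≤ l : Finset (Fin n → Fin 4)) :
        Set (Fin n → Fin 4))) := by
  refine Submodule.span_le.2 ?_
  rintro _ ⟨f, hf, rfl⟩
  have h : ∀ q, ∃ a : Fin 4 → ℂ, f q = ∑ c, a c • pauli c ∧ (q ∉ L → ∀ c, c ≠ 0 → a c = 0) := by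
    intro q
    by_cases hq : q ∈ L
    · obtain ⟨a, ha⟩ := exists_pauli_expansion (f q)
      exact ⟨a, ha, fun h => absurd hq h⟩
    · refine ⟨Pi.single 0 1, ?_, fun _ c hc => Pi.single_eq_of_ne hc _⟩
      rw [hf q hq, Finset.sum_eq_single 0]
      · simp [pauli_zero]
      · intro c _ hc
        simp [Pi.single_eq_of_ne hc]
      · simp
  choose a ha ha0 using h
  have hexp : tensorAll f = ∑ Q : Fin n → Fin 4, (∏ q, a q (Q q)) • pauliString Q := by
    ext x y
    simp only [tensorAll, Matrix.of_apply, Matrix.sum_apply, Matrix.smul_apply, pauliString, smul_eq_mul,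
      ← Finset.prod_mul_distrib]
    rw [← Fintype.prod_sum fun q c => a q c * pauli c (x q) (y q)]
    refine Finset.prod_congr rfl fun q _ => ?_
    rw [ha q]
    simp [Matrix.sum_apply]
  rw [SetLike.mem_coe, hexp]
  refine Submodule.sum_mem _ fun Q _ => ?_
  by_cases hQ : ∀ q, Q q ≠ 0 → q ∈ L
  · refine Submodule.smul_mem _ _ (Submodule.subset_span ⟨Q, ?_, rfl⟩)
    simp only [Finset.coe_filter, Finset.mem_univ, true_and, Set.mem_ofPred_eq]
    refine (Finset.card_le_card fun q hq => hQ q ?_).trans hL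
    simpa using hq
  · push Not at hQ
    obtain ⟨q, hq, hqL⟩ := hQ
    rw [Finset.prod_eq_zero (Finset.mem_univ q) (ha0 q hqL _ hq), zero_smul]
    exact zero_mem _

end

section

variable {n : ℕ}

/-! ### The error of leaving out wide gates -/

theorem card_ones (S : Finset (Fin n)) :
    ((Finset.univ.filter fun x : Bits n => ∀ i ∈ S, x i = 1).card : ℝ) = 2 ^ n * (1 / 2) ^ S.card := by
  have h : (Finset.univ.filter fun x : Bits n => ∀ i ∈ S, x i = 1) =
      Fintype.piFinset fun i => if i ∈ S then {1} else Finset.univ := by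
    ext x
    simp only [Finset.mem_filter, Finset.mem_univ, true_and, Fintype.mem_piFinset]
    refine forall_congr' fun i => ?_
    by_cases hi : i ∈ S <;> simp [hi]
  rw [h, Fintype.card_piFinset]
  have h1 : ∀ i : Fin n, ((if i ∈ S then {1} else Finset.univ : Finset (Fin 2)).card : ℝ) =
      2 * if i ∈ S then 1 / 2 else 1 := by
    intro i
    by_cases hi : i ∈ S <;> simp [hi]
  push_cast
  simp only [h1, Finset.prod_mul_distrib, Finset.prod_ite, Finset.prod_const, Finset.card_univ,
    Fintype.card_fin, one_pow, mul_one]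
  simp

theorem norm_prod_czPhase (F : Finset (Finset (Fin n))) (x : Bits n) :
    ‖∏ S ∈ F, czPhase S x‖ = 1 := by
  rw [norm_prod]
  refine Finset.prod_eq_one fun S _ => ?_
  unfold czPhase
  split <;> simp

theorem card_gates_le (L : CZLayer n) : L.gates.card ≤ n := by
  have h : (L.gates.biUnion id).card = ∑ S ∈ L.gates, S.card :=
    Finset.card_biUnion fun S hS T hT => L.disjoint S hS T hT
  calc L.gates.card = ∑ S ∈ L.gates, 1 := by simp
    _ ≤ ∑ S ∈ L.gates, S.card :=
      Finset.sum_le_sum fun S hS => Finset.card_pos.2 (L.nonempty S hS)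
    _ ≤ n := by
      rw [← h]
      exact (Finset.card_le_univ _).trans (by simp)

/-- The product differs from 1 only if some gate of `F` fires, and the distance of two unit numbers
is at most 2; the sum over `F` is a union bound. -/
theorem sq_norm_prod_sub_one_le (F : Finset (Finset (Fin n))) (x : Bits n) :
    ‖(∏ S ∈ F, czPhase S x) - 1‖ ^ 2 ≤ ∑ S ∈ F, if ∀ i ∈ S, x i = 1 then (4 : ℝ) else 0 := by
  by_cases h : ∃ S ∈ F, ∀ i ∈ S, x i = 1
  · obtain ⟨S, hS, hx⟩ := h
    have h1 : ‖(∏ S ∈ F, czPhase S x) - 1‖ ≤ 2 := by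
      refine (norm_sub_le _ _).trans ?_
      rw [norm_prod_czPhase, norm_one]
      norm_num
    have h2 : (4 : ℝ) ≤ ∑ S ∈ F, if ∀ i ∈ S, x i = 1 then (4 : ℝ) else 0 := by
      refine le_trans (le_of_eq ?_) (Finset.single_le_sum
        (f := fun S => if ∀ i ∈ S, x i = 1 then (4 : ℝ) else 0) (fun T _ => by positivity) hS)
      rw [if_pos hx]
    nlinarith [norm_nonneg ((∏ S ∈ F, czPhase S x) - 1)]
  · push Not at h
    rw [Finset.prod_eq_one]
    · rw [sub_self, norm_zero, zero_pow two_ne_zero]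
      exact Finset.sum_nonneg fun _ _ => by positivity
    · intro S hS
      obtain ⟨i, hi, hx⟩ := h S hS
      exact if_neg fun h => hx (h i hi)

/-- A gate wider than `k` fires on less than a fraction 2^(-k) of the basis states, and disjointness
allows at most `n` gates. This smallness is specific to the averaged norm; in operator norm a wide
gate is as far from 1 as a narrow one. -/
theorem hsNorm_layer_sub_le (L : CZLayer n) (k : ℕ) :
    hsNorm (L.op - (L.narrow k).op) ≤ 2 * Real.sqrt (n * (1 / 2) ^ k) := by
  refine le_of_sq_le_sq ?_ (by positivity)
  rw [mul_pow, Real.sq_sqrt (by positivity), hsNorm_sq]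
  set F := L.gates.filter fun S => ¬ S.card ≤ k with hF
  have h1 : ∀ x y, ‖(L.op - (L.narrow k).op) x y‖ ^ 2 =
      if x = y then ‖(∏ S ∈ F, czPhase S x) - 1‖ ^ 2 else 0 := by
    intro x y
    rw [CZLayer.op, CZLayer.op, Matrix.diagonal_sub, Matrix.diagonal_apply]
    split
    · rw [← Finset.prod_filter_mul_prod_filter_not L.gates (fun S => S.card ≤ k)]
      change ‖(∏ S ∈ (L.narrow k).gates, czPhase S x) * (∏ S ∈ F, czPhase S x) -
        ∏ S ∈ (L.narrow k).gates, czPhase S x‖ ^ 2 = _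
      rw [← mul_sub_one, norm_mul, norm_prod_czPhase, one_mul]
    · simp
  simp only [h1, Finset.sum_ite_eq, Finset.mem_univ, if_true]
  have h2 : ∑ x : Bits n, ‖(∏ S ∈ F, czPhase S x) - 1‖ ^ 2 ≤ n * (4 * (2 ^ n * (1 / 2) ^ k)) := by
    refine (Finset.sum_le_sum fun x _ => sq_norm_prod_sub_one_le F x).trans ?_
    rw [Finset.sum_comm]
    have h3 : ∀ S ∈ F, (∑ x : Bits n, if ∀ i ∈ S, x i = 1 then (4 : ℝ) else 0) ≤
        4 * (2 ^ n * (1 / 2) ^ k) := by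
      intro S hS
      rw [← Finset.sum_filter, Finset.sum_const, nsmul_eq_mul, card_ones, mul_comm]
      refine mul_le_mul_of_nonneg_left (mul_le_mul_of_nonneg_left ?_ (by positivity)) (by norm_num)
      exact pow_le_pow_of_le_one (by norm_num) (by norm_num) (not_le.1 (Finset.mem_filter.1 hS).2).le
    refine (Finset.sum_le_card_nsmul _ _ _ h3).trans ?_
    rw [nsmul_eq_mul]
    refine mul_le_mul_of_nonneg_right ?_ (by positivity)
    exact_mod_cast (Finset.card_filter_le _ _).trans (card_gates_le L)
  have h4 : (Fintype.card (Bits n) : ℝ) = 2 ^ n := by simp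
  rw [h4]
  refine (mul_le_mul_of_nonneg_left h2 (by positivity)).trans (le_of_eq ?_)
  field_simp
  norm_num

theorem hsNorm_narrow_sub_le (k : ℕ) {d : ℕ} (C : QACCircuit n d) :
    hsNorm ((C.unitary : Op n) - ((C.narrow k).unitary : Op n)) ≤
      d * (2 * Real.sqrt (n * (1 / 2) ^ k)) := by
  induction C with
  | single u => simp [QACCircuit.narrow]
  | layer C L u ih =>
    rename_i d
    have h : ((QACCircuit.layer C L u).unitary : Op n) - ((QACCircuit.layer C L u).narrow k).unitary =
        (tensorUnitary u : Op n) * ((L.op - (L.narrow k).op) * (C.unitary : Op n) +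
          (L.narrow k).op * ((C.unitary : Op n) - ((C.narrow k).unitary : Op n))) := by
      simp only [QACCircuit.narrow, QACCircuit.unitary, Submonoid.coe_mul, mul_sub, sub_mul, mul_add,
        mul_assoc]
      abel
    rw [h, hsNorm_unitary_mul (tensorUnitary u).2]
    refine (hsNorm_add_le _ _).trans ?_
    rw [hsNorm_mul_unitary C.unitary.2, hsNorm_unitary_mul (L.narrow k).op_mem]
    push_cast
    linarith [hsNorm_layer_sub_le L k]

/-- The unitary occurs on both sides of the Pauli operator and is replaced on one side at a time. -/
theorem hsNorm_heisenberg_sub_le (C D : UnitaryOp n) (i : Fin n) (c : Fin 4) :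
    hsNorm (heisenberg C i c - heisenberg D i c) ≤ 2 * hsNorm ((C : Op n) - (D : Op n)) := by
  have h : heisenberg C i c - heisenberg D i c =
      ((C : Op n) - (D : Op n)) * (single i (pauli c) * star (C : Op n)) +
        ((D : Op n) * single i (pauli c)) * star ((C : Op n) - (D : Op n)) := by
    simp only [heisenberg, star_sub, mul_sub, sub_mul, mul_assoc]
    abel
  have h1 : single i (pauli c) * star (C : Op n) ∈ Matrix.unitaryGroup (Bits n) ℂ :=
    mul_mem (single_pauli_mem i c) (star C).2
  have h2 : (D : Op n) * single i (pauli c) ∈ Matrix.unitaryGroup (Bits n) ℂ :=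
    mul_mem D.2 (single_pauli_mem i c)
  have h3 : ∀ A : Op n, hsNorm (star A) = hsNorm A := by
    intro A
    simp only [hsNorm, Matrix.star_apply, norm_star]
    rw [Finset.sum_comm]
  rw [h]
  refine (hsNorm_add_le _ _).trans ?_
  rw [hsNorm_mul_unitary h1, hsNorm_unitary_mul h2, h3, two_mul]

/-! ### The rows in memory -/

theorem weight_zero : weight (0 : Fin n → Fin 4) = 0 := by simp [weight]

theorem weight_update_of_ne_zero {Q : Fin n → Fin 4} {q : Fin n} (hq : Q q = 0) {c : Fin 4}
    (hc : c ≠ 0) : weight (Function.update Q q c) = weight Q + 1 := by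
  have : (Finset.univ.filter fun j => Function.update Q q c j ≠ 0) =
      insert q (Finset.univ.filter fun j => Q j ≠ 0) := by
    ext j
    by_cases hj : j = q
    · subst hj; simp [hc]
    · simp [hj]
  rw [weight, this, Finset.card_insert_of_notMem (by simp [hq]), weight]

theorem mem_extendRow {l q : ℕ} {Q R : Fin n → Fin 4} : R ∈ extendRow l q Q ↔
    ∃ h : q < n, weight Q < l ∧ ∃ c, c ≠ 0 ∧ R = Function.update Q ⟨q, h⟩ c := by
  unfold extendRow
  split
  · rename_i h
    constructor
    · intro hR
      simp only [List.mem_cons, List.not_mem_nil, or_false] at hR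
      rcases hR with h' | h' | h'
      · exact ⟨h.1, h.2, 1, by decide, h'⟩
      · exact ⟨h.1, h.2, 2, by decide, h'⟩
      · exact ⟨h.1, h.2, 3, by decide, h'⟩
    · rintro ⟨_, _, c, hc, rfl⟩
      simp only [List.mem_cons, List.not_mem_nil, or_false]
      fin_cases c
      · exact absurd rfl hc
      · exact Or.inl rfl
      · exact Or.inr (Or.inl rfl)
      · exact Or.inr (Or.inr rfl)
  · rename_i h
    simp only [List.not_mem_nil, false_iff]
    rintro ⟨h1, h2, _⟩
    exact h ⟨h1, h2⟩

theorem mem_pauliRows {l q : ℕ} {R : Fin n → Fin 4} :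
    R ∈ pauliRows n l q ↔ weight R ≤ l ∧ ∀ j : Fin n, q ≤ j → R j = 0 := by
  induction q generalizing R with
  | zero =>
    rw [pauliRows, List.mem_singleton]
    constructor
    · rintro rfl
      exact ⟨by simp [weight_zero], fun _ _ => rfl⟩
    · rintro ⟨-, h⟩
      funext j
      exact h j (Nat.zero_le _)
  | succ q ih =>
    rw [pauliRows, List.mem_append, List.mem_flatMap, ih]
    constructor
    · rintro (⟨h1, h2⟩ | ⟨Q, hQ, hR⟩)
      · exact ⟨h1, fun j hj => h2 j (by omega)⟩
      · obtain ⟨hq, hw, c, hc, rfl⟩ := mem_extendRow.1 hR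
        rw [ih] at hQ
        refine ⟨?_, fun j hj => ?_⟩
        · rw [weight_update_of_ne_zero (hQ.2 _ le_rfl) hc]
          exact hw
        · rw [Function.update_of_ne, hQ.2 j (by omega)]
          rintro rfl
          simp at hj
    · rintro ⟨h1, h2⟩
      by_cases hq : q < n
      · by_cases hR : R ⟨q, hq⟩ = 0
        · refine Or.inl ⟨h1, fun j hj => ?_⟩
          rcases Nat.eq_or_lt_of_le hj with h | h
          · rw [← hR]
            congr 1
            exact Fin.ext h.symm
          · exact h2 j h
        · have hup : R = Function.update (Function.update R ⟨q, hq⟩ 0) ⟨q, hq⟩ (R ⟨q, hq⟩) := by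
            rw [Function.update_idem, Function.update_eq_self]
          have hw := weight_update_of_ne_zero (Q := Function.update R ⟨q, hq⟩ 0) (q := ⟨q, hq⟩)
            (by simp) hR
          rw [← hup] at hw
          refine Or.inr ⟨Function.update R ⟨q, hq⟩ 0, ih.2 ⟨by omega, fun j hj => ?_⟩,
            mem_extendRow.2 ⟨hq, by omega, _, hR, hup⟩⟩
          by_cases hjq : j = ⟨q, hq⟩
          · subst hjq; simp
          · rw [Function.update_of_ne hjq]
            refine h2 j ?_
            have : (j : ℕ) ≠ q := fun h => hjq (Fin.ext h)
            omega
      · exact Or.inl ⟨h1, fun j hj => absurd j.2 (by omega)⟩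

/-- A string added in stage `q` has a nontrivial letter at `q`, where all earlier strings are
trivial. Erasing this letter recovers the string it came from. -/
theorem nodup_pauliRows (n l q : ℕ) : (pauliRows n l q).Nodup := by
  induction q with
  | zero => simp [pauliRows]
  | succ q ih =>
    rw [pauliRows, List.nodup_append]
    refine ⟨ih, ?_, ?_⟩
    · rw [List.nodup_flatMap]
      constructor
      · intro Q hQ
        unfold extendRow
        split
        · rename_i h
          have hinj := Function.update_injective Q ⟨q, h.1⟩
          simp [hinj.eq_iff]
        · simp
      · refine ih.pairwise_of_forall_ne fun Q hQ R hR hne => ?_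
        intro S hS hS'
        obtain ⟨hq, -, c, -, rfl⟩ := mem_extendRow.1 hS
        obtain ⟨_, -, c', -, h⟩ := mem_extendRow.1 hS'
        refine hne (funext fun j => ?_)
        by_cases hj : j = ⟨q, hq⟩
        · subst hj
          rw [(mem_pauliRows.1 hQ).2 _ le_rfl, (mem_pauliRows.1 hR).2 _ le_rfl]
        · have := congrFun h j
          rwa [Function.update_of_ne hj, Function.update_of_ne hj] at this
    · intro Q hQ R hR h
      subst h
      obtain ⟨S, hS, hR⟩ := List.mem_flatMap.1 hR
      obtain ⟨hq, -, c, hc, rfl⟩ := mem_extendRow.1 hR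
      have := (mem_pauliRows.1 hQ).2 ⟨q, hq⟩ le_rfl
      rw [Function.update_self] at this
      exact hc this

theorem toFinset_pauliRows (n l : ℕ) : (pauliRows n l n).toFinset =
    Finset.univ.filter fun Q : Fin n → Fin 4 => weight Q ≤ l := by
  ext Q
  rw [List.mem_toFinset, mem_pauliRows]
  simp only [Finset.mem_filter, Finset.mem_univ, true_and]
  exact ⟨fun h => h.1, fun h => ⟨h, fun j hj => absurd j.2 (by omega)⟩⟩

/-- Each string of weight at most `l + 1` arises from one of weight at most `l` by changing one
entry, for which there are `4 * n` choices. -/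
theorem card_weight_le (hn : 1 ≤ n) (l : ℕ) :
    (Finset.univ.filter fun Q : Fin n → Fin 4 => weight Q ≤ l).card ≤ (4 * n) ^ l := by
  induction l with
  | zero =>
    rw [pow_zero]
    refine Finset.card_le_one.2 fun Q hQ R hR => ?_
    have h : ∀ Q ∈ (Finset.univ.filter fun Q : Fin n → Fin 4 => weight Q ≤ 0), Q = 0 := by
      intro Q hQ
      simp only [Finset.mem_filter, Finset.mem_univ, true_and, Nat.le_zero, weight,
        Finset.card_eq_zero, Finset.filter_eq_empty_iff, not_not] at hQ
      funext q
      exact hQ trivial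
    rw [h Q hQ, h R hR]
  | succ l ih =>
    have hsub : (Finset.univ.filter fun Q : Fin n → Fin 4 => weight Q ≤ l + 1) ⊆
        ((Finset.univ.filter fun Q : Fin n → Fin 4 => weight Q ≤ l) ×ˢ
          (Finset.univ : Finset (Fin n × Fin 4))).image
          fun x => Function.update x.1 x.2.1 x.2.2 := by
      intro Q hQ
      simp only [Finset.mem_filter, Finset.mem_univ, true_and] at hQ
      rw [Finset.mem_image]
      by_cases h : ∃ q, Q q ≠ 0
      · obtain ⟨q, hq⟩ := h
        have hup : Q = Function.update (Function.update Q q 0) q (Q q) := by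
          rw [Function.update_idem, Function.update_eq_self]
        have hw := weight_update_of_ne_zero (Q := Function.update Q q 0) (q := q) (by simp) hq
        rw [← hup] at hw
        refine ⟨(Function.update Q q 0, q, Q q), ?_, hup.symm⟩
        simp only [Finset.mem_product, Finset.mem_filter, Finset.mem_univ, true_and, and_true]
        omega
      · push Not at h
        obtain rfl : Q = 0 := funext h
        refine ⟨(0, ⟨0, hn⟩, 0), by simp [weight_zero], ?_⟩
        exact Function.update_eq_self _ _
    refine (Finset.card_le_card hsub).trans (Finset.card_image_le.trans ?_)
    rw [Finset.card_product, Finset.card_univ, Fintype.card_prod, Fintype.card_fin, Fintype.card_fin,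
      pow_succ, mul_comm 4 n]
    exact Nat.mul_le_mul (by rw [mul_comm n 4]; exact ih) le_rfl

theorem length_pauliRows_le (hn : 1 ≤ n) (l : ℕ) : (pauliRows n l n).length ≤ (4 * n) ^ l := by
  rw [← List.toFinset_card_of_nodup (nodup_pauliRows n l n), toFinset_pauliRows]
  exact card_weight_le hn l

theorem one_le_length_pauliRows (n l q : ℕ) : 1 ≤ (pauliRows n l q).length :=
  List.length_pos_of_mem (mem_pauliRows.2 ⟨by simp [weight_zero], fun _ _ => rfl⟩ :
    (0 : Fin n → Fin 4) ∈ _)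

/-- The Pauli strings of bounded weight suffice to approximate the Heisenberg operators. -/
theorem tailBound {k d : ℕ} (hk : 1 ≤ k) (C : QACCircuit n d) :
    TailBound C.unitary (pauliRows n (k ^ d) n) (2 * (d * (2 * Real.sqrt (n * (1 / 2) ^ k)))) := by
  intro i P
  obtain ⟨M, hM, h⟩ := exists_light_cone hk C i P.index
  have h1 := supportedOn_le_span_pauliString hM h
  rw [Submodule.mem_span_image_finset_iff_exists_fun'] at h1
  obtain ⟨b, hb⟩ := h1
  rw [← List.sum_toFinset _ (nodup_pauliRows n (k ^ d) n), toFinset_pauliRows]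
  generalize (Finset.univ.filter fun Q : Fin n → Fin 4 => weight Q ≤ k ^ d) = F at hb ⊢
  -- The measured coefficients belong to the full circuit, while `b` expands the Heisenberg operator
  -- of the narrowed one. By best approximation the former do at least as well, so the narrowed
  -- circuit never has to be known.
  have h2 := hsNorm_sub_sum_le F pauliString (heisenberg C.unitary i P.index)
    (fun Q => ((correlation C.unitary i P Q : ℝ) : ℂ)) b
    (fun Q _ => correlation_eq_trace C.unitary i P Q) fun Q _ R _ => trace_pauliString_mul Q R
  refine h2.trans ?_
  rw [hb]
  exact (hsNorm_heisenberg_sub_le _ _ _ _).trans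
    (mul_le_mul_of_nonneg_left (hsNorm_narrow_sub_le k C) (by norm_num))

end

section

/-! ### Second moments of the Haar measure -/

variable {m : ℕ}

/-- The action of a linear isometry on pure states. -/
def isometryMap (e : EuclideanSpace ℂ (Bits m) ≃ₗᵢ[ℝ] EuclideanSpace ℂ (Bits m))
    (ψ : PureState m) : PureState m :=
  ⟨e ψ.1, by rw [mem_sphere_zero_iff_norm, e.norm_map, norm_eq_of_mem_sphere]⟩

theorem continuous_isometryMap (e : EuclideanSpace ℂ (Bits m) ≃ₗᵢ[ℝ] EuclideanSpace ℂ (Bits m)) :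
    Continuous (isometryMap e) :=
  (e.continuous.comp continuous_subtype_val).subtype_mk _

open scoped Pointwise in
-- The measure of a set on the sphere is proportional to the volume of the cone over it. An isometry
-- maps cones to cones and preserves volume.
theorem measurePreserving_isometryMap
    (e : EuclideanSpace ℂ (Bits m) ≃ₗᵢ[ℝ] EuclideanSpace ℂ (Bits m)) :
    MeasurePreserving (isometryMap e) (haarState m) (haarState m) := by
  have hmeas := (continuous_isometryMap e).measurable
  refine ⟨hmeas, ?_⟩
  ext s hs
  rw [Measure.map_apply hmeas hs, haarState, Measure.smul_apply, Measure.smul_apply,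
    Measure.toSphere_apply' _ (hmeas hs), Measure.toSphere_apply' _ hs]
  congr 2
  have hset : Set.Ioo (0 : ℝ) 1 • ((↑) '' (isometryMap e ⁻¹' s) : Set (EuclideanSpace ℂ (Bits m))) =
      e ⁻¹' (Set.Ioo (0 : ℝ) 1 • ((↑) '' s)) := by
    ext v
    simp only [Set.mem_smul, Set.mem_image, Set.mem_preimage]
    constructor
    · rintro ⟨r, hr, _, ⟨ψ, hψ, rfl⟩, rfl⟩
      exact ⟨r, hr, _, ⟨_, hψ, rfl⟩, (e.map_smul r ψ.1).symm⟩
    · rintro ⟨r, hr, _, ⟨ψ, hψ, rfl⟩, h⟩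
      refine ⟨r, hr, e.symm ψ.1, ⟨isometryMap e.symm ψ, ?_, rfl⟩, ?_⟩
      · convert hψ using 1
        exact Subtype.ext (e.apply_symm_apply _)
      · apply e.injective
        rw [e.map_smul, e.apply_symm_apply, h]
  rw [hset]
  exact e.measurePreserving.measure_preimage_equiv (f := e.toMeasurableEquiv) _

theorem integrable_of_continuous {f : PureState m → ℂ} (hf : Continuous f) :
    Integrable f (haarState m) :=
  hf.integrable_of_hasCompactSupport (HasCompactSupport.of_compactSpace f)

theorem continuous_coord (x : Bits m) : Continuous fun ψ : PureState m => ψ.1 x := by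
  fun_prop

theorem integral_isometryMap (e : EuclideanSpace ℂ (Bits m) ≃ₗᵢ[ℝ] EuclideanSpace ℂ (Bits m))
    {f : PureState m → ℂ} (hf : Continuous f) :
    ∫ ψ, f (isometryMap e ψ) ∂haarState m = ∫ ψ, f ψ ∂haarState m := by
  have h := measurePreserving_isometryMap e
  conv_rhs => rw [← h.map_eq]
  rw [integral_map h.measurable.aemeasurable hf.aestronglyMeasurable]

/-- Changing the sign of the coordinate `x` negates the integrand. -/
theorem integral_mul_conj_of_ne {x y : Bits m} (h : x ≠ y) :
    ∫ ψ, ψ.1 x * star (ψ.1 y) ∂haarState m = 0 := by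
  let e : EuclideanSpace ℂ (Bits m) ≃ₗᵢ[ℝ] EuclideanSpace ℂ (Bits m) :=
    LinearIsometryEquiv.piLpCongrRight 2 fun z =>
      if z = x then LinearIsometryEquiv.neg ℝ else LinearIsometryEquiv.refl ℝ ℂ
  have h1 := integral_isometryMap e (f := fun ψ => ψ.1 x * star (ψ.1 y))
    ((continuous_coord x).mul (continuous_coord y).star)
  have h2 : ∀ ψ : PureState m, (isometryMap e ψ).1 x * star ((isometryMap e ψ).1 y) =
      -(ψ.1 x * star (ψ.1 y)) := by
    intro ψ
    simp [isometryMap, e, h.symm]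
  simp only [h2, integral_neg] at h1
  have h3 : (2 : ℂ) * ∫ ψ, ψ.1 x * star (ψ.1 y) ∂haarState m = 0 := by
    linear_combination -h1
  simpa using h3

/-- Exchanging coordinates shows that all these moments agree, and they sum to 1 on the unit sphere.
-/
theorem integral_mul_conj_self (x : Bits m) :
    ∫ ψ, ψ.1 x * star (ψ.1 x) ∂haarState m = (Fintype.card (Bits m) : ℂ)⁻¹ := by
  have h1 : ∀ y, ∫ ψ, ψ.1 y * star (ψ.1 y) ∂haarState m = ∫ ψ, ψ.1 x * star (ψ.1 x) ∂haarState m := by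
    intro y
    let e : EuclideanSpace ℂ (Bits m) ≃ₗᵢ[ℝ] EuclideanSpace ℂ (Bits m) :=
      LinearIsometryEquiv.piLpCongrLeft 2 ℝ ℂ (Equiv.swap x y)
    have h2 := integral_isometryMap e (f := fun ψ => ψ.1 y * star (ψ.1 y))
      ((continuous_coord y).mul (continuous_coord y).star)
    rw [← h2]
    have h3 : ∀ ψ : PureState m, (isometryMap e ψ).1 y = ψ.1 x := by
      intro ψ
      simp [isometryMap, e, LinearIsometryEquiv.piLpCongrLeft_apply, Equiv.piCongrLeft']
    simp only [h3]
  have h2 : ∀ ψ : PureState m, ∑ y, ψ.1 y * star (ψ.1 y) = 1 := by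
    intro ψ
    have h := EuclideanSpace.norm_sq_eq ψ.1
    rw [norm_eq_of_mem_sphere, one_pow] at h
    simp only [Complex.star_def, Complex.mul_conj']
    exact_mod_cast h.symm
  have h3 : ∑ y, ∫ ψ, ψ.1 y * star (ψ.1 y) ∂haarState m = 1 := by
    rw [← integral_finsetSum]
    · simp only [h2]
      simp
    · intro y _
      exact integrable_of_continuous ((continuous_coord y).mul (continuous_coord y).star)
  simp only [h1, Finset.sum_const, Finset.card_univ, nsmul_eq_mul] at h3
  exact eq_inv_of_mul_eq_one_right h3

/-- The Haar average of the squared length of `A ψ`. -/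
theorem integral_sum_normSq (A : Op m) :
    ∫ ψ : PureState m, (∑ i, ‖∑ x, A i x * ψ.1 x‖ ^ 2 : ℝ) ∂haarState m = hsNorm A ^ 2 := by
  have h1 : ∀ ψ : PureState m, ((∑ i, ‖∑ x, A i x * ψ.1 x‖ ^ 2 : ℝ) : ℂ) =
      ∑ i, ∑ x, ∑ y, (A i x * star (A i y)) * (ψ.1 x * star (ψ.1 y)) := by
    intro ψ
    push_cast
    refine Finset.sum_congr rfl fun i _ => ?_
    rw [← Complex.mul_conj', map_sum, Finset.sum_mul_sum]
    refine Finset.sum_congr rfl fun x _ => Finset.sum_congr rfl fun y _ => ?_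
    rw [map_mul]
    simp only [Complex.star_def]
    ring
  have hint : ∀ i x y, Integrable (fun ψ : PureState m =>
      (A i x * star (A i y)) * (ψ.1 x * star (ψ.1 y))) (haarState m) := fun i x y =>
    (integrable_of_continuous ((continuous_coord x).mul (continuous_coord y).star)).const_mul _
  have h2 : ∀ x y, ∫ ψ : PureState m, ψ.1 x * star (ψ.1 y) ∂haarState m =
      if x = y then (Fintype.card (Bits m) : ℂ)⁻¹ else 0 := by
    intro x y
    split
    · rename_i h
      subst h
      exact integral_mul_conj_self x
    · rename_i h
      exact integral_mul_conj_of_ne h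
  have h3 : ((∫ ψ : PureState m, (∑ i, ‖∑ x, A i x * ψ.1 x‖ ^ 2 : ℝ) ∂haarState m : ℝ) : ℂ) =
      ((hsNorm A ^ 2 : ℝ) : ℂ) := by
    rw [← integral_complex_ofReal]
    simp only [h1]
    rw [integral_finsetSum _ fun i _ => integrable_finsetSum _ fun x _ =>
      integrable_finsetSum _ fun y _ => hint i x y]
    simp only [integral_finsetSum _ fun x _ => integrable_finsetSum _ fun y _ => hint _ x y,
      integral_finsetSum _ fun y _ => hint _ _ y, integral_const_mul, h2, mul_ite, mul_zero,
      Finset.sum_ite_eq, Finset.mem_univ, if_true]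
    rw [hsNorm_sq]
    push_cast
    rw [Finset.mul_sum]
    refine Finset.sum_congr rfl fun i _ => ?_
    rw [Finset.mul_sum]
    refine Finset.sum_congr rfl fun x _ => ?_
    rw [Complex.star_def, Complex.mul_conj', mul_comm]
  exact_mod_cast h3

/-! ### The average-case distance -/

open scoped MatrixOrder ComplexOrder in
theorem sqrt_smul_projection {ι : Type} [Fintype ι] [DecidableEq ι] {ρ : Matrix ι ι ℂ}
    (hρ : ρ * ρ = ρ) (hpos : ρ.PosSemidef) {r : ℝ} (hr : 0 ≤ r) :
    CFC.sqrt (((r ^ 2 : ℝ) : ℂ) • ρ) = (r : ℂ) • ρ := by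
  refine CFC.sqrt_unique ?_ ?_
  · rw [smul_mul_smul_comm, hρ]
    push_cast
    rw [pow_two]
  · rw [Matrix.nonneg_iff_posSemidef]
    exact hpos.smul (by exact_mod_cast hr)

open scoped MatrixOrder ComplexOrder in
-- For a unit vector φ the projection ρ is its own root and ρσρ = |⟨φ, χ⟩|² ρ, so both square roots
-- are explicit.
theorem fidelity_vecMulVec {ι : Type} [Fintype ι] [DecidableEq ι] (φ χ : ι → ℂ)
    (hφ : star φ ⬝ᵥ φ = 1) :
    fidelity (vecMulVec φ (star φ)) (vecMulVec χ (star χ)) = ‖star φ ⬝ᵥ χ‖ ^ 2 := by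
  have hproj : vecMulVec φ (star φ) * vecMulVec φ (star φ) = vecMulVec φ (star φ) := by
    rw [Matrix.vecMulVec_mul_vecMulVec, hφ, one_smul]
  have hpos := Matrix.posSemidef_vecMulVec_self_star φ
  have h1 : CFC.sqrt (vecMulVec φ (star φ)) = vecMulVec φ (star φ) := by
    have := sqrt_smul_projection hproj hpos (zero_le_one)
    simpa using this
  have h2 : vecMulVec φ (star φ) * vecMulVec χ (star χ) * vecMulVec φ (star φ) =
      ((‖star φ ⬝ᵥ χ‖ ^ 2 : ℝ) : ℂ) • vecMulVec φ (star φ) := by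
    have h3 : star χ ⬝ᵥ φ = star (star φ ⬝ᵥ χ) := by
      rw [Matrix.star_dotProduct]
    rw [Matrix.vecMulVec_mul_vecMulVec, Matrix.vecMulVec_mul_vecMulVec]
    rw [smul_dotProduct, Matrix.vecMulVec_smul, h3, smul_eq_mul, Complex.star_def,
      Complex.mul_conj']
    push_cast
    rfl
  rw [fidelity, h1, h2, sqrt_smul_projection hproj hpos (norm_nonneg _), Matrix.trace_smul,
    Matrix.trace_vecMulVec, dotProduct_comm φ, hφ]
  simp

theorem sum_normSq_sub_smul {ι : Type} [Fintype ι] (φ χ : ι → ℂ) (hφ : star φ ⬝ᵥ φ = 1)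
    (hχ : star χ ⬝ᵥ χ = 1) {c : ℂ} (hc : ‖c‖ = 1) :
    ∑ i, ‖φ i - c * χ i‖ ^ 2 = 2 - 2 * (c * (star φ ⬝ᵥ χ)).re := by
  have h1 : ((∑ i, ‖φ i - c * χ i‖ ^ 2 : ℝ) : ℂ) = star (φ - c • χ) ⬝ᵥ (φ - c • χ) := by
    rw [dotProduct]
    push_cast
    refine Finset.sum_congr rfl fun i _ => ?_
    rw [← Complex.conj_mul']
    rfl
  have h2 : star χ ⬝ᵥ φ = star (star φ ⬝ᵥ χ) := by
    rw [Matrix.star_dotProduct]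
  have h3 : star c * c = 1 := by
    rw [Complex.star_def, Complex.conj_mul', hc]
    norm_num
  have h4 : star (φ - c • χ) ⬝ᵥ (φ - c • χ) =
      2 - (c * (star φ ⬝ᵥ χ) + star (c * (star φ ⬝ᵥ χ))) := by
    rw [star_sub, star_smul, sub_dotProduct, dotProduct_sub, dotProduct_sub, smul_dotProduct,
      smul_dotProduct, dotProduct_smul, dotProduct_smul, hφ, hχ, h2, star_mul]
    simp only [smul_eq_mul]
    linear_combination h3
  have h5 := congrArg Complex.re (h1.trans h4)
  rw [Complex.ofReal_re] at h5
  rw [h5]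
  simp
  ring

theorem ketbra_channel (U : UnitaryOp m) (ψ : PureState m) : unitaryChannel U (ketbra ψ) =
    vecMulVec ((U : Op m) *ᵥ ψ.1) (star ((U : Op m) *ᵥ ψ.1)) := by
  have : ketbra ψ = vecMulVec ψ.1 (star (ψ.1 : Bits m → ℂ)) := rfl
  rw [unitaryChannel, this, Matrix.mul_vecMulVec, Matrix.vecMulVec_mul, Matrix.star_mulVec,
    Matrix.star_eq_conjTranspose]

theorem star_mulVec_dotProduct (U : UnitaryOp m) (ψ : PureState m) :
    star ((U : Op m) *ᵥ ψ.1) ⬝ᵥ ((U : Op m) *ᵥ ψ.1) = 1 := by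
  rw [Matrix.star_mulVec, ← Matrix.star_eq_conjTranspose, Matrix.dotProduct_mulVec,
    Matrix.vecMul_vecMul, Matrix.mem_unitaryGroup_iff'.1 U.2, Matrix.vecMul_one]
  have h := EuclideanSpace.norm_sq_eq ψ.1
  rw [norm_eq_of_mem_sphere, one_pow] at h
  rw [dotProduct]
  simp only [Pi.star_apply, Complex.star_def, Complex.conj_mul']
  exact_mod_cast h.symm

/-- Unitaries that are close in the Hilbert–Schmidt norm have a small average-case distance. -/
theorem Near.avgDist_le {U V : UnitaryOp m} {e : ℝ} (h : Near e (U : Op m) (V : Op m)) :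
    avgDist U V ≤ e ^ 2 := by
  obtain ⟨c, hc, h⟩ := h
  have hpoint : ∀ (ψ : PureState m), ∀ b : ℂ, ‖b‖ = 1 →
      (∑ i, ‖∑ x, ((U : Op m) - b • (V : Op m)) i x * ψ.1 x‖ ^ 2 : ℝ) =
        2 - 2 * (b * (star ((U : Op m) *ᵥ ψ.1) ⬝ᵥ ((V : Op m) *ᵥ ψ.1))).re := by
    intro ψ b hb
    rw [← sum_normSq_sub_smul _ _ (star_mulVec_dotProduct U ψ) (star_mulVec_dotProduct V ψ) hb]
    refine Finset.sum_congr rfl fun i _ => ?_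
    congr 2
    rw [Matrix.mulVec, Matrix.mulVec, dotProduct, dotProduct, Finset.mul_sum, ← Finset.sum_sub_distrib]
    refine Finset.sum_congr rfl fun x _ => ?_
    rw [Matrix.sub_apply, Matrix.smul_apply, smul_eq_mul, sub_mul, mul_assoc]
  have hfid : ∀ ψ : PureState m, fidelity (unitaryChannel U (ketbra ψ)) (unitaryChannel V (ketbra ψ)) =
      ‖star ((U : Op m) *ᵥ ψ.1) ⬝ᵥ ((V : Op m) *ᵥ ψ.1)‖ ^ 2 := by
    intro ψ
    rw [ketbra_channel, ketbra_channel, fidelity_vecMulVec _ _ (star_mulVec_dotProduct U ψ)]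
  -- Cauchy–Schwarz, from the nonnegativity of `hpoint` for the phase that makes the inner product
  -- real and nonnegative.
  have hle : ∀ ψ : PureState m, ‖star ((U : Op m) *ᵥ ψ.1) ⬝ᵥ ((V : Op m) *ᵥ ψ.1)‖ ≤ 1 := by
    intro ψ
    obtain ⟨b, hb, hb'⟩ := Complex.exists_norm_eq_mul_self
      (star ((U : Op m) *ᵥ ψ.1) ⬝ᵥ ((V : Op m) *ᵥ ψ.1))
    have h1 := hpoint ψ b hb
    rw [← hb', Complex.ofReal_re] at h1
    have h2 : (0 : ℝ) ≤ ∑ i, ‖∑ x, ((U : Op m) - b • (V : Op m)) i x * ψ.1 x‖ ^ 2 := by positivity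
    linarith
  have hsq : hsNorm ((U : Op m) - c • (V : Op m)) ^ 2 ≤ e ^ 2 := by
    gcongr
    exact hsNorm_nonneg _
  refine le_trans ?_ hsq
  rw [← integral_sum_normSq, avgDist, channelDist]
  refine integral_mono_of_nonneg (Filter.Eventually.of_forall fun ψ => ?_) ?_
    (Filter.Eventually.of_forall fun ψ => ?_)
  · simp only [Pi.zero_apply, hfid]
    nlinarith [hle ψ, norm_nonneg (star ((U : Op m) *ᵥ ψ.1) ⬝ᵥ ((V : Op m) *ᵥ ψ.1))]
  · refine Continuous.integrable_of_hasCompactSupport ?_ (HasCompactSupport.of_compactSpace _)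
    have := fun x => continuous_coord (m := m) x
    fun_prop
  · simp only [hfid]
    rw [hpoint ψ c hc]
    have h1 := (Complex.re_le_norm (c * (star ((U : Op m) *ᵥ ψ.1) ⬝ᵥ ((V : Op m) *ᵥ ψ.1))))
    rw [norm_mul, hc, one_mul] at h1
    -- With x the modulus of the inner product, 1 - x² ≤ 2 - 2x because (1 - x)² ≥ 0.
    nlinarith [sq_nonneg (1 - ‖star ((U : Op m) *ᵥ ψ.1) ⬝ᵥ ((V : Op m) *ᵥ ψ.1)‖)]

end

section

/-! ### The choice of the parameters -/

/-- The width parameter for depth `d` and a polynomial bounded by `n ↦ 2 ^ (s * bitLen n)`. -/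
def widthFactor (d s : ℕ) : ℕ := 2 * (20 + d + s)

theorem widthFactor_pos (d s : ℕ) : 0 < widthFactor d s := by unfold widthFactor; omega

theorem bitLen_pos (n : ℕ) : 1 ≤ bitLen n := by unfold bitLen; omega

theorem le_two_pow_bitLen (n : ℕ) : n ≤ 2 ^ bitLen n :=
  (Nat.lt_pow_succ_log_self (by norm_num) n).le

theorem coneSize_pos {c : ℕ} (hc : 0 < c) (d n : ℕ) : 1 ≤ coneSize c d n :=
  Nat.one_le_pow _ _ (Nat.mul_pos hc (bitLen_pos n))

theorem length_pauliRows_le_two_pow {n : ℕ} (hn : 1 ≤ n) (l : ℕ) :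
    (pauliRows n l n).length ≤ 2 ^ (3 * (bitLen n * l)) := by
  refine (length_pauliRows_le hn l).trans ?_
  rw [← mul_assoc, pow_mul]
  refine Nat.pow_le_pow_left ?_ l
  have hb := bitLen_pos n
  calc 4 * n ≤ 2 ^ 2 * 2 ^ bitLen n := by have := le_two_pow_bitLen n; omega
    _ = 2 ^ (2 + bitLen n) := (pow_add _ _ _).symm
    _ ≤ 2 ^ (3 * bitLen n) := Nat.pow_le_pow_right (by norm_num) (by omega)

/-- Nonnegative coefficients give p(n) ≤ p(1) n^deg for n ≥ 1; this fixes the precision exponent in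
the main theorem. -/
theorem eval_le_two_pow (p : Polynomial ℕ) {n : ℕ} (hn : 1 ≤ n) :
    p.eval n ≤ 2 ^ (bitLen n * (p.eval 1 + p.natDegree)) := by
  have hb := bitLen_pos n
  have h1 : p.eval n ≤ p.eval 1 * n ^ p.natDegree := by
    rw [Polynomial.eval_eq_sum_range, Polynomial.eval_eq_sum_range, Finset.sum_mul]
    refine Finset.sum_le_sum fun i hi => ?_
    rw [one_pow, mul_one]
    exact Nat.mul_le_mul_left _ (Nat.pow_le_pow_right hn (by simpa [Nat.lt_succ_iff] using hi))
  refine h1.trans ?_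
  rw [mul_add, pow_add]
  refine Nat.mul_le_mul ?_ ?_
  · refine Nat.lt_two_pow_self.le.trans (Nat.pow_le_pow_right (by norm_num) ?_)
    exact Nat.le_mul_of_pos_left _ hb
  · rw [pow_mul]
    exact Nat.pow_le_pow_left (le_two_pow_bitLen n) _

theorem eval_pos {p : Polynomial ℕ} (hp : p ≠ 0) {n : ℕ} (hn : 1 ≤ n) : 0 < p.eval n := by
  rw [Polynomial.eval_eq_sum_range]
  refine lt_of_lt_of_le ?_ (Finset.single_le_sum (f := fun i => p.coeff i * n ^ i)
    (fun _ _ => Nat.zero_le _) (Finset.self_mem_range_succ p.natDegree))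
  have : p.coeff p.natDegree ≠ 0 := by simpa using hp
  positivity

/-- The bound on the entrywise Pauli-weight tail of a depth-`d` circuit. -/
def tailError (c d n : ℕ) : ℝ := 2 * (d * (2 * Real.sqrt (n * (1 / 2) ^ gateWidth c n)))

theorem tailError_nonneg (c d n : ℕ) : 0 ≤ tailError c d n := by unfold tailError; positivity

/-- The factor 2 in `widthFactor` pays for the square root. The remaining (20 + d + s) · b bits
cover 12, d, two factors n and the target 2^(bs+1). -/
theorem mul_tailError_le (d s n : ℕ) :
    n * (3 * tailError (widthFactor d s) d n) ≤ (1 / 2) ^ (bitLen n * s + 1) := by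
  have hb := bitLen_pos n
  have hn := le_two_pow_bitLen n
  set b := bitLen n
  have hsqrt : Real.sqrt (n * (1 / 2) ^ gateWidth (widthFactor d s) n) ≤
      n * (1 / 2) ^ ((20 + d + s) * b) := by
    refine Real.sqrt_le_iff.2 ⟨by positivity, ?_⟩
    rw [mul_pow, ← pow_mul, show gateWidth (widthFactor d s) n = (20 + d + s) * b * 2 by
      unfold gateWidth widthFactor; ring]
    refine mul_le_mul_of_nonneg_right ?_ (by positivity)
    exact_mod_cast Nat.le_self_pow (by norm_num) n
  have hd : d ≤ 2 ^ (d * b) :=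
    Nat.lt_two_pow_self.le.trans (Nat.pow_le_pow_right (by norm_num) (Nat.le_mul_of_pos_right _ hb))
  have hnat : 12 * d * n * n * 2 ^ (b * s + 1) ≤ 2 ^ ((20 + d + s) * b) := by
    calc 12 * d * n * n * 2 ^ (b * s + 1)
        ≤ 2 ^ 4 * 2 ^ (d * b) * 2 ^ b * 2 ^ b * 2 ^ (b * s + 1) := by gcongr; norm_num
      _ = 2 ^ (4 + d * b + b + b + (b * s + 1)) := by simp only [pow_add]
      _ ≤ 2 ^ ((20 + d + s) * b) := Nat.pow_le_pow_right (by norm_num) (by nlinarith)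
  have hreal : (12 * d * n * n * 2 ^ (b * s + 1) : ℝ) ≤ 2 ^ ((20 + d + s) * b) := by
    exact_mod_cast hnat
  calc n * (3 * tailError (widthFactor d s) d n)
      ≤ n * (3 * (2 * (d * (2 * (n * (1 / 2) ^ ((20 + d + s) * b)))))) := by
        unfold tailError; gcongr
    _ = 12 * d * n * n / 2 ^ ((20 + d + s) * b) := by rw [_root_.one_div_pow]; ring
    _ ≤ (1 / 2) ^ (b * s + 1) := by
      rw [_root_.one_div_pow, div_le_div_iff₀ (by positivity) (by positivity), one_mul]
      exact hreal

/-- The budget is split as ¼ for sampling, ½ for truncation and ¼ for the product formula. Both `τ`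
and 1/M are 1/B, and B exceeds the required power of the number of rows. -/
theorem learning_error_le (d s : ℕ) {n : ℕ} (hn : 1 ≤ n) :
    (n : ℝ) * (3 * ((pauliRows n (coneSize (widthFactor d s) d n) n).length *
        (1 / precision (widthFactor d s) d n) + tailError (widthFactor d s) d n) +
      16 * (pauliRows n (coneSize (widthFactor d s) d n) n).length ^ 2 /
        precision (widthFactor d s) d n) ≤ (1 / 2) ^ (bitLen n * s) := by
  have hb := bitLen_pos n
  have hnb := le_two_pow_bitLen n
  have htail := mul_tailError_le d s n
  have hN := length_pauliRows_le_two_pow hn (coneSize (widthFactor d s) d n)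
  have hl := coneSize_pos (widthFactor_pos d s) d n
  rw [show precision (widthFactor d s) d n =
    2 ^ (widthFactor d s * (bitLen n * coneSize (widthFactor d s) d n)) by
      unfold precision gateWidth; rw [mul_assoc]]
  generalize (pauliRows n (coneSize (widthFactor d s) d n) n).length = N at *
  generalize tailError (widthFactor d s) d n = κ at *
  generalize bitLen n = b at *
  have hm : b ≤ b * coneSize (widthFactor d s) d n := Nat.le_mul_of_pos_right _ hl
  generalize b * coneSize (widthFactor d s) d n = m at *
  have hbs : b * s ≤ m * s := Nat.mul_le_mul_right s hm
  have hexp : 40 * m + 2 * (m * s) ≤ widthFactor d s * m := by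
    unfold widthFactor; nlinarith [Nat.zero_le (d * m)]
  have h1 : 3 * n * N * 2 ^ (b * s + 2) ≤ 2 ^ (widthFactor d s * m) := by
    calc 3 * n * N * 2 ^ (b * s + 2)
        ≤ 2 ^ 2 * 2 ^ b * 2 ^ (3 * m) * 2 ^ (b * s + 2) := by gcongr; norm_num
      _ = 2 ^ (2 + b + 3 * m + (b * s + 2)) := by simp only [pow_add]
      _ ≤ 2 ^ (widthFactor d s * m) := Nat.pow_le_pow_right (by norm_num) (by omega)
  have h2 : 16 * n * N ^ 2 * 2 ^ (b * s + 2) ≤ 2 ^ (widthFactor d s * m) := by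
    calc 16 * n * N ^ 2 * 2 ^ (b * s + 2)
        ≤ 2 ^ 4 * 2 ^ b * (2 ^ (3 * m)) ^ 2 * 2 ^ (b * s + 2) := by gcongr; norm_num
      _ = 2 ^ (4 + b + 3 * m * 2 + (b * s + 2)) := by simp only [pow_add, pow_mul]
      _ ≤ 2 ^ (widthFactor d s * m) := Nat.pow_le_pow_right (by norm_num) (by omega)
  have h1' : (3 * n * N * 2 ^ (b * s + 2) : ℝ) ≤ 2 ^ (widthFactor d s * m) := by exact_mod_cast h1
  have h2' : (16 * n * N ^ 2 * 2 ^ (b * s + 2) : ℝ) ≤ 2 ^ (widthFactor d s * m) := by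
    exact_mod_cast h2
  have e1 : (3 * n * N / 2 ^ (widthFactor d s * m) : ℝ) ≤ (1 / 2) ^ (b * s + 2) := by
    rw [_root_.one_div_pow, div_le_div_iff₀ (by positivity) (by positivity), one_mul]
    exact h1'
  have e2 : (16 * n * N ^ 2 / 2 ^ (widthFactor d s * m) : ℝ) ≤ (1 / 2) ^ (b * s + 2) := by
    rw [_root_.one_div_pow, div_le_div_iff₀ (by positivity) (by positivity), one_mul]
    exact h2'
  rw [pow_add] at e1 e2 htail
  push_cast
  calc _ = (3 * n * N / 2 ^ (widthFactor d s * m) : ℝ) + n * (3 * κ) +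
        16 * n * N ^ 2 / 2 ^ (widthFactor d s * m) := by ring
    _ ≤ _ := by linarith

/-- One of the `L + 1` units of the exponent absorbs the prefactor and the others give the power of
½. The threshold is 512 = 2 · 16², from exp y ≥ y²/2 at y = x/16. -/
theorem exp_neg_mul_le {x : ℝ} (hx : 512 ≤ x) (L : ℕ) :
    x * Real.exp (-(x * (L + 1) / 16)) ≤ (1 / 2) ^ L := by
  have h1 : x ≤ Real.exp (x / 16) := by
    have := Real.quadratic_le_exp_of_nonneg (x := x / 16) (by linarith)
    nlinarith
  have h2 : Real.exp (-1) ≤ 1 / 2 := by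
    rw [Real.exp_neg, one_div]
    exact inv_anti₀ (by norm_num) (by linarith [Real.add_one_le_exp (1 : ℝ)])
  calc x * Real.exp (-(x * (L + 1) / 16))
      ≤ Real.exp (x / 16) * Real.exp (-(x * (L + 1) / 16)) := by gcongr
    _ = Real.exp (-(x * L / 16)) := by rw [← Real.exp_add]; ring_nf
    _ ≤ Real.exp (L * -1) := by
      refine Real.exp_le_exp.2 ?_
      have : (0 : ℝ) ≤ L := L.cast_nonneg
      nlinarith
    _ = Real.exp (-1) ^ L := Real.exp_nat_mul _ _
    _ ≤ (1 / 2) ^ L := pow_le_pow_left₀ (Real.exp_pos _).le h2 L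

theorem half_pow_ceil_logb_le {δ : ℝ} (h0 : 0 < δ) :
    (1 / 2 : ℝ) ^ ⌈Real.logb 2 (1 / δ)⌉₊ ≤ δ := by
  have h := Nat.le_ceil (Real.logb 2 (1 / δ))
  rw [Real.logb_le_iff_le_rpow (by norm_num) (by positivity), Real.rpow_natCast] at h
  rw [_root_.one_div_pow]
  rw [div_le_iff₀ h0] at h
  rw [div_le_iff₀ (by positivity)]
  linarith

/-- There are 3nBN estimates with τ = 1/B and T = B⁴(L + 1), so each fails with probability at most
2 exp(-B²(L + 1)/16). Since 6nN ≤ B the prefactor is at most B². -/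
theorem failure_le {d s n L : ℕ} (hn : 1 ≤ n) :
    (n : ℝ) * (precision (widthFactor d s) d n * (3 *
      ((pauliRows n (coneSize (widthFactor d s) d n) n).length *
        (2 * Real.exp (-((1 / (precision (widthFactor d s) d n : ℝ)) ^ 2 *
          (sampleCount (widthFactor d s) d n L : ℕ) / 16)))))) ≤ (1 / 2) ^ L := by
  have hb := bitLen_pos n
  have hnb := le_two_pow_bitLen n
  have hN := length_pauliRows_le_two_pow hn (coneSize (widthFactor d s) d n)
  have hl := coneSize_pos (widthFactor_pos d s) d n
  unfold sampleCount
  rw [show precision (widthFactor d s) d n =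
    2 ^ (widthFactor d s * (bitLen n * coneSize (widthFactor d s) d n)) by
      unfold precision gateWidth; rw [mul_assoc]]
  generalize (pauliRows n (coneSize (widthFactor d s) d n) n).length = N at *
  generalize bitLen n = b at *
  have hm : b ≤ b * coneSize (widthFactor d s) d n := Nat.le_mul_of_pos_right _ hl
  generalize b * coneSize (widthFactor d s) d n = m at *
  have hexp : 40 * m ≤ widthFactor d s * m := by
    unfold widthFactor; nlinarith [Nat.zero_le (d * m), Nat.zero_le (s * m)]
  have h1 : n * 6 * N ≤ 2 ^ (widthFactor d s * m) := by
    calc n * 6 * N ≤ 2 ^ b * 2 ^ 3 * 2 ^ (3 * m) := by gcongr; norm_num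
      _ = 2 ^ (b + 3 + 3 * m) := by simp only [pow_add]
      _ ≤ 2 ^ (widthFactor d s * m) := Nat.pow_le_pow_right (by norm_num) (by omega)
  have h2 : 512 ≤ 2 ^ (widthFactor d s * m) :=
    (by norm_num : 512 ≤ 2 ^ 9).trans (Nat.pow_le_pow_right (by norm_num) (by omega))
  generalize 2 ^ (widthFactor d s * m) = B at *
  have h1' : (n * 6 * N : ℝ) ≤ B := by exact_mod_cast h1
  have h2' : (512 : ℝ) ≤ B := by exact_mod_cast h2
  have h3 := exp_neg_mul_le (x := (B : ℝ) ^ 2) (by nlinarith) L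
  have h4 : (1 / (B : ℝ)) ^ 2 * ((B ^ 4 * (L + 1) : ℕ) : ℝ) / 16 = (B : ℝ) ^ 2 * (L + 1) / 16 := by
    push_cast; field_simp
  rw [h4]
  refine le_trans ?_ h3
  calc _ = (n * 6 * N : ℝ) * B * Real.exp (-((B : ℝ) ^ 2 * (L + 1) / 16)) := by ring
    _ ≤ B * B * Real.exp (-((B : ℝ) ^ 2 * (L + 1) / 16)) := by gcongr
    _ = _ := by ring

/-- Every size parameter is at most B. The dominant term n · B · N · (n T B²) contains four factors
bounded by B, next to T = B⁴(L + 1) and B², which gives the exponent 10. -/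
theorem totalTime_le {c d n : ℕ} (hc : 20 ≤ c) (hn : 1 ≤ n) (L : ℕ) :
    totalTime c d n L ≤ (3000 + 5 * d) * precision c d n ^ 10 * (L + 1) ∧
    n * (precision c d n * (3 * ((pauliRows n (coneSize c d n) n).length * sampleCount c d n L))) ≤
      (3000 + 5 * d) * precision c d n ^ 10 * (L + 1) := by
  have hb := bitLen_pos n
  have hnb := le_two_pow_bitLen n
  have hN := length_pauliRows_le_two_pow hn (coneSize c d n)
  have hl := coneSize_pos (by omega : 0 < c) d n
  unfold totalTime termCost sampleCount
  have hB : precision c d n = 2 ^ (c * (bitLen n * coneSize c d n)) := by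
    unfold precision gateWidth; rw [mul_assoc]
  have hg : gateWidth c n * coneSize c d n ≤ precision c d n := Nat.lt_two_pow_self.le
  have hm1 : bitLen n ≤ bitLen n * coneSize c d n := Nat.le_mul_of_pos_right _ hl
  have hm2 : coneSize c d n ≤ bitLen n * coneSize c d n := Nat.le_mul_of_pos_left _ hb
  have hm3 : 20 * (bitLen n * coneSize c d n) ≤ c * (bitLen n * coneSize c d n) :=
    Nat.mul_le_mul_right _ hc
  have hpow : ∀ {a : ℕ}, a ≤ 20 * (bitLen n * coneSize c d n) → 2 ^ a ≤ precision c d n :=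
    fun h => hB ▸ Nat.pow_le_pow_right (by norm_num) (h.trans hm3)
  have h1 : n ≤ precision c d n := hnb.trans (hpow (by omega))
  have h2 : bitLen n ≤ precision c d n := Nat.lt_two_pow_self.le.trans (hpow (by omega))
  have h3 : coneSize c d n ≤ precision c d n := Nat.lt_two_pow_self.le.trans (hpow (by omega))
  have h4 : (pauliRows n (coneSize c d n) n).length ≤ precision c d n :=
    hN.trans (hpow (by omega))
  generalize gateWidth c n * coneSize c d n = g at *
  generalize coneSize c d n = l at *
  generalize (pauliRows n l n).length = N at *
  have hB1 : 1 ≤ precision c d n := hn.trans h1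
  generalize precision c d n = B at *
  generalize bitLen n = b at *
  have hp : ∀ {i : ℕ}, i ≤ 10 → B ^ i ≤ B ^ 10 * (L + 1) := fun h =>
    (Nat.pow_le_pow_right hB1 h).trans (Nat.le_mul_of_pos_right _ L.succ_pos)
  have p0 := hp (i := 0) (by norm_num)
  have p1 := hp (i := 1) (by norm_num)
  have p2 := hp (i := 2) (by norm_num)
  have p3 := hp (i := 3) (by norm_num)
  have pL : L ≤ B ^ 10 * (L + 1) :=
    (Nat.le_succ L).trans (Nat.le_mul_of_pos_left _ (by positivity))
  have pd : d * l ≤ d * (B ^ 10 * (L + 1)) := Nat.mul_le_mul_left _ (h3.trans (by simpa using p1))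
  have pd' : d * 1 ≤ d * (B ^ 10 * (L + 1)) := Nat.mul_le_mul_left _ (by simpa using p0)
  have q1 : n * N ≤ B ^ 2 := by rw [pow_two]; exact Nat.mul_le_mul h1 h4
  have q2 : n * N * n ≤ B ^ 3 := by rw [pow_succ, pow_two]; gcongr
  have q3 : n * B ≤ B ^ 2 := by rw [pow_two]; exact Nat.mul_le_mul_right _ h1
  have q4 : n * B * N * (n * (B ^ 4 * (L + 1) * (B * B))) ≤ B ^ 10 * (L + 1) := by
    calc n * B * N * (n * (B ^ 4 * (L + 1) * (B * B)))
        ≤ B * B * B * (B * (B ^ 4 * (L + 1) * (B * B))) := by gcongr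
      _ = B ^ 10 * (L + 1) := by ring
  have q5 : n * B * N * (B ^ 4 * (L + 1)) ≤ B ^ 10 * (L + 1) := by
    calc n * B * N * (B ^ 4 * (L + 1)) ≤ B * B * B * (B ^ 4 * (L + 1)) := by gcongr
      _ = B ^ 7 * (L + 1) := by ring
      _ ≤ B ^ 10 * (L + 1) := by gcongr; omega
  rw [pow_zero] at p0
  rw [pow_one] at p1
  rw [mul_assoc (3000 + 5 * d)]
  generalize hX : B ^ 10 * (L + 1) = X at *
  constructor
  · calc _ = 86 + 5 * n + 2 * b + 3 * (d * 1) + 2 * (d * l) + 4 * g + 4 * B + 2 * B ^ 2 + 2 * L +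
          104 * n + 4 * n + 32 * (n * N) + 21 * (n * N * n) + 8 * (n * B) +
          1200 * (n * B * N * (n * (B ^ 4 * (L + 1) * (B * B)))) := by ring
      _ ≤ _ := by nlinarith
  · calc _ = 3 * (n * B * N * (B ^ 4 * (L + 1))) := by ring
      _ ≤ _ := by nlinarith [Nat.zero_le (d * X)]

theorem ceil_logb_succ_le {δ : ℝ} (h0 : 0 < δ) (h1 : δ < 1) :
    (⌈Real.logb 2 (1 / δ)⌉₊ : ℝ) + 1 ≤ 2 * (1 + Real.log (1 / δ)) := by
  have hlog : 0 ≤ Real.log (1 / δ) := Real.log_nonneg (by rw [le_div_iff₀ h0]; linarith)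
  have h2 : Real.logb 2 (1 / δ) ≤ 2 * Real.log (1 / δ) := by
    rw [Real.logb, div_le_iff₀ (Real.log_pos (by norm_num))]
    nlinarith [Real.log_two_gt_d9]
  have := Nat.ceil_lt_add_one (Real.logb_nonneg (b := 2) (by norm_num)
    (by rw [le_div_iff₀ h0]; linarith : 1 ≤ 1 / δ))
  linarith

/-- For n ≥ 2 the added 1 is at most the logarithm to base 2, and 2 / log 2 < 3. For n = 1 the right
side vanishes and the bound fails. -/
theorem bitLen_le_log {n : ℕ} (hn : 2 ≤ n) : (bitLen n : ℝ) ≤ 3 * Real.log n := by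
  have h : (2 : ℝ) ^ Nat.log 2 n ≤ n := by exact_mod_cast Nat.pow_log_le_self 2 (by omega)
  have h1 : (Nat.log 2 n : ℝ) * Real.log 2 ≤ Real.log n := by
    rw [← Real.log_pow]
    exact Real.log_le_log (by positivity) h
  have h2 : (1 : ℝ) ≤ Nat.log 2 n := by
    exact_mod_cast Nat.log_pos (by norm_num) hn
  have := Real.log_two_gt_d9
  unfold bitLen
  push_cast
  nlinarith

/-- The constant in the bound on the running time. -/
def timeConstant (c d : ℕ) : ℝ := 2 * (3000 + 5 * d) * 2 ^ (10 * c ^ (d + 1)) + 10 * (3 * c) ^ (d + 1)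

/-- B¹⁰ = 2^(10 (c b)^(d+1)) with b ≤ 3 log n, and one of the d + 1 logarithms becomes the base n.
For n = 1 the power on the right is 1, and the first summand of `timeConstant` absorbs the left
side. -/
theorem precision_pow_le {c d n : ℕ} (hn : 1 ≤ n) :
    2 * (3000 + 5 * d) * (precision c d n : ℝ) ^ 10 ≤
      timeConstant c d * (n : ℝ) ^ (timeConstant c d * Real.log n ^ d) := by
  have hprec : precision c d n = 2 ^ (c * bitLen n) ^ (d + 1) := by
    unfold precision coneSize gateWidth; rw [pow_succ']
  have hK1 : 2 * (3000 + 5 * d) * (2 : ℝ) ^ (10 * c ^ (d + 1)) ≤ timeConstant c d := by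
    unfold timeConstant; linarith [show (0 : ℝ) ≤ 10 * (3 * c) ^ (d + 1) by positivity]
  have hK2 : 10 * (3 * c : ℝ) ^ (d + 1) ≤ timeConstant c d := by
    unfold timeConstant
    linarith [show (0 : ℝ) ≤ 2 * (3000 + 5 * d) * (2 : ℝ) ^ (10 * c ^ (d + 1)) by positivity]
  rcases hn.eq_or_lt with rfl | hn2
  · have hb : bitLen 1 = 1 := by simp [bitLen]
    rw [hprec, hb, Nat.cast_one, Real.one_rpow, mul_one, mul_one]
    push_cast
    rw [← pow_mul, mul_comm (c ^ (d + 1))]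
    exact hK1
  · have hlog : 0 < Real.log n := Real.log_pos (by exact_mod_cast hn2)
    have hK3 : 2 * (3000 + 5 * d : ℝ) ≤ timeConstant c d := by
      refine le_trans ?_ hK1
      exact le_mul_of_one_le_right (by positivity) (one_le_pow₀ (by norm_num))
    refine mul_le_mul hK3 ?_ (by positivity) (le_trans (by positivity) hK3)
    rw [Real.rpow_def_of_pos (by positivity), hprec]
    push_cast
    rw [← pow_mul, ← Real.exp_log (show (0 : ℝ) < 2 ^ _ by positivity), Real.exp_le_exp,
      Real.log_pow]
    push_cast
    have hb : (c * bitLen n : ℝ) ≤ 3 * c * Real.log n := by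
      have := mul_le_mul_of_nonneg_left (bitLen_le_log hn2) (Nat.cast_nonneg (α := ℝ) c)
      linarith
    calc ((c * bitLen n : ℝ) ^ (d + 1) * 10) * Real.log 2
        ≤ ((c * bitLen n : ℝ) ^ (d + 1) * 10) * 1 := by
          gcongr; linarith [Real.log_two_lt_d9]
      _ ≤ ((3 * c * Real.log n) ^ (d + 1) * 10) * 1 := by gcongr
      _ = Real.log n * (10 * (3 * c) ^ (d + 1) * Real.log n ^ d) := by rw [mul_pow]; ring
      _ ≤ Real.log n * (timeConstant c d * Real.log n ^ d) := by gcongr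

theorem cast_le_time_bound {c d n L x : ℕ} {δ : ℝ} (hn : 1 ≤ n)
    (hL : (L : ℝ) + 1 ≤ 2 * (1 + Real.log (1 / δ)))
    (hx : x ≤ (3000 + 5 * d) * precision c d n ^ 10 * (L + 1)) :
    (x : ℝ) ≤ timeConstant c d * (n : ℝ) ^ (timeConstant c d * Real.log n ^ d) *
      (1 + Real.log (1 / δ)) := by
  have hx' : (x : ℝ) ≤ (3000 + 5 * d) * precision c d n ^ 10 * (L + 1) := by exact_mod_cast hx
  have hpos : (0 : ℝ) ≤ 1 + Real.log (1 / δ) := by have := L.cast_nonneg (α := ℝ); linarith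
  calc (x : ℝ) ≤ (3000 + 5 * d) * precision c d n ^ 10 * (L + 1) := hx'
    _ ≤ (3000 + 5 * d) * precision c d n ^ 10 * (2 * (1 + Real.log (1 / δ))) := by gcongr
    _ = 2 * (3000 + 5 * d) * precision c d n ^ 10 * (1 + Real.log (1 / δ)) := by ring
    _ ≤ _ := mul_le_mul_of_nonneg_right (precision_pow_le hn) hpos

/-! ### The learning theorem -/

theorem Whp.ofReal_one_sub_le {n : ℕ} {U : UnitaryOp n} {P : Prog} {s : State} {G : State → Prop}
    {ε : ℝ≥0∞} {δ : ℝ} (h : Whp U P s G ε) (hδ : 0 ≤ δ) (hε : ε ≤ ENNReal.ofReal δ) :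
    ENNReal.ofReal (1 - δ) ≤ (P.run U s).toOuterMeasure {t | G t} := by
  rw [ENNReal.ofReal_sub _ hδ, ENNReal.ofReal_one, tsub_le_iff_right]
  calc (1 : ℝ≥0∞) = (P.run U s).toOuterMeasure Set.univ :=
        ((PMF.toOuterMeasure_apply_eq_one_iff _ _).2 (Set.subset_univ _)).symm
    _ ≤ (P.run U s).toOuterMeasure ({t | G t} ∪ {t | ¬ G t}) :=
        measure_mono fun t _ => em (G t)
    _ ≤ (P.run U s).toOuterMeasure {t | G t} + (P.run U s).toOuterMeasure {t | ¬ G t} :=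
        measure_union_le _ _
    _ ≤ _ := by gcongr; exact h.trans hε

theorem initialEnv_init (n : ℕ) (δ : ℝ) :
    InitialEnv n ⌈Real.logb 2 (1 / δ)⌉₊ (State.init n δ) where
  num := by simp [State.init]
  digits := by simp [State.init]
  zero q hq := by simp [State.init, show q ≠ 0 by omega, show q ≠ 1 by omega]

/-- Vacuous accuracy at failure probability 0, which turns `whp_learnProg` into a statement about
every run. -/
theorem estimatesWithin_two {n : ℕ} (U : UnitaryOp n) (T : ℕ) : EstimatesWithin U T 2 0 :=
  fun _ _ _ _ hs hT => (sure_iff_whp _ _ _).1 (sure_estimateProg hs hT)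

theorem avgDist_le_of_qubitsPrinted {n d s : ℕ} (hn : 1 ≤ n) (C : QACCircuit n d)
    {T : ℕ} (hT : T ≠ 0) {gs : List (MatrixGate (n + n))}
    (h : QubitsPrinted C.unitary (precision_ne_zero (widthFactor d s) d n) hT
      (1 / precision (widthFactor d s) d n)
      (pauliRows n (coneSize (widthFactor d s) d n) n) n gs) :
    avgDist (circuitUnitary ((List.ofFn fun q : Fin n => swapGate q) ++ gs))
      (tensorPairUnitary C.unitary (star C.unitary)) ≤ (1 / 2) ^ (bitLen n * s) := by
  have htail : TailBound C.unitary (pauliRows n (coneSize (widthFactor d s) d n) n)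
      (tailError (widthFactor d s) d n) :=
    tailBound (Nat.mul_pos (widthFactor_pos d s) (bitLen_pos n)) C
  have hnear := (h.near_tensorPair (one_le_length_pauliRows _ _ _) (by positivity)
    (tailError_nonneg _ _ _) htail).mono (learning_error_le d s hn)
  refine hnear.avgDist_le.trans ?_
  rw [← pow_mul]
  -- The distance is bounded by the square of the error; the error itself is already small enough,
  -- so the gain is discarded.
  exact pow_le_pow_of_le_one (by norm_num) (by norm_num) (Nat.le_mul_of_pos_right _ (by norm_num))

theorem learnProg_support_le {n d s : ℕ} (hn : 1 ≤ n) {δ : ℝ} (h0 : 0 < δ) (h1 : δ < 1)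
    (U : UnitaryOp n) :
    ∀ t ∈ ((learnProg (widthFactor d s) d).run U (State.init n δ)).support,
      (t.time : ℝ) ≤ timeConstant (widthFactor d s) d *
        (n : ℝ) ^ (timeConstant (widthFactor d s) d * Real.log n ^ d) * (1 + Real.log (1 / δ)) ∧
      (t.queries : ℝ) ≤ timeConstant (widthFactor d s) d *
        (n : ℝ) ^ (timeConstant (widthFactor d s) d * Real.log n ^ d) *
          (1 + Real.log (1 / δ)) := by
  have h := whp_learnProg (d := d) (widthFactor_pos d s) hn (estimatesWithin_two U _)
    (initialEnv_init n δ) rfl rfl rfl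
  simp only [mul_zero] at h
  intro t ht
  obtain ⟨ht1, ht2, -⟩ := (sure_iff_whp _ _ _).2 h t ht
  have hle := totalTime_le (c := widthFactor d s) (d := d) (by unfold widthFactor; omega) hn
    ⌈Real.logb 2 (1 / δ)⌉₊
  have hL := ceil_logb_succ_le h0 h1
  exact ⟨cast_le_time_bound hn hL (ht1.trans hle.1), cast_le_time_bound hn hL (ht2.trans hle.2)⟩

theorem learnProg_learned {n d s : ℕ} (hn : 1 ≤ n) {δ ε : ℝ} (h0 : 0 < δ)
    (hε : (1 / 2) ^ (bitLen n * s) ≤ ε) (C : QACCircuit n d) :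
    ENNReal.ofReal (1 - δ) ≤
      ((learnProg (widthFactor d s) d).run C.unitary (State.init n δ)).toOuterMeasure
        {t | t.Learned C.unitary ε} := by
  have hB : (1 : ℝ) ≤ precision (widthFactor d s) d n := by
    exact_mod_cast Nat.one_le_iff_ne_zero.2 (precision_ne_zero _ _ _)
  have h := whp_learnProg (d := d) (widthFactor_pos d s) hn
    (τ := 1 / precision (widthFactor d s) d n)
    (fun _ _ _ _ hs hT => whp_estimateProg (U := C.unitary) hs hT (by positivity)
      (by rw [div_le_one (by positivity)]; exact hB))
    (initialEnv_init n δ) rfl rfl rfl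
  refine (h.mono ?_ le_rfl).ofReal_one_sub_le h0.le ?_
  · rintro t ⟨-, -, gs, hgs, hout⟩
    exact ⟨_, hout, (avgDist_le_of_qubitsPrinted hn C _ hgs).trans hε⟩
  · rw [← ENNReal.ofReal_natCast n, ← ENNReal.ofReal_natCast (precision _ _ _),
      ← ENNReal.ofReal_natCast (List.length _), ← ENNReal.ofReal_ofNat 3,
      ← ENNReal.ofReal_mul (by positivity), ← ENNReal.ofReal_mul (by positivity),
      ← ENNReal.ofReal_mul (by positivity), ← ENNReal.ofReal_mul (by positivity)]
    exact ENNReal.ofReal_le_ofReal ((failure_le hn).trans (half_pow_ceil_logb_le h0))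

end

end QACLearning

end

theorem mainTheorem1 (d : ℕ) (p : Polynomial ℕ) (hp : p ≠ 0) :
    ∃ (P : QACLearning.Prog) (K : ℝ), ∀ n : ℕ, 1 ≤ n → ∀ δ : ℝ, 0 < δ → δ < 1 →
      ∀ C : QACLearning.QACCircuit n d,
        (∀ s ∈ (P.run C.unitary (QACLearning.State.init n δ)).support,
          (s.time : ℝ) ≤ K * (n : ℝ) ^ (K * Real.log n ^ d) * (1 + Real.log (1 / δ)) ∧
          (s.queries : ℝ) ≤ K * (n : ℝ) ^ (K * Real.log n ^ d) * (1 + Real.log (1 / δ))) ∧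
        ENNReal.ofReal (1 - δ) ≤
          (P.run C.unitary (QACLearning.State.init n δ)).toOuterMeasure
            {s | s.Learned C.unitary (1 / ((p.eval n : ℕ) : ℝ))} := by
  -- The exponent comes from `eval_le_two_pow`; it depends only on `p`, so the program and the
  -- constant are the same for all `n` and `δ`.
  refine ⟨QACLearning.learnProg (QACLearning.widthFactor d (p.eval 1 + p.natDegree)) d,
    QACLearning.timeConstant (QACLearning.widthFactor d (p.eval 1 + p.natDegree)) d,
    fun n hn δ h0 h1 C => ⟨QACLearning.learnProg_support_le hn h0 h1 C.unitary,
      QACLearning.learnProg_learned hn h0 ?_ C⟩⟩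
  have hpos : (0 : ℝ) < ((p.eval n : ℕ) : ℝ) := by exact_mod_cast QACLearning.eval_pos hp hn
  have hle := QACLearning.eval_le_two_pow p hn
  rw [_root_.one_div_pow]
  exact one_div_le_one_div_of_le hpos (by exact_mod_cast hle)
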